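/- Let $H$ be a finite simple graph with a distinguished nonempty set $R$ of roots; the set $V(H)\setminus R$ of non-roots is called the expansion set. Assume that $(R,H)$ is fully grounded, i.e. every root has at least one non-root neighbour, and symmetric, i.e. $R$ is a disjoint union of nonempty classes such that every non-root vertex either is adjacent to no root, or is adjacent to all vertices of exactly one class and to no other root. Let $k_1<\dots<k_r$ be the cardinalities of the classes, let $m_i\ge 1$ be the number of classes of size $k_i$, and let $g_{i,j}$ ($1\le i\le r$, $1\le j\le m_i$) be the number of common neighbours, in the expansion set, of the vertices of the $j$-th class of size $k_i$, where the classes are numbered so that $g_{i,1}\ge\dots\ge g_{i,m_i}$. Put $g_i=\sum_j g_{i,j}$, $g=\sum_i g_i$ and $K=\sum_i k_ig_i$. Let $s$ be the number of non-root vertices adjacent to no root, let $f$ be the number of edges of $H$ between non-root vertices, and let $c$ be the number of automorphisms of $H$ that fix every root. Let $p\in(0,1)$ be constant. For an injective map $T$ from $R$ to $[n]=\{1,\dots,n\}$, let $X(T)$ be the number of (not necessarily induced) subgraphs of the binomial random graph $G(n,p)$ that are images of the graph obtained from $H$ by deleting all edges between two roots, under injective maps $V(H)\to[n]$ extending $T$.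 Define $$a_n=\frac{n^{s+g-1}p^f}{c}\Bigl[np^{K}+\sqrt{2n\ln n}\,\sum_{i=1}^r g_i\,p^{K-k_i}\sqrt{k_ip^{k_i}(1-p^{k_i})}\Bigl(1-\frac{\ln(k_i!)}{2k_i\ln n}-\frac{\ln(4\pi k_i\ln n)}{4k_i\ln n}\Bigr)\Bigr],$$ $$b_n=\frac{n^{s+g-1}p^f}{c}\sqrt{\frac{n}{2\ln n}}\;p^{K}.$$ Then, as $n\to\infty$, $$\frac{\max_T X(T)-a_n}{b_n}\xrightarrow{d}\sum_{i=1}^r\sqrt{\frac{1-p^{k_i}}{k_ip^{k_i}}}\sum_{j=1}^{m_i}g_{i,j}\,\eta_{i,j},$$ where the maximum is over all injective maps $T:R\to[n]$, and the random vectors $\eta_i=(\eta_{i,1},\dots,\eta_{i,m_i})$, $1\le i\le r$, are mutually independent with probability densities $$e^{-x_1}e^{-x_2}\cdots e^{-x_{m_i}}\,e^{-e^{-x_{m_i}}}\,\mathbf 1\{x_1\ge x_2\ge\dots\ge x_{m_i}\}.$$ -/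

import Mathlib

open MeasureTheory ProbabilityTheory Filter

namespace RootedGraph

section Combinatorics

variable {V : Type*} (H : SimpleGraph V) (R : Finset V)

/-- `(R, H)` is fully grounded: every root has a non-root neighbour. -/
def IsFullyGrounded : Prop := ∀ u ∈ R, ∃ v, v ∉ R ∧ H.Adj u v

/-- `(R, H)` is symmetric with root classes the (nonempty, disjoint) parts of `P`: every non-root
vertex is adjacent to no root, or its root neighbours are exactly the vertices of one class. -/
def IsSymmetricWith [DecidableEq V] (P : Finpartition R) : Prop :=
  ∀ v, v ∉ R →
    (∀ u ∈ R, ¬ H.Adj v u) ∨ ∃ A ∈ P.parts, ∀ u ∈ R, (H.Adj v u ↔ u ∈ A)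

/-- The number of common neighbours, in the expansion set, of the vertices of `A`. -/
noncomputable def numCommonNbrs (A : Finset V) : ℕ :=
  {v : V | v ∉ R ∧ ∀ u ∈ A, H.Adj u v}.ncard

/-- The number `s` of vertices of the expansion set that are not adjacent to any root. -/
noncomputable def numFree : ℕ := {v : V | v ∉ R ∧ ∀ u ∈ R, ¬ H.Adj u v}.ncard

/-- The number `f` of edges of `H` induced by the expansion set. -/
noncomputable def numInnerEdges : ℕ := {e ∈ H.edgeSet | ∀ v ∈ e, v ∉ R}.ncard

/-- The number of automorphisms of `H` that fix every root. -/
noncomputable def numRootedAut : ℕ := Nat.card {σ : H ≃g H // ∀ u ∈ R, σ u = u}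

variable {H R}

/-- The subgraph `K` of `G` is an `(R, H)`-extension of the tuple `T`: it is the image of `H`, with
the edges between two roots left out, under an injection sending each root `u` to `T u`. -/
def IsExtension {W : Type*} {G : SimpleGraph W} (H : SimpleGraph V) (R : Finset V)
    (T : R ↪ W) (K : G.Subgraph) : Prop :=
  ∃ φ : V ↪ W, (∀ u : R, φ u = T u) ∧ K.verts = Set.range φ ∧
    ∀ x y, K.Adj x y ↔ ∃ u v, φ u = x ∧ φ v = y ∧ H.Adj u v ∧ ¬ (u ∈ R ∧ v ∈ R)

/-- The extension count `X(T)`: the number of (not necessarily induced) subgraphs of `G` that are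
`(R, H)`-extensions of `T`. -/
noncomputable def extCount {W : Type*} (H : SimpleGraph V) (R : Finset V) (G : SimpleGraph W)
    (T : R ↪ W) : ℕ :=
  {K : G.Subgraph | IsExtension H R T K}.ncard

/-- `max_T X(T)`, over all tuples `T` of distinct vertices indexed by the roots. -/
noncomputable def maxExtCount [DecidableEq V] {n : ℕ} (H : SimpleGraph V) (R : Finset V)
    (G : SimpleGraph (Fin n)) : ℕ :=
  Finset.univ.sup fun T : R ↪ Fin n => extCount H R G T

end Combinatorics

section Scaling

/-- The common factor `n ^ (s + g - 1) * p ^ f / c` of `a_n` and `b_n`, where `g = ∑ i, g_i`. -/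
noncomputable def prefactor (s f c : ℕ) {r : ℕ} (g : Fin r → ℕ) (p : ℝ) (n : ℕ) : ℝ :=
  (n : ℝ) ^ ((s + ∑ i, g i) - 1) * p ^ f / c

/-- The centering constants `a_n`. -/
noncomputable def centering (s f c : ℕ) {r : ℕ} (k g : Fin r → ℕ) (p : ℝ) (n : ℕ) : ℝ :=
  prefactor s f c g p n *
    (n * p ^ (∑ i, k i * g i) +
      √(2 * n * Real.log n) *
        ∑ i, g i * p ^ ((∑ l, k l * g l) - k i) * √(k i * p ^ k i * (1 - p ^ k i)) *
          (1 - Real.log ((k i).factorial) / (2 * k i * Real.log n)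
            - Real.log (4 * Real.pi * k i * Real.log n) / (4 * k i * Real.log n)))

/-- The normalizing constants `b_n`. -/
noncomputable def scaling (s f c : ℕ) {r : ℕ} (k g : Fin r → ℕ) (p : ℝ) (n : ℕ) : ℝ :=
  prefactor s f c g p n * √(n / (2 * Real.log n)) * p ^ (∑ i, k i * g i)

end Scaling

section Limit

open Classical in
/-- The function `e^{-x_1} ⋯ e^{-x_m} e^{-e^{-x_m}}` restricted to `x_1 ≥ ⋯ ≥ x_m`. -/
noncomputable def orderedGumbelDensity (m : ℕ) [NeZero m] (x : Fin m → ℝ) : ℝ :=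
  if Antitone x then
    (∏ j, Real.exp (-x j)) *
      Real.exp (-Real.exp (-x ⟨m - 1, Nat.sub_lt (NeZero.pos m) Nat.one_pos⟩))
  else 0

/-- The measure on `ℝ^m` with density `orderedGumbelDensity m`. -/
noncomputable def orderedGumbel (m : ℕ) [NeZero m] : Measure (Fin m → ℝ) :=
  volume.withDensity fun x => ENNReal.ofReal (orderedGumbelDensity m x)

end Limit

end RootedGraph

open MeasureTheory ProbabilityTheory Filter

namespace RootedGraph

/-! ### Finite product Bernoulli spaces: independence, resampling, the Harris inequality, binomial
laws. -/

section FiniteProduct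

/-! Reduction to codegrees. With high probability every set of bounded size has nearly the expected
number of common neighbours, and every two common neighbourhoods of such sets span nearly the
expected number of edges (`tendsto_pr_not_regular`). In such a configuration, homomorphisms can be
counted one edge at a time, and the remaining product of degrees can be expanded to first order. So
X(T), up to an error of smaller order than b_n, is an affine function of the codegrees of the images
of the root classes, with nonnegative coefficients (`abs_extCount_sub_le`). By the rearrangement
inequality it is largest when, for each i, the classes of size k_i go in order of decreasing g_{i,j}
to the k_i-sets of largest codegree, provided these sets are disjoint (`TopSets.sum_mul_codeg_le`).
Inserting centred and scaled codegrees turns the affine function exactly into a_n + b_n times the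
linear form of the limit (`prefactor_mul_eq_centering_add`).

Extreme codegrees. The codegree of a k-set is binomial with success probability p^k. By a local
limit theorem in the moderate deviation range (`tendsto_binom_local`), its mass at `center` + x
`spread` is asymptotically k! e^{-x} / (n^k `spread`) (`tendsto_binom_extreme`), so about e^{-x} of
the k-sets are expected above that point. The claim is that the top codegrees behave like the top
points of a Poisson process of intensity e^{-x} dx, independently for the different sizes; the
ordered Gumbel density is that of the m largest points.

Only lower bounds are needed. The limit is a probability measure, so by the portmanteau theorem it
suffices to bound from below the liminf of the probability of each open set. The events in `TopSets`
say that the classes have, under T, prescribed numbers l of outer common neighbours and that no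
other sets compete with them. If the entries of l are well separated, the sets are determined by
their ranks, so one configuration is counted for at most the product of the factorials of the class
sizes many T, and for one l each (`card_topSets_le`). Hence the probability that such an event
occurs is at least the sum of the individual probabilities divided by this constant, and no second
moment is computed.

One summand. Expose the edges that meet the image of T. The outer codegrees of the disjoint classes
are independent binomial variables. The absence of rivals is a decreasing event in the unexposed
edges, so the Harris inequality bounds its conditional probability below by a product: the k-sets
disjoint from the exposed part give a factor tending to exp(-e^{-x}), with x the position of the
last of the classes of size k, and the sets that meet it give 1 - o(1) (`pr_noRival_merge_ge`). The
latter rests on strict inequalities between constants: a set that shares vertices with an extreme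
set gains too little from it (`tilt_const`, `overlap_const`), turned into powers of n by Chernoff
bounds with sharp variance (`atypical_set_bound`, `overlap_bound`). The pointwise lower bounds are
summed over the lattice of values l by Fatou's lemma (`lintegral_le_liminf_sum`,
`le_liminf_topSets`). -/

/-- The indicator of a proposition, as a real number. -/
noncomputable def ind (P : Prop) : ℝ := by
  classical exact if P then 1 else 0

lemma ind_of_true {P : Prop} (h : P) : ind P = 1 := by simp [ind, h]

lemma ind_of_false {P : Prop} (h : ¬ P) : ind P = 0 := by simp [ind, h]

lemma ind_nonneg (P : Prop) : 0 ≤ ind P := by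
  by_cases h : P <;> simp [ind, h]

lemma ind_le_one (P : Prop) : ind P ≤ 1 := by
  by_cases h : P <;> simp [ind, h]

lemma ind_mono {P Q : Prop} (h : P → Q) : ind P ≤ ind Q := by
  by_cases hP : P
  · simp [ind_of_true hP, ind_of_true (h hP)]
  · simpa [ind_of_false hP] using ind_nonneg Q

lemma ind_congr {P Q : Prop} (h : P ↔ Q) : ind P = ind Q := by rw [propext h]

lemma ind_and (P Q : Prop) : ind (P ∧ Q) = ind P * ind Q := by
  by_cases hP : P <;> by_cases hQ : Q <;> simp [ind, hP, hQ]

lemma ind_not (P : Prop) : ind (¬ P) = 1 - ind P := by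
  by_cases hP : P <;> simp [ind, hP]

lemma ind_forall_mem {ι : Type*} (s : Finset ι) (P : ι → Prop) :
    ind (∀ i ∈ s, P i) = ∏ i ∈ s, ind (P i) := by
  classical
  induction s using Finset.induction_on with
  | empty => simp [ind]
  | insert a s ha ih => rw [Finset.prod_insert ha, ← ih, ← ind_and]; simp

lemma ind_forall {ι : Type*} [Fintype ι] (P : ι → Prop) :
    ind (∀ i, P i) = ∏ i, ind (P i) := by
  simpa using ind_forall_mem Finset.univ P

lemma ind_exists_mem_le {ι : Type*} (s : Finset ι) (P : ι → Prop) :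
    ind (∃ i ∈ s, P i) ≤ ∑ i ∈ s, ind (P i) := by
  by_cases h : ∃ i ∈ s, P i
  · obtain ⟨i, hi, hP⟩ := h
    calc ind _ ≤ 1 := ind_le_one _
      _ = ind (P i) := (ind_of_true hP).symm
      _ ≤ _ := Finset.single_le_sum (f := fun i => ind (P i)) (fun i _ => ind_nonneg _) hi
  · rw [ind_of_false h]; exact Finset.sum_nonneg fun i _ => ind_nonneg _

lemma card_filter_eq_sum_ind {α : Type*} (s : Finset α) (P : α → Prop) [DecidablePred P] :
    ((s.filter P).card : ℝ) = ∑ a ∈ s, ind (P a) := by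
  rw [Finset.card_filter]; push_cast
  exact Finset.sum_congr rfl fun a _ => by by_cases h : P a <;> simp [ind, h]

variable {E : Type*}

/-- The configuration that agrees with `ω` on `Q` and with `ω'` off `Q`. -/
noncomputable def merge (Q : Set E) (ω ω' : E → Bool) : E → Bool := by
  classical exact fun e => if e ∈ Q then ω e else ω' e

lemma merge_of_mem {Q : Set E} {e : E} (h : e ∈ Q) (ω ω' : E → Bool) : merge Q ω ω' e = ω e := by
  simp [merge, h]

lemma merge_of_notMem {Q : Set E} {e : E} (h : e ∉ Q) (ω ω' : E → Bool) :
    merge Q ω ω' e = ω' e := by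
  simp [merge, h]

lemma dependsOn_prod {ι : Type*} {s : Finset ι} {f : ι → (E → Bool) → ℝ} {Q : ι → Set E}
    (h : ∀ i ∈ s, DependsOn (f i) (Q i)) :
    DependsOn (fun ω => ∏ i ∈ s, f i ω) (⋃ i ∈ s, Q i) := fun _ _ hxy =>
  Finset.prod_congr rfl fun i hi => h i hi fun e he => hxy e (Set.mem_biUnion hi he)

variable [Fintype E] {p : ℝ}

/-- The weight of a configuration under the product of Bernoulli measures. -/
noncomputable def wt (p : ℝ) (ω : E → Bool) : ℝ := ∏ e, if ω e then p else 1 - p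

lemma wt_nonneg (hp : p ∈ Set.Icc (0 : ℝ) 1) (ω : E → Bool) : 0 ≤ wt p ω :=
  Finset.prod_nonneg fun e _ => by split_ifs <;> linarith [hp.1, hp.2]

variable [DecidableEq E]

/-- The expectation under the product of Bernoulli measures. -/
noncomputable def ex (p : ℝ) (f : (E → Bool) → ℝ) : ℝ := ∑ ω, wt p ω * f ω

/-- The probability of an event under the product of Bernoulli measures. -/
noncomputable def pr (p : ℝ) (P : (E → Bool) → Prop) : ℝ := ex p fun ω => ind (P ω)

/-- The expectation of a product of functions of single coordinates. -/
lemma ex_prod_coord (p : ℝ) (h : E → Bool → ℝ) :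
    ex p (fun ω => ∏ e, h e (ω e)) = ∏ e, (p * h e true + (1 - p) * h e false) := by
  have : ∀ e, p * h e true + (1 - p) * h e false
      = ∑ b : Bool, (if b then p else 1 - p) * h e b := by intro e; simp
  simp_rw [this]
  rw [Finset.prod_univ_sum, Fintype.piFinset_univ]
  simp only [ex, wt, Finset.prod_mul_distrib]

lemma ex_const (p c : ℝ) : ex (E := E) p (fun _ => c) = c := by
  have h := ex_prod_coord (E := E) p (fun _ _ => 1)
  simp only [ex, mul_one, Finset.prod_const_one] at h ⊢
  rw [← Finset.sum_mul, h]; simp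

lemma ex_add (p : ℝ) (f g : (E → Bool) → ℝ) :
    ex p (fun ω => f ω + g ω) = ex p f + ex p g := by
  simp [ex, mul_add, Finset.sum_add_distrib]

lemma ex_sub (p : ℝ) (f g : (E → Bool) → ℝ) :
    ex p (fun ω => f ω - g ω) = ex p f - ex p g := by
  simp [ex, mul_sub, Finset.sum_sub_distrib]

lemma ex_const_mul (p c : ℝ) (f : (E → Bool) → ℝ) :
    ex p (fun ω => c * f ω) = c * ex p f := by
  simp only [ex, Finset.mul_sum]; exact Finset.sum_congr rfl fun _ _ => by ring

lemma ex_mul_const (p c : ℝ) (f : (E → Bool) → ℝ) :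
    ex p (fun ω => f ω * c) = ex p f * c := by
  simp only [ex, Finset.sum_mul]; exact Finset.sum_congr rfl fun _ _ => by ring

lemma ex_sum {ι : Type*} (p : ℝ) (s : Finset ι) (f : ι → (E → Bool) → ℝ) :
    ex p (fun ω => ∑ i ∈ s, f i ω) = ∑ i ∈ s, ex p (f i) := by
  simp only [ex, Finset.mul_sum]; exact Finset.sum_comm

lemma ex_mono (hp : p ∈ Set.Icc (0 : ℝ) 1) {f g : (E → Bool) → ℝ} (h : ∀ ω, f ω ≤ g ω) :
    ex p f ≤ ex p g :=
  Finset.sum_le_sum fun ω _ => mul_le_mul_of_nonneg_left (h ω) (wt_nonneg hp ω)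

lemma ex_nonneg (hp : p ∈ Set.Icc (0 : ℝ) 1) {f : (E → Bool) → ℝ} (h : ∀ ω, 0 ≤ f ω) :
    0 ≤ ex p f :=
  Finset.sum_nonneg fun ω _ => mul_nonneg (wt_nonneg hp ω) (h ω)

lemma pr_nonneg (hp : p ∈ Set.Icc (0 : ℝ) 1) (P : (E → Bool) → Prop) : 0 ≤ pr p P :=
  ex_nonneg hp fun _ => ind_nonneg _

lemma pr_le_one (hp : p ∈ Set.Icc (0 : ℝ) 1) (P : (E → Bool) → Prop) : pr p P ≤ 1 :=
  (ex_mono hp fun _ => ind_le_one _).trans (ex_const p 1).le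

lemma pr_mono (hp : p ∈ Set.Icc (0 : ℝ) 1) {P Q : (E → Bool) → Prop} (h : ∀ ω, P ω → Q ω) :
    pr p P ≤ pr p Q :=
  ex_mono hp fun ω => ind_mono (h ω)

lemma pr_congr {P Q : (E → Bool) → Prop} (h : ∀ ω, P ω ↔ Q ω) : pr p P = pr p Q := by
  have : P = Q := funext fun ω => propext (h ω)
  rw [this]

lemma pr_not (P : (E → Bool) → Prop) : pr p (fun ω => ¬ P ω) = 1 - pr p P := by
  simp only [pr, ind_not, ex_sub, ex_const]

lemma pr_exists_mem_le {ι : Type*} (hp : p ∈ Set.Icc (0 : ℝ) 1) (s : Finset ι)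
    (P : ι → (E → Bool) → Prop) :
    pr p (fun ω => ∃ i ∈ s, P i ω) ≤ ∑ i ∈ s, pr p (P i) := by
  unfold pr
  rw [← ex_sum]
  exact ex_mono hp fun ω => ind_exists_mem_le s fun i => P i ω

lemma pr_or_le (hp : p ∈ Set.Icc (0 : ℝ) 1) (P Q : (E → Bool) → Prop) :
    pr p (fun ω => P ω ∨ Q ω) ≤ pr p P + pr p Q := by
  unfold pr
  rw [← ex_add]
  refine ex_mono hp fun ω => ?_
  by_cases hP : P ω <;> by_cases hQ : Q ω <;> simp [ind, hP, hQ]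

/-- Resampling the coordinates off `Q` does not change the law. -/
lemma ex_merge (p : ℝ) (Q : Set E) (f : (E → Bool) → ℝ) :
    ex p f = ex p fun ω => ex p fun ω' => f (merge Q ω ω') := by
  have h1 : ex p f = ∑ x : (E → Bool) × (E → Bool), wt p x.1 * wt p x.2 * f x.1 := by
    have h := ex_const (E := E) p 1
    simp only [ex, mul_one] at h
    rw [Fintype.sum_prod_type]
    simp only [ex]
    refine Finset.sum_congr rfl fun ω _ => ?_
    calc wt p ω * f ω = (∑ ω' : E → Bool, wt p ω') * (wt p ω * f ω) := by rw [h]; ring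
      _ = _ := by rw [Finset.sum_mul]; exact Finset.sum_congr rfl fun _ _ => by ring
  have h2 : (ex p fun ω => ex p fun ω' => f (merge Q ω ω'))
      = ∑ x : (E → Bool) × (E → Bool), wt p x.1 * wt p x.2 * f (merge Q x.1 x.2) := by
    rw [Fintype.sum_prod_type]
    simp only [ex, Finset.mul_sum, mul_assoc]
  rw [h1, h2]
  -- Exchanging the coordinates off `Q` between the two configurations is an involution that
  -- preserves the product of the two weights.
  let σ : (E → Bool) × (E → Bool) → (E → Bool) × (E → Bool) :=
    fun x => (merge Q x.1 x.2, merge Q x.2 x.1)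
  have hσ : Function.Involutive σ := by
    rintro ⟨a, b⟩
    ext e <;> by_cases h : e ∈ Q <;> simp [σ, merge, h]
  refine (Fintype.sum_equiv hσ.toPerm _ _ fun x => ?_).symm
  simp only [Function.Involutive.coe_toPerm, σ]
  congr 1
  simp only [wt, ← Finset.prod_mul_distrib]
  refine Finset.prod_congr rfl fun e _ => ?_
  by_cases h : e ∈ Q <;> simp [merge, h, mul_comm]

lemma ex_mul_of_dependsOn (p : ℝ) {Q Q' : Set E} (hQ : Disjoint Q Q') {f g : (E → Bool) → ℝ}
    (hf : DependsOn f Q) (hg : DependsOn g Q') :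
    ex p (fun ω => f ω * g ω) = ex p f * ex p g := by
  rw [ex_merge p Q]
  have : ∀ ω ω' : E → Bool, f (merge Q ω ω') * g (merge Q ω ω') = f ω * g ω' := fun ω ω' => by
    rw [hf (fun e he => merge_of_mem he ω ω'),
      hg (fun e he => merge_of_notMem (fun h => Set.disjoint_left.1 hQ h he) ω ω')]
  simp only [this, ex_const_mul, ex_mul_const]

lemma ex_prod_of_dependsOn {ι : Type*} (p : ℝ) (s : Finset ι) {f : ι → (E → Bool) → ℝ}
    {Q : ι → Set E} (h : ∀ i ∈ s, DependsOn (f i) (Q i))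
    (hQ : (s : Set ι).PairwiseDisjoint Q) :
    ex p (fun ω => ∏ i ∈ s, f i ω) = ∏ i ∈ s, ex p (f i) := by
  classical
  induction s using Finset.induction_on with
  | empty => simp [ex_const]
  | insert a s ha ih =>
    simp only [Finset.prod_insert ha]
    rw [← ih (fun i hi => h i (Finset.mem_insert_of_mem hi))
      (hQ.subset (by simp)), ex_mul_of_dependsOn p (Q := Q a) (Q' := ⋃ i ∈ s, Q i) ?_
      (h a (Finset.mem_insert_self _ _))
      (dependsOn_prod fun i hi => h i (Finset.mem_insert_of_mem hi))]
    simp only [Set.disjoint_iUnion_right]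
    intro i hi
    exact hQ (by simp) (by simp [hi]) (by rintro rfl; exact ha hi)

/-- The probability that all coordinates in `F` are present. -/
lemma pr_forall_mem (p : ℝ) (F : Finset E) : pr p (fun ω : E → Bool => ∀ e ∈ F, ω e = true)
    = p ^ F.card := by
  have h := ex_prod_coord (E := E) p (fun e b => if e ∈ F then ind (b = true) else 1)
  have h2 : ∀ e : E, p * (if e ∈ F then ind (true = true) else 1)
      + (1 - p) * (if e ∈ F then ind (false = true) else 1) = if e ∈ F then p else 1 := by
    intro e; by_cases he : e ∈ F <;> simp [he, ind]
  rw [Finset.prod_congr rfl fun e _ => h2 e] at h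
  rw [Finset.prod_ite_mem, Finset.univ_inter, Finset.prod_const] at h
  rw [pr, ← h]
  congr 1; ext ω
  rw [ind_forall_mem, Finset.prod_ite_mem, Finset.univ_inter]

/-- **Harris inequality** for two nonnegative decreasing functions. -/
lemma ex_mul_ge_of_antitone (hp : p ∈ Set.Icc (0 : ℝ) 1) {f g : (E → Bool) → ℝ}
    (hf0 : ∀ ω, 0 ≤ f ω) (hg0 : ∀ ω, 0 ≤ g ω) (hf : Antitone f) (hg : Antitone g) :
    ex p f * ex p g ≤ ex p fun ω => f ω * g ω := by
  -- The FKG lattice condition holds with equality for product weights. The order dual turns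
  -- decreasing functions into increasing ones, which is the form that `fkg` takes.
  have hmod : ∀ a b : (E → Bool)ᵒᵈ, wt p (OrderDual.ofDual a) * wt p (OrderDual.ofDual b) ≤
      wt p (OrderDual.ofDual (a ⊓ b)) * wt p (OrderDual.ofDual (a ⊔ b)) := by
    intro a b
    apply le_of_eq
    simp only [wt, ← Finset.prod_mul_distrib, ofDual_inf, ofDual_sup]
    refine Finset.prod_congr rfl fun e _ => ?_
    have : ∀ x y : Bool, (if x then p else 1 - p) * (if y then p else 1 - p) =
        (if x ⊔ y then p else 1 - p) * (if x ⊓ y then p else 1 - p) := by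
      intro x y; cases x <;> cases y <;> simp [mul_comm]
    exact this _ _
  have h := fkg (α := (E → Bool)ᵒᵈ) (μ := fun a => wt p (OrderDual.ofDual a))
    (f := fun a => f (OrderDual.ofDual a)) (g := fun a => g (OrderDual.ofDual a))
    (fun a => wt_nonneg hp _) (fun a => hf0 _) (fun a => hg0 _)
    (fun a b hab => hf hab) (fun a b hab => hg hab) hmod
  have h1 : ∀ F : (E → Bool) → ℝ, (∑ a : (E → Bool)ᵒᵈ, wt p (OrderDual.ofDual a) *
      F (OrderDual.ofDual a)) = ex p F := fun F =>
    Fintype.sum_equiv OrderDual.ofDual _ _ fun _ => rfl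
  have h2 : (∑ a : (E → Bool)ᵒᵈ, wt p (OrderDual.ofDual a)) = 1 := by
    have := h1 fun _ => 1
    rw [ex_const] at this
    simpa using this
  rw [h1 f, h1 g, h2, one_mul, h1 fun ω => f ω * g ω] at h
  exact h

/-- **Harris inequality** for finitely many decreasing events. -/
lemma prod_pr_le_of_antitone {ι : Type*} (hp : p ∈ Set.Icc (0 : ℝ) 1) (s : Finset ι)
    (A : ι → (E → Bool) → Prop) (hA : ∀ i ∈ s, ∀ ω ω', ω ≤ ω' → A i ω' → A i ω) :
    ∏ i ∈ s, pr p (A i) ≤ pr p fun ω => ∀ i ∈ s, A i ω := by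
  classical
  induction s using Finset.induction_on with
  | empty => simp [pr, ind, ex_const]
  | insert a s ha ih =>
    rw [Finset.prod_insert ha]
    have ih' := ih fun i hi => hA i (Finset.mem_insert_of_mem hi)
    calc _ ≤ pr p (A a) * pr p fun ω => ∀ i ∈ s, A i ω :=
          mul_le_mul_of_nonneg_left ih' (pr_nonneg hp _)
      _ ≤ ex p fun ω => ind (A a ω) * ind (∀ i ∈ s, A i ω) :=
          ex_mul_ge_of_antitone hp (fun _ => ind_nonneg _) (fun _ => ind_nonneg _)
            (fun ω ω' h => ind_mono (hA a (Finset.mem_insert_self _ _) ω ω' h))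
            (fun ω ω' h => ind_mono fun h' i hi =>
              hA i (Finset.mem_insert_of_mem hi) ω ω' h (h' i hi))
      _ = _ := by
          simp only [pr, ← ind_and]
          congr 1; ext ω; apply ind_congr; simp

/-- The probability mass function of the binomial distribution. -/
noncomputable def binom (N : ℕ) (q : ℝ) (l : ℕ) : ℝ := N.choose l * q ^ l * (1 - q) ^ (N - l)

/-- The number of occurrences among independent events of probability `q` is binomial. -/
lemma pr_card_filter_eq {α : Type*} [DecidableEq α] (p q : ℝ) (s : Finset α)
    (A : α → (E → Bool) → Prop) [∀ ω, DecidablePred fun v => A v ω] {Q : α → Set E}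
    (hA : ∀ v ∈ s, DependsOn (A v) (Q v))
    (hQ : (s : Set α).PairwiseDisjoint Q) (hq : ∀ v ∈ s, pr p (A v) = q) (l : ℕ) :
    pr p (fun ω => (s.filter fun v => A v ω).card = l) = binom s.card q l := by
  classical
  -- The event is split according to the set `U` of indices whose events occur; each set of size `l`
  -- has the same probability.
  have key : ∀ U ∈ s.powersetCard l,
      ex p (fun ω => ∏ v ∈ s, ind (A v ω ↔ v ∈ U)) = q ^ l * (1 - q) ^ (s.card - l) := by
    intro U hU
    obtain ⟨hUs, hUl⟩ := Finset.mem_powersetCard.1 hU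
    rw [ex_prod_of_dependsOn p s (Q := Q) (fun v hv x y hxy => by rw [hA v hv hxy]) hQ]
    have : ∀ v ∈ s, ex p (fun ω => ind (A v ω ↔ v ∈ U)) = if v ∈ U then q else 1 - q := by
      intro v hv
      split_ifs with h
      · rw [← hq v hv]; exact congrArg _ (funext fun ω => ind_congr (by simp [h]))
      · rw [← hq v hv, ← pr_not]; exact congrArg _ (funext fun ω => ind_congr (by simp [h]))
    rw [Finset.prod_congr rfl this, Finset.prod_ite, Finset.prod_const, Finset.prod_const]
    have e1 : s.filter (· ∈ U) = U := by ext v; simp; exact fun h => hUs h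
    have e2 : (s.filter (· ∉ U)).card = s.card - l := by
      rw [← Finset.sdiff_eq_filter, Finset.card_sdiff_of_subset hUs, hUl]
    rw [e1, e2, hUl]
  have h1 : ∀ ω, ind ((s.filter fun v => A v ω).card = l)
      = ∑ U ∈ s.powersetCard l, ∏ v ∈ s, ind (A v ω ↔ v ∈ U) := by
    intro ω
    simp only [← ind_forall_mem]
    have : ∀ U ∈ s.powersetCard l, ind (∀ v ∈ s, (A v ω ↔ v ∈ U))
        = if U = s.filter fun v => A v ω then 1 else 0 := by
      intro U hU
      obtain ⟨hUs, hUl⟩ := Finset.mem_powersetCard.1 hU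
      have : (∀ v ∈ s, (A v ω ↔ v ∈ U)) ↔ U = s.filter fun v => A v ω := by
        constructor
        · intro h; ext v; simp only [Finset.mem_filter]
          exact ⟨fun hv => ⟨hUs hv, (h v (hUs hv)).2 hv⟩, fun hv => (h v hv.1).1 hv.2⟩
        · intro h v hv; rw [h]; simp [hv]
      simp [ind, this]
    rw [Finset.sum_congr rfl this, Finset.sum_ite_eq']
    simp [ind, Finset.mem_powersetCard]
  simp only [pr, h1]
  rw [ex_sum, Finset.sum_congr rfl key, Finset.sum_const, Finset.card_powersetCard, binom,
    nsmul_eq_mul, mul_assoc]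

end FiniteProduct

/-! ### Chernoff bounds with the exact variance in the leading term. -/

section Chernoff

lemma exp_le_one_add_add_sq {y : ℝ} (hy : |y| ≤ 1) :
    Real.exp y ≤ 1 + y + y ^ 2 / 2 + |y| ^ 3 := by
  have h := Real.exp_bound hy (n := 3) (by norm_num)
  have h2 : |Real.exp y - (1 + y + y ^ 2 / 2)| ≤ |y| ^ 3 * (4 / 18) := by
    convert h using 2
    · simp [Finset.sum_range_succ, Nat.factorial]
    · norm_num [Nat.factorial]
  have h3 := (abs_le.1 h2).2
  have : 0 ≤ |y| ^ 3 := by positivity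
  linarith

variable {E : Type*} [Fintype E] [DecidableEq E] {p : ℝ}

/-- A bound on the moment generating function of a bounded variable, with the variance in the
leading term. -/
lemma ex_exp_le (hp : p ∈ Set.Icc (0 : ℝ) 1) {Y : (E → Bool) → ℝ} {τ : ℝ} (hτ : τ ≤ 1 / 4)
    (hY : ∀ ω, |Y ω| ≤ τ) :
    ex p (fun ω => Real.exp (Y ω)) ≤
      Real.exp (ex p Y + (ex p (fun ω => Y ω ^ 2) - ex p Y ^ 2) / 2 + 8 * τ ^ 3) := by
  set μ := ex p Y with hμ
  have hτ0 : 0 ≤ τ := (abs_nonneg _).trans (hY fun _ => false)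
  have hμτ : |μ| ≤ τ := by
    refine abs_le.2 ⟨?_, ?_⟩
    · simpa [ex_const] using ex_mono hp (f := fun _ => -τ) (g := Y) fun ω => (abs_le.1 (hY ω)).1
    · simpa [ex_const] using ex_mono hp (g := fun _ => τ) (f := Y) fun ω => (abs_le.1 (hY ω)).2
  have hY' : ∀ ω, |Y ω - μ| ≤ 2 * τ := fun ω =>
    (abs_sub _ _).trans (by linarith [hY ω])
  have hvar : ex p (fun ω => (Y ω - μ) ^ 2) = ex p (fun ω => Y ω ^ 2) - μ ^ 2 := by
    have : (fun ω => (Y ω - μ) ^ 2) = fun ω => (Y ω ^ 2 - 2 * μ * Y ω) + μ ^ 2 := by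
      ext ω; ring
    rw [this, ex_add, ex_sub, ex_const_mul, ex_const]; ring
  have hcen : ex p (fun ω => Y ω - μ) = 0 := by rw [ex_sub, ex_const]; simp [hμ]
  -- The linear term vanishes after centring. The centred variable is at most 2τ ≤ 1/2 in absolute
  -- value, so the cubic Taylor remainder is at most (2τ)³ = 8τ³.
  have h1 : ex p (fun ω => Real.exp (Y ω - μ)) ≤
      1 + (ex p (fun ω => Y ω ^ 2) - μ ^ 2) / 2 + 8 * τ ^ 3 := by
    calc _ ≤ ex p (fun ω => (1 + (Y ω - μ)) + ((1 / 2) * (Y ω - μ) ^ 2 + 8 * τ ^ 3)) := by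
          refine ex_mono hp fun ω => ?_
          have h := exp_le_one_add_add_sq (y := Y ω - μ) ((hY' ω).trans (by linarith))
          have : |Y ω - μ| ^ 3 ≤ (2 * τ) ^ 3 := pow_le_pow_left₀ (abs_nonneg _) (hY' ω) 3
          nlinarith
      _ = _ := by
          rw [ex_add, ex_add, ex_add, ex_const, hcen, ex_const_mul, hvar, ex_const]; ring
  have h2 : (fun ω => Real.exp (Y ω)) = fun ω => Real.exp μ * Real.exp (Y ω - μ) := by
    ext ω; rw [← Real.exp_add]; ring_nf
  rw [h2, ex_const_mul]
  calc _ ≤ Real.exp μ * Real.exp ((ex p (fun ω => Y ω ^ 2) - μ ^ 2) / 2 + 8 * τ ^ 3) := by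
        refine mul_le_mul_of_nonneg_left (h1.trans ?_) (Real.exp_pos _).le
        have := Real.add_one_le_exp ((ex p (fun ω => Y ω ^ 2) - μ ^ 2) / 2 + 8 * τ ^ 3)
        linarith
    _ = _ := by rw [← Real.exp_add]; ring_nf

/-- A Chernoff bound for a sum of independent bounded variables. -/
lemma pr_sum_ge_le {α : Type*} (hp : p ∈ Set.Icc (0 : ℝ) 1) (s : Finset α)
    {Y : α → (E → Bool) → ℝ} {Q : α → Set E} {τ μ V t : ℝ}
    (hdep : ∀ v ∈ s, DependsOn (Y v) (Q v)) (hQ : (s : Set α).PairwiseDisjoint Q)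
    (hτ : τ ≤ 1 / 4) (hY : ∀ v ∈ s, ∀ ω, |Y v ω| ≤ τ) (hμ : ∀ v ∈ s, ex p (Y v) = μ)
    (hV : ∀ v ∈ s, ex p (fun ω => Y v ω ^ 2) - μ ^ 2 ≤ V) :
    pr p (fun ω => t ≤ ∑ v ∈ s, Y v ω) ≤
      Real.exp (-t + s.card * (μ + V / 2 + 8 * τ ^ 3)) := by
  calc _ ≤ ex p (fun ω => Real.exp (-t) * Real.exp (∑ v ∈ s, Y v ω)) := by
        refine ex_mono hp fun ω => ?_
        rw [← Real.exp_add]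
        by_cases h : t ≤ ∑ v ∈ s, Y v ω
        · rw [ind_of_true h]; exact Real.one_le_exp (by linarith)
        · rw [ind_of_false h]; positivity
    _ = Real.exp (-t) * ∏ v ∈ s, ex p (fun ω => Real.exp (Y v ω)) := by
        rw [ex_const_mul]
        simp only [Real.exp_sum]
        rw [ex_prod_of_dependsOn p s (Q := Q) (fun v hv x y hxy => by rw [hdep v hv hxy]) hQ]
    _ ≤ Real.exp (-t) * ∏ v ∈ s, Real.exp (μ + V / 2 + 8 * τ ^ 3) := by
        refine mul_le_mul_of_nonneg_left (Finset.prod_le_prod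
          (fun v _ => ex_nonneg hp fun _ => (Real.exp_pos _).le) fun v hv => ?_) (Real.exp_pos _).le
        refine (ex_exp_le hp hτ (hY v hv)).trans (Real.exp_le_exp.2 ?_)
        have := hV v hv
        rw [hμ v hv]; linarith
    _ = _ := by rw [Finset.prod_const, ← Real.exp_nat_mul, ← Real.exp_add]

end Chernoff

/-! ### Transfer between Bernoulli configurations and the binomial random graph. -/

section RandomGraph

variable {W : Type*}

/-- The simple graph whose edges are the non-loops marked by `ω`. -/
def graphOf (ω : Sym2 W → Bool) : SimpleGraph W := SimpleGraph.fromEdgeSet {e | ω e = true}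

lemma graphOf_adj {ω : Sym2 W → Bool} {a b : W} :
    (graphOf ω).Adj a b ↔ ω s(a, b) = true ∧ a ≠ b := by
  simp [graphOf]

variable [Fintype W] [DecidableEq W]

/-- Coordinates are indexed by all unordered pairs, loops included. The event leaves the loop
coordinates free, so each of them contributes a factor 1, and the other pairs contribute p or 1 - p,
as in the binomial random graph. -/
lemma pr_graphOf_eq (p : unitInterval) (G : SimpleGraph W) :
    pr (p : ℝ) (fun ω => graphOf ω = G) =
      (SimpleGraph.binomialRandom W p).real {G} := by
  classical
  have h1 : ∀ ω : Sym2 W → Bool, ind (graphOf ω = G) =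
      ∏ e, if e.IsDiag then 1 else ind (ω e = true ↔ e ∈ G.edgeSet) := by
    intro ω
    have : ∀ e : Sym2 W, (if e.IsDiag then 1 else ind (ω e = true ↔ e ∈ G.edgeSet)) =
        ind (¬ e.IsDiag → (ω e = true ↔ e ∈ G.edgeSet)) := by
      intro e; by_cases he : e.IsDiag <;> simp [he, ind]
    simp only [this, ← ind_forall]
    apply ind_congr
    constructor
    · rintro rfl e he
      induction e with | _ a b => simpa [graphOf_adj] using fun _ => he
    · intro h
      ext a b
      rw [graphOf_adj]
      by_cases hab : a = b
      · simp [hab]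
      · simpa [hab] using h s(a, b) (by simpa using hab)
  have h2 := ex_prod_coord (E := Sym2 W) (p : ℝ)
    (fun e b => if e.IsDiag then 1 else ind (b = true ↔ e ∈ G.edgeSet))
  rw [pr]
  simp only [h1]
  rw [h2]
  have h3 : ∀ e : Sym2 W, (p : ℝ) * (if e.IsDiag then 1 else ind (true = true ↔ e ∈ G.edgeSet)) +
      (1 - p) * (if e.IsDiag then 1 else ind (false = true ↔ e ∈ G.edgeSet)) =
      if e.IsDiag then 1 else if e ∈ G.edgeSet then (p : ℝ) else 1 - p := by
    intro e
    by_cases he : e.IsDiag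
    · simp [he]
    · by_cases hG : e ∈ G.edgeSet <;> simp [he, hG, ind]
  rw [Finset.prod_congr rfl fun e _ => h3 e, measureReal_def, SimpleGraph.binomialRandom_singleton]
  rw [Finset.prod_ite, Finset.prod_const_one, one_mul, Finset.prod_ite, Finset.prod_const,
    Finset.prod_const]
  have c1 : ((Finset.univ.filter fun e : Sym2 W => ¬ e.IsDiag).filter (· ∈ G.edgeSet)).card =
      G.edgeSet.ncard := by
    rw [Set.ncard_eq_toFinset_card']
    congr 1; ext e
    simp only [Finset.mem_filter, Finset.mem_univ, true_and, Set.mem_toFinset]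
    exact ⟨fun h => h.2, fun h => ⟨G.not_isDiag_of_mem_edgeSet h, h⟩⟩
  have c2 : (Finset.univ.filter fun e : Sym2 W => ¬ e.IsDiag).card = (Nat.card W).choose 2 := by
    rw [Nat.card_eq_fintype_card, ← Sym2.card_subtype_not_diag, Fintype.card_subtype]
  have c3 := Finset.card_filter_add_card_filter_not (s := Finset.univ.filter fun e : Sym2 W => ¬ e.IsDiag)
    (· ∈ G.edgeSet)
  rw [c1, c2] at c3
  rw [c1, ← c3, Nat.add_sub_cancel_left, ENNReal.toReal_mul, ENNReal.toReal_pow,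
    ENNReal.toReal_pow]
  rfl

omit [DecidableEq W] in
lemma measurableSet_simpleGraph (S : Set (SimpleGraph W)) : MeasurableSet S := by
  have h : ∀ G : SimpleGraph W, MeasurableSet {G} := fun G => by
    have : ({G} : Set (SimpleGraph W)) = SimpleGraph.edgeSet ⁻¹' {G.edgeSet} := by
      ext G'; simp
    rw [this]
    exact SimpleGraph.measurable_edgeSet (measurableSet_singleton _)
  have : MeasurableSingletonClass (SimpleGraph W) := ⟨h⟩
  exact S.toFinite.measurableSet

lemma pr_graphOf_mem (p : unitInterval) (S : Set (SimpleGraph W)) :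
    pr (p : ℝ) (fun ω => graphOf ω ∈ S) = (SimpleGraph.binomialRandom W p).real S := by
  classical
  have hS : S = ⋃ G ∈ S.toFinite.toFinset, {G} := by ext; simp
  have h1 : (SimpleGraph.binomialRandom W p).real S =
      ∑ G ∈ S.toFinite.toFinset, (SimpleGraph.binomialRandom W p).real {G} := by
    conv_lhs => rw [hS]
    rw [measureReal_biUnion_finset]
    · intro a _ b _ hab; simpa using hab
    · intro b _; exact measurableSet_simpleGraph _
  rw [h1]
  simp only [← pr_graphOf_eq, pr]
  rw [← ex_sum]
  congr 1; ext ω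
  simp only [ind, Finset.sum_ite_eq]
  simp

end RandomGraph

/-! ### The local limit theorem for binomial probabilities, from Stirling's formula. -/

section LocalLimit

open Topology

/-- Relative entropy is a sum of terms of this shape. The cubic error here is what makes |l - Nq|³ /
N² → 0 the natural range of the local limit theorem. -/
lemma abs_one_add_mul_log_sub_le {u : ℝ} (hu : |u| ≤ 1 / 2) :
    |(1 + u) * Real.log (1 + u) - (u + u ^ 2 / 2)| ≤ 4 * |u| ^ 3 := by
  have h := Real.abs_log_sub_add_sum_range_le (x := -u) (by rw [abs_neg]; linarith) 2
  simp only [Finset.sum_range_succ, Finset.sum_range_zero, abs_neg, sub_neg_eq_add] at h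
  have h1 : |Real.log (1 + u) - (u - u ^ 2 / 2)| ≤ 2 * |u| ^ 3 := by
    have e : Real.log (1 + u) - (u - u ^ 2 / 2) = 0 + (-u) ^ (0 + 1) / ((0 : ℕ) + 1) +
      (-u) ^ (1 + 1) / ((1 : ℕ) + 1) + Real.log (1 + u) := by push_cast; ring
    rw [e]
    refine h.trans ?_
    rw [div_le_iff₀ (by linarith), show 2 + 1 = 3 from rfl]
    have := mul_nonneg (pow_nonneg (abs_nonneg u) 3) (sub_nonneg.2 hu)
    linarith
  have e : (1 + u) * Real.log (1 + u) - (u + u ^ 2 / 2) =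
      (1 + u) * (Real.log (1 + u) - (u - u ^ 2 / 2)) + - (u ^ 3 / 2) := by ring
  rw [e]
  refine (abs_add_le _ _).trans ?_
  rw [abs_mul, abs_neg, abs_div, abs_pow]
  have h2 : |1 + u| ≤ 3 / 2 := (abs_add_le _ _).trans (by rw [abs_one]; linarith)
  have : |1 + u| * |Real.log (1 + u) - (u - u ^ 2 / 2)| ≤ 3 / 2 * (2 * |u| ^ 3) :=
    mul_le_mul h2 h1 (abs_nonneg _) (by norm_num)
  have h3 := pow_nonneg (abs_nonneg u) 3
  rw [abs_two]
  linarith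

/-- An exact form of Stirling's approximation: each factorial is written through
`Stirling.stirlingSeq`. This isolates a ratio of Stirling factors, a ratio of variances, and the
exponential of minus the relative entropy, which can then be treated separately. -/
lemma binom_mul_eq {N l : ℕ} {q : ℝ} (hq0 : 0 < q) (hq1 : q < 1) (hl0 : 0 < l) (hlN : l < N) :
    binom N q l * √(2 * Real.pi * N * q * (1 - q)) =
      (Stirling.stirlingSeq N * √Real.pi /
        (Stirling.stirlingSeq l * Stirling.stirlingSeq (N - l))) *
      √((q / (l / N)) * ((1 - q) / (1 - l / N))) *
      Real.exp (-(l * Real.log (l / (N * q)) +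
        (N - l : ℝ) * Real.log ((N - l) / (N * (1 - q))))) := by
  have hN0 : (0 : ℝ) < N := by exact_mod_cast hl0.trans hlN
  have hl0' : (0 : ℝ) < l := by exact_mod_cast hl0
  have hNl : (0 : ℝ) < N - l := by rw [sub_pos]; exact_mod_cast hlN
  have hq1' : 0 < 1 - q := by linarith
  have hcast : ((N - l : ℕ) : ℝ) = N - l := by rw [Nat.cast_sub hlN.le]
  have hchoose : (N.choose l : ℝ) = N.factorial / (l.factorial * (N - l).factorial) :=
    Nat.cast_choose ℝ hlN.le
  have hexp : Real.exp (-(l * Real.log (l / (N * q)) +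
      (N - l : ℝ) * Real.log ((N - l) / (N * (1 - q))))) =
      (N * q / l) ^ l * (N * (1 - q) / (N - l)) ^ (N - l) := by
    rw [neg_add, Real.exp_add, ← mul_neg, ← mul_neg, ← Real.log_inv, ← Real.log_inv, inv_div,
      inv_div, ← hcast, Real.exp_nat_mul, Real.exp_nat_mul, Real.exp_log, Real.exp_log]
    · rw [hcast]; positivity
    · positivity
  rw [hexp, binom, hchoose]
  simp only [Stirling.stirlingSeq, hcast]
  have e1 : √((q / (l / N)) * ((1 - q) / (1 - l / N))) =
      √(2 * N) * √(2 * Real.pi * N * q * (1 - q)) / (√Real.pi * √(2 * l) * √(2 * (N - l))) := by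
    rw [← Real.sqrt_mul (by positivity), ← Real.sqrt_mul (by positivity),
      ← Real.sqrt_mul (by positivity), ← Real.sqrt_div (by positivity)]
    congr 1
    have : (1 - l / N : ℝ) = (N - l) / N := by field_simp
    rw [this]
    field_simp
  rw [e1]
  have hsN : √(2 * (N : ℝ)) ≠ 0 := by positivity
  have hsl : √(2 * (l : ℝ)) ≠ 0 := by positivity
  have hsNl : √(2 * ((N : ℝ) - l)) ≠ 0 := by positivity
  have hpi : √Real.pi ≠ 0 := by positivity
  have hsplit : (N : ℝ) ^ N = (N : ℝ) ^ l * (N : ℝ) ^ (N - l) := by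
    rw [← pow_add]; congr 1; omega
  have hesplit : (Real.exp 1) ^ N = (Real.exp 1) ^ l * (Real.exp 1) ^ (N - l) := by
    rw [← pow_add]; congr 1; omega
  simp only [div_pow, mul_pow, hsplit, hesplit]
  have h1 : ((N : ℝ) - l) ^ (N - l) ≠ 0 := by positivity
  have h2 : (N : ℝ) ^ l ≠ 0 := by positivity
  have h3 : (N : ℝ) ^ (N - l) ≠ 0 := by positivity
  have h4 : (l : ℝ) ^ l ≠ 0 := by positivity
  have h5 : (Real.exp 1) ^ l ≠ 0 := by positivity
  have h6 : (Real.exp 1) ^ (N - l) ≠ 0 := by positivity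
  have h7 : ((l.factorial : ℕ) : ℝ) ≠ 0 := by positivity
  have h8 : (((N - l).factorial : ℕ) : ℝ) ≠ 0 := by positivity
  generalize √(2 * Real.pi * N * q * (1 - q)) = X
  generalize q ^ l = Q1
  generalize (1 - q) ^ (N - l) = Q2
  field_simp

/-- The local limit theorem for the binomial distribution in the range of moderate deviations. -/
lemma tendsto_binom_local {q : ℝ} (hq0 : 0 < q) (hq1 : q < 1) {N l : ℕ → ℕ}
    (hN : Tendsto N atTop atTop)
    (hh : Tendsto (fun n => |(l n : ℝ) - N n * q| ^ 3 / (N n : ℝ) ^ 2) atTop (𝓝 0)) :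
    Tendsto (fun n => binom (N n) q (l n) * √(2 * Real.pi * N n * q * (1 - q)) *
      Real.exp (((l n : ℝ) - N n * q) ^ 2 / (2 * N n * q * (1 - q)))) atTop (𝓝 1) := by
  have hq1' : 0 < 1 - q := by linarith
  have hNr : Tendsto (fun n => (N n : ℝ)) atTop atTop := tendsto_natCast_atTop_atTop.comp hN
  have hNinv : Tendsto (fun n => ((N n : ℝ))⁻¹) atTop (𝓝 0) := tendsto_inv_atTop_zero.comp hNr
  have hNpos : ∀ᶠ n in atTop, (0 : ℝ) < N n := hNr.eventually_gt_atTop 0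
  -- The relative deviation. Its cube is the quantity in the hypothesis divided by `N n`, so it
  -- tends to 0.
  set u : ℕ → ℝ := fun n => ((l n : ℝ) - N n * q) / N n with hu
  have hu0 : Tendsto u atTop (𝓝 0) := by
    rw [tendsto_zero_iff_abs_tendsto_zero]
    have h3 : Tendsto (fun n => |u n| ^ 3) atTop (𝓝 0) := by
      have := hh.mul hNinv
      rw [zero_mul] at this
      refine this.congr' ?_
      filter_upwards [hNpos] with n hn
      simp only [hu, abs_div, abs_of_pos hn]
      field_simp
    have h4 := (h3.rpow_const (p := (1 / 3 : ℝ)) (Or.inr (by norm_num)))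
    rw [Real.zero_rpow (by norm_num)] at h4
    refine h4.congr fun n => ?_
    rw [← Real.rpow_natCast, ← Real.rpow_mul (abs_nonneg _)]
    norm_num
  have hlu : ∀ᶠ n in atTop, (l n : ℝ) = N n * (q + u n) := by
    filter_upwards [hNpos] with n hn
    simp only [hu]; field_simp; ring
  have hsmall : ∀ ε > 0, ∀ᶠ n in atTop, |u n| < ε := fun ε hε => by
    simpa using (Metric.tendsto_nhds.1 hu0) ε hε
  have hm : 0 < min q (1 - q) / 2 := by positivity
  have hlb : ∀ᶠ n in atTop, (N n : ℝ) * (q / 2) ≤ l n ∧ (N n : ℝ) * ((1 - q) / 2) ≤ N n - l n := by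
    filter_upwards [hNpos, hlu, hsmall _ hm] with n hn hl hs
    have h1 := (abs_lt.1 hs)
    have h2 : min q (1 - q) ≤ q := min_le_left _ _
    have h3 : min q (1 - q) ≤ 1 - q := min_le_right _ _
    rw [hl]
    constructor
    · exact mul_le_mul_of_nonneg_left (by linarith) hn.le
    · have : (N n : ℝ) * ((1 - q) / 2) ≤ N n * (1 - q - u n) :=
        mul_le_mul_of_nonneg_left (by linarith) hn.le
      linarith
  have hl0 : ∀ᶠ n in atTop, 0 < l n ∧ l n < N n := by
    filter_upwards [hNpos, hlb] with n hn h
    have h1 : (0 : ℝ) < l n := lt_of_lt_of_le (by positivity) h.1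
    have h2 : (0 : ℝ) < N n - l n := lt_of_lt_of_le (by positivity) h.2
    exact ⟨by exact_mod_cast h1, by rw [sub_pos] at h2; exact_mod_cast h2⟩
  have hltop : Tendsto l atTop atTop := by
    have : Tendsto (fun n => (l n : ℝ)) atTop atTop :=
      tendsto_atTop_mono' _ (hlb.mono fun n h => h.1) (hNr.atTop_mul_const (by positivity))
    exact tendsto_natCast_atTop_iff.1 this
  have hNltop : Tendsto (fun n => N n - l n) atTop atTop := by
    have : Tendsto (fun n => ((N n - l n : ℕ) : ℝ)) atTop atTop :=
      tendsto_atTop_mono' _ (by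
        filter_upwards [hlb, hl0] with n h h0
        rw [Nat.cast_sub h0.2.le]; exact h.2) (hNr.atTop_mul_const (by positivity : 0 < (1 - q) / 2))
    exact tendsto_natCast_atTop_iff.1 this
  have hS := Stirling.tendsto_stirlingSeq_sqrt_pi
  have hpi : √Real.pi ≠ 0 := by positivity
  have t1 : Tendsto (fun n => Stirling.stirlingSeq (N n) * √Real.pi /
      (Stirling.stirlingSeq (l n) * Stirling.stirlingSeq (N n - l n))) atTop (𝓝 1) := by
    have := ((hS.comp hN).mul_const (√Real.pi)).div ((hS.comp hltop).mul (hS.comp hNltop))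
      (mul_ne_zero hpi hpi)
    rwa [div_self (mul_ne_zero hpi hpi)] at this
  have t2 : Tendsto (fun n => √((q / (l n / N n)) * ((1 - q) / (1 - l n / N n)))) atTop (𝓝 1) := by
    have hlN : Tendsto (fun n => (l n : ℝ) / N n) atTop (𝓝 q) := by
      have : Tendsto (fun n => q + u n) atTop (𝓝 q) := by simpa using hu0.const_add q
      refine this.congr' ?_
      filter_upwards [hNpos, hlu] with n hn h
      rw [h]; field_simp
    have := ((tendsto_const_nhds (x := q)).div hlN hq0.ne').mul
      ((tendsto_const_nhds (x := 1 - q)).div (hlN.const_sub 1) hq1'.ne')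
    have := (Real.continuous_sqrt.tendsto _).comp this
    rw [div_self hq0.ne', div_self hq1'.ne', one_mul, Real.sqrt_one] at this
    exact this
  have t3 : Tendsto (fun n => Real.exp (-(l n * Real.log (l n / (N n * q)) +
        (N n - l n : ℝ) * Real.log ((N n - l n) / (N n * (1 - q)))) +
        ((l n : ℝ) - N n * q) ^ 2 / (2 * N n * q * (1 - q)))) atTop (𝓝 1) := by
    suffices h0 : Tendsto (fun n => -(l n * Real.log (l n / (N n * q)) +
        (N n - l n : ℝ) * Real.log ((N n - l n) / (N n * (1 - q)))) +
        ((l n : ℝ) - N n * q) ^ 2 / (2 * N n * q * (1 - q))) atTop (𝓝 0) by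
      simpa [Function.comp_def] using (Real.continuous_exp.tendsto _).comp h0
    rw [tendsto_zero_iff_abs_tendsto_zero]
    have hbound := hh.const_mul (4 / q ^ 2 + 4 / (1 - q) ^ 2)
    rw [mul_zero] at hbound
    refine squeeze_zero' (Eventually.of_forall fun _ => abs_nonneg _) ?_ hbound
    filter_upwards [hNpos, hlu, hsmall _ hm] with n hn hl hs
    simp only [Function.comp_apply]
    have h2 : min q (1 - q) ≤ q := min_le_left _ _
    have h3 : min q (1 - q) ≤ 1 - q := min_le_right _ _
    have ha : |u n / q| ≤ 1 / 2 := by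
      rw [abs_div, abs_of_pos hq0, div_le_iff₀ hq0]; linarith
    have hb : |-(u n) / (1 - q)| ≤ 1 / 2 := by
      rw [abs_div, abs_neg, abs_of_pos hq1', div_le_iff₀ hq1']; linarith
    have e1 := abs_one_add_mul_log_sub_le ha
    have e2 := abs_one_add_mul_log_sub_le hb
    have f1 : (l n : ℝ) / (N n * q) = 1 + u n / q := by rw [hl]; field_simp
    have f2 : ((N n : ℝ) - l n) / (N n * (1 - q)) = 1 + -(u n) / (1 - q) := by
      rw [hl]; field_simp; ring
    have f3 : (l n : ℝ) - N n * q = N n * u n := by rw [hl]; ring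
    rw [f1, f2, f3]
    have g1 : (l n : ℝ) = N n * q * (1 + u n / q) := by rw [hl]; field_simp
    have g2 : ((N n : ℝ) - l n) = N n * (1 - q) * (1 + -(u n) / (1 - q)) := by
      rw [hl]; field_simp; ring
    rw [g2, g1]
    -- The linear terms of the two entropy expansions cancel, and the quadratic ones add up to N u²
    -- / (2q(1 - q)), the Gaussian exponent. Only the cubic errors remain.
    have g3 : -(N n * q * (1 + u n / q) * Real.log (1 + u n / q) +
        N n * (1 - q) * (1 + -(u n) / (1 - q)) * Real.log (1 + -(u n) / (1 - q))) +
        (N n * u n) ^ 2 / (2 * N n * q * (1 - q)) =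
        -(N n * q * ((1 + u n / q) * Real.log (1 + u n / q) - (u n / q + (u n / q) ^ 2 / 2))) +
        -(N n * (1 - q) * ((1 + -(u n) / (1 - q)) * Real.log (1 + -(u n) / (1 - q)) -
          (-(u n) / (1 - q) + (-(u n) / (1 - q)) ^ 2 / 2))) := by
      generalize Real.log (1 + u n / q) = A
      generalize Real.log (1 + -(u n) / (1 - q)) = B
      field_simp
      ring
    rw [g3]
    refine (abs_add_le _ _).trans ?_
    rw [abs_neg, abs_neg, abs_mul (N n * q), abs_mul (N n * (1 - q)), abs_of_pos (mul_pos hn hq0),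
      abs_of_pos (mul_pos hn hq1')]
    calc _ ≤ N n * q * (4 * |u n / q| ^ 3) + N n * (1 - q) * (4 * |-(u n) / (1 - q)| ^ 3) :=
          add_le_add (mul_le_mul_of_nonneg_left e1 (by positivity))
            (mul_le_mul_of_nonneg_left e2 (by positivity))
      _ = _ := by
          rw [abs_div (u n), abs_div (-(u n)), abs_neg, abs_of_pos hq0, abs_of_pos hq1',
            abs_mul (N n : ℝ), abs_of_pos hn]
          field_simp
  have := (t1.mul t2).mul t3
  rw [one_mul, one_mul] at this
  refine this.congr' ?_
  filter_upwards [hl0] with n h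
  rw [binom_mul_eq hq0 hq1 h.1 h.2, Real.exp_add]
  ring

end LocalLimit

/-! ### Binomial masses and tails at the scale of the maximum over all k-sets. -/

section Extreme

open Topology

/-- The spread of the maximum of the common neighbourhood sizes of `k`-sets. -/
noncomputable def spread (k : ℕ) (q : ℝ) (n : ℕ) : ℝ := √(n * (q * (1 - q)) / (2 * k * Real.log n))

/-- The location of the maximum of the common neighbourhood sizes of `k`-sets. -/
noncomputable def center (k : ℕ) (q : ℝ) (n : ℕ) : ℝ :=
  n * q + √(2 * n * Real.log n) * (√(k * q * (1 - q)) *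
    (1 - Real.log (k.factorial) / (2 * k * Real.log n)
      - Real.log (4 * Real.pi * k * Real.log n) / (4 * k * Real.log n)))

lemma tendsto_log_natCast : Tendsto (fun n : ℕ => Real.log n) atTop atTop :=
  Real.tendsto_log_atTop.comp tendsto_natCast_atTop_atTop

lemma tendsto_log_pow_div (j : ℕ) :
    Tendsto (fun n : ℕ => Real.log n ^ j / n) atTop (𝓝 0) := by
  have h := (isLittleO_log_rpow_rpow_atTop (j : ℝ) one_pos).tendsto_div_nhds_zero
  have := h.comp (tendsto_natCast_atTop_atTop (R := ℝ))
  refine this.congr fun n => ?_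
  simp

lemma tendsto_log_const_mul_div_sqrt {C : ℝ} (hC : 0 < C) :
    Tendsto (fun y : ℝ => Real.log (C * y) / √y) atTop (𝓝 0) := by
  have h := (isLittleO_log_rpow_atTop (r := 1 / 2) (by norm_num)).tendsto_div_nhds_zero
  have h2 := (h.comp (tendsto_id.const_mul_atTop hC)).mul_const (√C)
  rw [zero_mul] at h2
  refine h2.congr' ?_
  filter_upwards [eventually_gt_atTop 0] with y hy
  simp only [Function.comp_apply, id, ← Real.sqrt_eq_rpow]
  rw [Real.sqrt_mul hC.le]
  have := Real.sqrt_pos.2 hC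
  have := Real.sqrt_pos.2 hy
  field_simp

/-- The common scale of fluctuations and extremes. -/
noncomputable def gap (k : ℕ) (q : ℝ) (n : ℕ) : ℝ :=
  √(2 * n * Real.log n * (k * (q * (1 - q))))

lemma gap_sq {k : ℕ} {q : ℝ} (hq0 : 0 < q) (hq1 : q < 1) (n : ℕ) :
    gap k q n ^ 2 = 2 * n * Real.log n * (k * (q * (1 - q))) := by
  have : 0 < 1 - q := by linarith
  exact Real.sq_sqrt (mul_nonneg (mul_nonneg (by positivity) (Real.log_natCast_nonneg n))
    (by positivity))

lemma gap_pos {k : ℕ} (hk : 0 < k) {q : ℝ} (hq0 : 0 < q) (hq1 : q < 1) {n : ℕ} (hn : 1 < n) :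
    0 < gap k q n := by
  have : 0 < 1 - q := by linarith
  have := Real.log_pos (x := n) (by exact_mod_cast hn)
  have : 0 < n := by omega
  exact Real.sqrt_pos.2 (by positivity)

lemma center_eq {k : ℕ} {q : ℝ} (n : ℕ) :
    center k q n = n * q + gap k q n *
      (1 - Real.log (k.factorial) / (2 * k * Real.log n)
        - Real.log (4 * Real.pi * k * Real.log n) / (4 * k * Real.log n)) := by
  have : gap k q n = √(2 * n * Real.log n) * √(k * q * (1 - q)) := by
    rw [gap, Real.sqrt_mul (mul_nonneg (by positivity) (Real.log_natCast_nonneg n)), ← mul_assoc (k : ℝ)]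
  rw [center, this]; ring

/-- At deviation `gap` the Gaussian exponent is k log n, which balances the number of k-sets.
Changing the deviation by a factor 1 + δ changes the exponent by about 2δk log n, so `gap` / (2k log
n) moves it by one unit. -/
lemma spread_eq {k : ℕ} (hk : 0 < k) {q : ℝ} (hq0 : 0 < q) (hq1 : q < 1) {n : ℕ} (hn : 1 < n) :
    spread k q n = gap k q n / (2 * k * Real.log n) := by
  have h1 : 0 < 1 - q := by linarith
  have h2 := Real.log_pos (x := n) (by exact_mod_cast hn)
  have h3 : 0 < n := by omega
  rw [spread, gap, eq_div_iff (by positivity)]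
  rw [← Real.sqrt_sq (by positivity : 0 ≤ 2 * (k : ℝ) * Real.log n), ← Real.sqrt_mul (by positivity)]
  rw [Real.sqrt_sq (by positivity)]
  congr 1
  field_simp

lemma tendsto_log_div_gap {k : ℕ} (hk : 0 < k) {q : ℝ} (hq0 : 0 < q) (hq1 : q < 1) :
    Tendsto (fun n : ℕ => Real.log n / gap k q n) atTop (𝓝 0) := by
  have h1 : 0 < 1 - q := by linarith
  have h := ((tendsto_log_pow_div 1).const_mul (1 / (2 * (k * (q * (1 - q)))))).sqrt
  rw [mul_zero, Real.sqrt_zero] at h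
  refine h.congr' ?_
  filter_upwards [eventually_gt_atTop 1] with n hn
  have h2 := Real.log_pos (x := n) (by exact_mod_cast hn)
  have h3 : 0 < n := by omega
  have h4 := gap_pos hk hq0 hq1 hn
  rw [← Real.sqrt_sq (by positivity : 0 ≤ Real.log n / gap k q n), div_pow, gap_sq hq0 hq1]
  congr 1
  field_simp

lemma tendsto_gap_atTop {k : ℕ} (hk : 0 < k) {q : ℝ} (hq0 : 0 < q) (hq1 : q < 1) :
    Tendsto (fun n : ℕ => gap k q n) atTop atTop := by
  have h := (tendsto_log_div_gap hk hq0 hq1)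
  have h2 : Tendsto (fun n : ℕ => (Real.log n / gap k q n)⁻¹) atTop atTop := by
    refine Tendsto.inv_tendsto_nhdsGT_zero ?_
    rw [tendsto_nhdsWithin_iff]
    refine ⟨h, ?_⟩
    filter_upwards [eventually_gt_atTop 1] with n hn
    exact div_pos (Real.log_pos (by exact_mod_cast hn)) (gap_pos hk hq0 hq1 hn)
  refine (h2.atTop_mul_atTop₀ tendsto_log_natCast).congr' ?_
  filter_upwards [eventually_gt_atTop 1] with n hn
  have := Real.log_pos (x := n) (by exact_mod_cast hn)
  have := gap_pos hk hq0 hq1 hn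
  field_simp

lemma tendsto_spread_atTop {k : ℕ} (hk : 0 < k) {q : ℝ} (hq0 : 0 < q) (hq1 : q < 1) :
    Tendsto (fun n : ℕ => spread k q n) atTop atTop := by
  have h := (tendsto_log_div_gap hk hq0 hq1).const_mul (2 * (k : ℝ))
  rw [mul_zero] at h
  have h2 : Tendsto (fun n : ℕ => (2 * k * (Real.log n / gap k q n))⁻¹) atTop atTop := by
    refine Tendsto.inv_tendsto_nhdsGT_zero ?_
    rw [tendsto_nhdsWithin_iff]
    refine ⟨h, ?_⟩
    filter_upwards [eventually_gt_atTop 1] with n hn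
    have := Real.log_pos (x := n) (by exact_mod_cast hn)
    have := gap_pos hk hq0 hq1 hn
    exact Set.mem_Ioi.2 (by positivity)
  refine h2.congr' ?_
  filter_upwards [eventually_gt_atTop 1] with n hn
  rw [spread_eq hk hq0 hq1 hn, ← mul_div_assoc, inv_div]

lemma tendsto_natSub_atTop (c : ℕ) : Tendsto (fun n : ℕ => n - c) atTop atTop :=
  tendsto_sub_atTop_nat c

lemma tendsto_div_natSub (c : ℕ) : Tendsto (fun n : ℕ => (n : ℝ) / (n - c : ℕ)) atTop (𝓝 1) := by
  have h : Tendsto (fun n : ℕ => ((n - c : ℕ) : ℝ)) atTop atTop :=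
    tendsto_natCast_atTop_atTop.comp (tendsto_natSub_atTop c)
  have h2 := ((h.inv_tendsto_atTop).const_mul (c : ℝ)).const_add 1
  rw [mul_zero, add_zero] at h2
  refine h2.congr' ?_
  filter_upwards [eventually_gt_atTop c] with n hn
  have : ((n - c : ℕ) : ℝ) ≠ 0 := by
    have : 0 < n - c := by omega
    positivity
  rw [Nat.cast_sub hn.le] at this ⊢
  simp only [Pi.inv_apply, Nat.cast_sub hn.le]
  field_simp
  ring

/-- Asymptotics of the deviation of `l n` from the mean when `(l n - center) / spread → x`. -/
lemma exists_deviation {k : ℕ} (hk : 0 < k) {q : ℝ} (hq0 : 0 < q) (hq1 : q < 1) (c : ℕ)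
    {l : ℕ → ℕ} {x : ℝ}
    (hl : Tendsto (fun n => ((l n : ℝ) - center k q n) / spread k q n) atTop (𝓝 x)) :
    ∃ δ : ℕ → ℝ, Tendsto (fun n : ℕ => √(Real.log n) * δ n) atTop (𝓝 0) ∧
      Tendsto (fun n : ℕ => 2 * k * Real.log n * δ n + Real.log k.factorial +
        Real.log (4 * Real.pi * k * Real.log n) / 2) atTop (𝓝 x) ∧
      ∀ᶠ n in atTop, (l n : ℝ) - (n - c : ℕ) * q = gap k q n * (1 + δ n) := by
  obtain ⟨xn, hxn⟩ : ∃ xn : ℕ → ℝ, ∀ n, xn n = ((l n : ℝ) - center k q n) / spread k q n :=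
    ⟨_, fun _ => rfl⟩
  simp only [← hxn] at hl
  have hkr : (0 : ℝ) < k := by exact_mod_cast hk
  have hL := tendsto_log_natCast
  have hLg := tendsto_log_div_gap hk hq0 hq1
  -- The relative deviation from `gap`: the correction terms of `center`, then the position `xn n`
  -- in units of `spread`, then a term for the mean being taken over n - c trials while `center`
  -- uses n.
  refine ⟨fun n => -(Real.log (k.factorial) / (2 * k * Real.log n)
        + Real.log (4 * Real.pi * k * Real.log n) / (4 * k * Real.log n)) +
        xn n / (2 * k * Real.log n) + c * q / gap k q n, ?_, ?_, ?_⟩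
  · have hs : Tendsto (fun n : ℕ => (√(Real.log n))⁻¹) atTop (𝓝 0) :=
      (Real.tendsto_sqrt_atTop.comp hL).inv_tendsto_atTop
    have h1 := hs.const_mul (-(Real.log k.factorial / (2 * k)))
    have h2 := ((tendsto_log_const_mul_div_sqrt (C := 4 * Real.pi * k) (by positivity)).comp
      hL).const_mul (-(1 / (4 * (k : ℝ))))
    have h3 := (hl.mul hs).mul_const (1 / (2 * (k : ℝ)))
    have h4 := (hLg.mul hs).const_mul (c * q)
    have := ((h1.add h2).add h3).add h4
    simp only [mul_zero, zero_mul, add_zero] at this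
    refine this.congr' ?_
    filter_upwards [eventually_gt_atTop 1] with n hn
    have h5 := Real.log_pos (x := n) (by exact_mod_cast hn)
    have h6 := gap_pos hk hq0 hq1 hn
    have h7 := Real.sqrt_pos.2 h5
    simp only [Function.comp_apply]
    generalize Real.log (4 * Real.pi * k * Real.log n) = A
    generalize xn n = B
    have h8 : Real.log n = √(Real.log n) ^ 2 := (Real.sq_sqrt h5.le).symm
    generalize √(Real.log n) = R at *
    rw [h8]
    field_simp
    ring
  · have := hl.add (hLg.const_mul (2 * k * c * q))
    rw [mul_zero, add_zero] at this
    refine this.congr' ?_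
    filter_upwards [eventually_gt_atTop 1] with n hn
    have h5 := Real.log_pos (x := n) (by exact_mod_cast hn)
    have h6 := gap_pos hk hq0 hq1 hn
    generalize Real.log (4 * Real.pi * k * Real.log n) = A
    generalize xn n = B
    field_simp
    ring
  · filter_upwards [eventually_gt_atTop 1, eventually_ge_atTop c] with n hn hc
    have h5 := Real.log_pos (x := n) (by exact_mod_cast hn)
    have h6 := gap_pos hk hq0 hq1 hn
    have h7 : (l n : ℝ) = center k q n + spread k q n * xn n := by
      have : 0 < spread k q n := by rw [spread_eq hk hq0 hq1 hn]; positivity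
      rw [hxn]; field_simp; ring
    rw [h7, center_eq, spread_eq hk hq0 hq1 hn, Nat.cast_sub hc]
    generalize Real.log (4 * Real.pi * k * Real.log n) = A
    generalize xn n = B
    field_simp
    ring

/-- The binomial probabilities at the extreme scale. -/
lemma tendsto_binom_extreme {k : ℕ} (hk : 0 < k) {q : ℝ} (hq0 : 0 < q) (hq1 : q < 1) (c : ℕ)
    {l : ℕ → ℕ} {x : ℝ}
    (hl : Tendsto (fun n => ((l n : ℝ) - center k q n) / spread k q n) atTop (𝓝 x)) :
    Tendsto (fun n : ℕ => (n : ℝ) ^ k / k.factorial * spread k q n * binom (n - c) q (l n))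
      atTop (𝓝 (Real.exp (-x))) := by
  obtain ⟨δ, hδ1, hδ2, hδ3⟩ := exists_deviation hk hq0 hq1 c hl
  have hq1' : 0 < 1 - q := by linarith
  have hkr : (0 : ℝ) < k := by exact_mod_cast hk
  have hL := tendsto_log_natCast
  have hδ0 : Tendsto δ atTop (𝓝 0) := by
    have := hδ1.mul (Real.tendsto_sqrt_atTop.comp hL).inv_tendsto_atTop
    rw [zero_mul] at this
    refine this.congr' ?_
    filter_upwards [eventually_gt_atTop 1] with n hn
    have h5 := Real.sqrt_pos.2 (Real.log_pos (x := n) (by exact_mod_cast hn))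
    simp only [Function.comp_apply, Pi.inv_apply]
    field_simp
  have hratio := tendsto_div_natSub c
  have hh : Tendsto (fun n => |(l n : ℝ) - (n - c : ℕ) * q| ^ 3 / ((n - c : ℕ) : ℝ) ^ 2)
      atTop (𝓝 0) := by
    have h1 := (((tendsto_log_pow_div 3).mul (hratio.pow 4)).const_mul
      ((2 * (k * (q * (1 - q)))) ^ 3)).sqrt
    have h2 := ((hδ0.const_add 1).abs).pow 3
    have := h1.mul h2
    simp only [zero_mul, mul_zero, Real.sqrt_zero] at this
    refine this.congr' ?_
    filter_upwards [eventually_gt_atTop 1, eventually_gt_atTop c, hδ3] with n hn hc h3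
    have h5 := Real.log_pos (x := n) (by exact_mod_cast hn)
    have h6 := gap_pos hk hq0 hq1 hn
    have hc' : (0 : ℝ) < (n - c : ℕ) := by
      have : 0 < n - c := by omega
      positivity
    have hn' : (0 : ℝ) < n := by positivity
    rw [h3, abs_mul, mul_pow (|gap k q n|), abs_of_pos h6, mul_div_right_comm]
    congr 1
    rw [← Real.sqrt_sq (by positivity : 0 ≤ gap k q n ^ 3 / ((n - c : ℕ) : ℝ) ^ 2),
      div_pow (gap k q n ^ 3),
      ← pow_mul, mul_comm 3 2, pow_mul, gap_sq hq0 hq1]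
    congr 1
    field_simp
  have hloc := tendsto_binom_local hq0 hq1 (tendsto_natSub_atTop c) hh
  -- The Gaussian exponent minus the logarithm of n^k / (k! √(4πk log n)). Once it tends to `x`,
  -- that logarithm supplies the factor n^k / k!, and √(4πk log n) turns the variance normalization
  -- into `spread`.
  set D : ℕ → ℝ := fun n => ((l n : ℝ) - (n - c : ℕ) * q) ^ 2 / (2 * (n - c : ℕ) * q * (1 - q)) -
    (k * Real.log n - Real.log k.factorial - Real.log (4 * Real.pi * k * Real.log n) / 2) with hD
  have hDx : Tendsto D atTop (𝓝 x) := by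
    -- The exponent is k log n (1 + δ)² n/(n - c). The part linear in δ is covered by `hδ2`, the
    -- quadratic one needs δ² log n → 0, and `h3` is the effect of n/(n - c) - 1 = c/(n - c).
    have h1 := (hδ1.pow 2).const_mul (k : ℝ)
    have h2 : Tendsto (fun n : ℕ => Real.log n / (n - c : ℕ)) atTop (𝓝 0) := by
      have := (tendsto_log_pow_div 1).mul hratio
      rw [zero_mul] at this
      refine this.congr' ?_
      filter_upwards [eventually_gt_atTop 1] with n hn
      have hn' : (0 : ℝ) < n := by positivity
      field_simp
    have h3 := (h2.const_mul (k * c : ℝ)).mul ((hδ0.const_add 1).pow 2)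
    have := (hδ2.add h1).add h3
    simp only [mul_zero, zero_mul, add_zero, zero_pow two_ne_zero] at this
    refine this.congr' ?_
    filter_upwards [eventually_gt_atTop 1, eventually_gt_atTop c, hδ3] with n hn hc h3
    have h5 := Real.log_pos (x := n) (by exact_mod_cast hn)
    have hc' : (0 : ℝ) < (n - c : ℕ) := by
      have : 0 < n - c := by omega
      positivity
    have hn' : (n : ℝ) = (n - c : ℕ) + c := by rw [Nat.cast_sub hc.le]; ring
    simp only [hD]
    rw [h3, mul_pow (gap k q n), gap_sq hq0 hq1, mul_pow (√(Real.log n)), Real.sq_sqrt h5.le]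
    generalize Real.log (4 * Real.pi * k * Real.log n) = A
    generalize Real.log n = L at *
    rw [hn']
    field_simp
    ring
  have hfin := (hloc.mul ((Real.continuous_exp.tendsto _).comp hDx.neg)).mul hratio.sqrt
  rw [one_mul, Real.sqrt_one, mul_one] at hfin
  refine hfin.congr' ?_
  filter_upwards [eventually_gt_atTop 1, eventually_gt_atTop c] with n hn hc
  have h5 := Real.log_pos (x := n) (by exact_mod_cast hn)
  have hc' : (0 : ℝ) < (n - c : ℕ) := by
    have : 0 < n - c := by omega
    positivity
  have hn' : (0 : ℝ) < n := by positivity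
  simp only [Function.comp_apply]
  have e1 : Real.exp (-D n) = Real.exp (-(((l n : ℝ) - (n - c : ℕ) * q) ^ 2 /
      (2 * (n - c : ℕ) * q * (1 - q)))) * ((n : ℝ) ^ k / k.factorial / √(4 * Real.pi * k * Real.log n)) := by
    simp only [hD]
    have : (n : ℝ) ^ k / k.factorial / √(4 * Real.pi * k * Real.log n) =
        Real.exp (k * Real.log n - Real.log k.factorial -
          Real.log (4 * Real.pi * k * Real.log n) / 2) := by
      rw [Real.exp_sub, Real.exp_sub, Real.exp_nat_mul, Real.exp_log hn', Real.exp_log (by positivity),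
        ← Real.log_sqrt (by positivity), Real.exp_log (by positivity)]
    rw [this, ← Real.exp_add]; congr 1; ring
  have e2 : √(2 * Real.pi * (n - c : ℕ) * q * (1 - q)) * √((n : ℝ) / (n - c : ℕ)) /
      √(4 * Real.pi * k * Real.log n) = spread k q n := by
    rw [spread, ← Real.sqrt_mul (by positivity), ← Real.sqrt_div (by positivity)]
    congr 1
    field_simp
    ring
  rw [e1, ← e2, Real.exp_neg]
  field_simp

/-- The upper tail of the binomial distribution. -/
noncomputable def binomTail (N : ℕ) (q : ℝ) (l : ℕ) : ℝ := ∑ j ∈ Finset.Ico l (N + 1), binom N q j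

lemma binom_nonneg {N : ℕ} {q : ℝ} (hq : q ∈ Set.Icc (0 : ℝ) 1) (l : ℕ) : 0 ≤ binom N q l := by
  have := hq.1
  have : 0 ≤ 1 - q := by linarith [hq.2]
  unfold binom; positivity

lemma binomTail_nonneg {N : ℕ} {q : ℝ} (hq : q ∈ Set.Icc (0 : ℝ) 1) (l : ℕ) :
    0 ≤ binomTail N q l :=
  Finset.sum_nonneg fun _ _ => binom_nonneg hq _

lemma binom_succ_mul {N l : ℕ} {q : ℝ} (hl : l < N) :
    binom N q (l + 1) * ((l + 1) * (1 - q)) = binom N q l * ((N - l) * q) := by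
  have h1 : (N.choose (l + 1) : ℝ) * (l + 1) = N.choose l * (N - l) := by
    have := Nat.choose_succ_right_eq N l
    rw [← Nat.cast_sub hl.le]; exact_mod_cast this
  have h2 : N - l = (N - (l + 1)) + 1 := by omega
  unfold binom
  rw [h2, pow_succ, pow_succ]
  linear_combination (q ^ l * q * (1 - q) ^ (N - (l + 1)) * (1 - q)) * h1

/-- Beyond the mean, the tail of the binomial distribution is dominated by a geometric series. -/
lemma binomTail_le {N l : ℕ} {q : ℝ} (hq0 : 0 < q) (hq1 : q < 1) (hl : (N : ℝ) * q ≤ l) :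
    binomTail N q l ≤ binom N q l * ((l + 1) * (1 - q) / (l + 1 - q - N * q)) := by
  have hq1' : 0 < 1 - q := by linarith
  have hqI : q ∈ Set.Icc (0 : ℝ) 1 := ⟨hq0.le, hq1.le⟩
  have hden : 0 < (l : ℝ) + 1 - q - N * q := by linarith
  -- The ratio of the masses at `l + 1` and `l`. These ratios decrease, and beyond the mean they are
  -- less than 1.
  set ρ : ℝ := (N - l) * q / ((l + 1) * (1 - q)) with hρ
  rcases lt_or_ge N l with hNl | hNl
  · rw [binomTail, Finset.Ico_eq_empty (by omega), Finset.sum_empty]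
    have := binom_nonneg (N := N) hqI l
    positivity
  have hNl' : (l : ℝ) ≤ N := by exact_mod_cast hNl
  have hρ0 : 0 ≤ ρ := div_nonneg (mul_nonneg (by linarith) hq0.le) (by positivity)
  have hρ1 : ρ < 1 := by rw [hρ, div_lt_one (by positivity)]; nlinarith
  have hgeo : ∀ i, l + i ≤ N → binom N q (l + i) ≤ binom N q l * ρ ^ i := by
    intro i
    induction i with
    | zero => intro _; simp
    | succ i ih =>
      intro hi
      have ih := ih (by omega)
      have h1 := binom_succ_mul (N := N) (l := l + i) (q := q) (by omega)
      push_cast at h1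
      have hpos : 0 < ((l : ℝ) + i + 1) * (1 - q) := by positivity
      have h2 : binom N q (l + (i + 1)) = binom N q (l + i) * ((N - (l + i)) * q /
          ((l + i + 1) * (1 - q))) := by
        rw [← mul_div_assoc, eq_div_iff hpos.ne', ← h1, ← add_assoc]
      have h3 : ((N : ℝ) - (l + i)) * q / ((l + i + 1) * (1 - q)) ≤ ρ := by
        rw [hρ]
        apply div_le_div₀ (mul_nonneg (by linarith) hq0.le) _ (by positivity)
        · exact mul_le_mul_of_nonneg_right (by linarith [(Nat.cast_nonneg i : (0:ℝ) ≤ i)]) hq1'.le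
        · exact mul_le_mul_of_nonneg_right (by linarith [(Nat.cast_nonneg i : (0:ℝ) ≤ i)]) hq0.le
      rw [h2, pow_succ, ← mul_assoc]
      have hnn : (0 : ℝ) ≤ ((N : ℝ) - (l + i)) * q / ((l + i + 1) * (1 - q)) := by
        have : ((l : ℝ) + i) ≤ N := by exact_mod_cast (by omega : l + i ≤ N)
        exact div_nonneg (mul_nonneg (by linarith) hq0.le) hpos.le
      exact mul_le_mul ih h3 hnn (mul_nonneg (binom_nonneg hqI _) (pow_nonneg hρ0 _))
  calc binomTail N q l = ∑ i ∈ Finset.range (N + 1 - l), binom N q (l + i) := by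
        rw [binomTail, Finset.sum_Ico_eq_sum_range]
    _ ≤ ∑ i ∈ Finset.range (N + 1 - l), binom N q l * ρ ^ i :=
        Finset.sum_le_sum fun i hi => hgeo i (by rw [Finset.mem_range] at hi; omega)
    _ ≤ binom N q l * (1 - ρ)⁻¹ := by
        rw [← Finset.mul_sum]
        refine mul_le_mul_of_nonneg_left ?_ (binom_nonneg hqI _)
        rw [← tsum_geometric_of_lt_one hρ0 hρ1]
        exact (summable_geometric_of_lt_one hρ0 hρ1).sum_le_tsum _ fun i _ => pow_nonneg hρ0 i
    _ = _ := by
        congr 1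
        have : 1 - ρ = (l + 1 - q - N * q) / ((l + 1) * (1 - q)) := by
          rw [hρ]; field_simp; ring
        rw [this, inv_div]

/-- The binomial tail at the extreme scale. -/
lemma binomTail_extreme_le {k : ℕ} (hk : 0 < k) {q : ℝ} (hq0 : 0 < q) (hq1 : q < 1) (c : ℕ)
    {l : ℕ → ℕ} {x : ℝ}
    (hl : Tendsto (fun n => ((l n : ℝ) - center k q n) / spread k q n) atTop (𝓝 x)) :
    ∃ t : ℕ → ℝ, Tendsto t atTop (𝓝 (Real.exp (-x))) ∧
      ∀ᶠ n : ℕ in atTop, (n : ℝ) ^ k / k.factorial * binomTail (n - c) q (l n) ≤ t n := by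
  obtain ⟨δ, hδ1, hδ2, hδ3⟩ := exists_deviation hk hq0 hq1 c hl
  have hb := tendsto_binom_extreme hk hq0 hq1 c hl
  have hq1' : 0 < 1 - q := by linarith
  have hkr : (0 : ℝ) < k := by exact_mod_cast hk
  have hL := tendsto_log_natCast
  have hδ0 : Tendsto δ atTop (𝓝 0) := by
    have := hδ1.mul (Real.tendsto_sqrt_atTop.comp hL).inv_tendsto_atTop
    rw [zero_mul] at this
    refine this.congr' ?_
    filter_upwards [eventually_gt_atTop 1] with n hn
    have h5 := Real.sqrt_pos.2 (Real.log_pos (x := n) (by exact_mod_cast hn))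
    simp only [Function.comp_apply, Pi.inv_apply]
    field_simp
  have hginv := (tendsto_gap_atTop hk hq0 hq1).inv_tendsto_atTop
  have hgn : Tendsto (fun n : ℕ => gap k q n / n) atTop (𝓝 0) := by
    have := ((tendsto_log_pow_div 1).const_mul (2 * (k * (q * (1 - q))))).sqrt
    rw [mul_zero, Real.sqrt_zero] at this
    refine this.congr' ?_
    filter_upwards [eventually_gt_atTop 1] with n hn
    have hn' : (0 : ℝ) < n := by positivity
    have h6 := gap_pos hk hq0 hq1 hn
    rw [← Real.sqrt_sq (by positivity : 0 ≤ gap k q n / n), div_pow, gap_sq hq0 hq1]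
    congr 1
    field_simp
  have hninv : Tendsto (fun n : ℕ => (n : ℝ)⁻¹) atTop (𝓝 0) := tendsto_inv_atTop_nhds_zero_nat
  -- `r n` is the limit ratio of the geometric correction to the spread
  have hr : Tendsto (fun n : ℕ => (l n + 1 : ℝ) * (1 - q) / (l n + 1 - q - (n - c : ℕ) * q) /
      spread k q n) atTop (𝓝 1) := by
    have h1 : Tendsto (fun n : ℕ => (((q + gap k q n / n * (1 + δ n)) + (1 - c * q) * (n : ℝ)⁻¹) / q) /
        (1 + δ n + (1 - q) * (gap k q n)⁻¹)) atTop (𝓝 1) := by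
      have := ((((hgn.mul (hδ0.const_add 1)).const_add q).add (hninv.const_mul (1 - c * q))).div_const q).div
        ((hδ0.const_add 1).add (hginv.const_mul (1 - q))) (by norm_num)
      rw [show (q + 0 * (1 + 0) + (1 - c * q) * 0) / q / (1 + 0 + (1 - q) * 0) = 1 by
        simp [hq0.ne']] at this
      exact this
    refine h1.congr' ?_
    have hden : ∀ᶠ n in atTop, 0 < 1 + δ n + (1 - q) * (gap k q n)⁻¹ := by
      have : Tendsto (fun n => 1 + δ n + (1 - q) * (gap k q n)⁻¹) atTop (𝓝 1) := by
        simpa using (hδ0.const_add 1).add (hginv.const_mul (1 - q))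
      exact this.eventually (lt_mem_nhds one_pos)
    filter_upwards [eventually_gt_atTop 1, eventually_ge_atTop c, hδ3, hden] with n hn hc h3 hd
    have hn' : (0 : ℝ) < n := by positivity
    have h5 := Real.log_pos (x := n) (by exact_mod_cast hn)
    have h6 := gap_pos hk hq0 hq1 hn
    have h7 : (l n : ℝ) = (n - c) * q + gap k q n * (1 + δ n) := by
      rw [Nat.cast_sub hc] at h3; linarith
    -- `gap` times `spread` is the variance nq(1 - q). The geometric correction is about nq(1 -
    -- q)/`gap`, hence asymptotic to `spread`, and the tail is comparable to `spread` times the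
    -- mass.
    have h8 : gap k q n * (gap k q n / (2 * k * Real.log n)) = n * (q * (1 - q)) := by
      rw [← mul_div_assoc, ← pow_two, gap_sq hq0 hq1]; field_simp
    have h9 : (l n : ℝ) + 1 - q - (n - c : ℕ) * q =
        gap k q n * (1 + δ n + (1 - q) * (gap k q n)⁻¹) := by
      rw [Nat.cast_sub hc, h7]; field_simp; ring
    rw [h9, spread_eq hk hq0 hq1 hn, div_div _ _ (gap k q n / _), mul_right_comm (gap k q n), h8, h7]
    field_simp
    ring
  have hfin := hb.mul hr
  rw [mul_one] at hfin
  refine ⟨_, hfin, ?_⟩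
  have hden : ∀ᶠ n in atTop, 0 < 1 + δ n := by
    have : Tendsto (fun n => 1 + δ n) atTop (𝓝 1) := by simpa using hδ0.const_add 1
    exact this.eventually (lt_mem_nhds one_pos)
  filter_upwards [eventually_gt_atTop 1, hδ3, hden] with n hn h3 hd
  have h5 := Real.log_pos (x := n) (by exact_mod_cast hn)
  have h6 := gap_pos hk hq0 hq1 hn
  have h7 : 0 < spread k q n := by rw [spread_eq hk hq0 hq1 hn]; positivity
  have h8 := binomTail_le (N := n - c) (l := l n) hq0 hq1 (by nlinarith)
  calc _ ≤ (n : ℝ) ^ k / k.factorial * _ := mul_le_mul_of_nonneg_left h8 (by positivity)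
    _ = _ := by field_simp

end Extreme

/-! ### Strict inequalities between the constants of extreme codegrees. -/

section Constants

open Topology

variable {p : ℝ}

/-- Bernoulli's inequality gives 1 - p^i ≤ i(1 - p), and comparing a p^a with the geometric sum 1 +
p + ... + p^(a-1) gives a p^a (1 - p) < 1 - p^a. All comparisons of constants below reduce to this
one. -/
lemma mul_pow_mul_one_sub_pow_lt (hp0 : 0 < p) (hp1 : p < 1) {a i : ℕ} (ha : 0 < a) (hi : 0 < i) :
    a * p ^ a * (1 - p ^ i) < i * (1 - p ^ a) := by
  have h1 : 1 - p ^ i ≤ i * (1 - p) := by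
    have := one_add_mul_le_pow (a := p - 1) (by linarith) i
    rw [show 1 + (p - 1) = p by ring] at this
    nlinarith
  have h2 : a * p ^ a * (1 - p) < 1 - p ^ a := by
    have hg := geom_sum_mul_neg p a
    have h3 : (a : ℝ) * p ^ a < ∑ j ∈ Finset.range a, p ^ j := by
      calc (a : ℝ) * p ^ a = ∑ j ∈ Finset.range a, p ^ a := by simp
        _ < _ := Finset.sum_lt_sum_of_nonempty (Finset.nonempty_range_iff.2 ha.ne') fun j hj =>
            pow_lt_pow_right_of_lt_one₀ hp0 hp1 (Finset.mem_range.1 hj)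
    rw [← hg]
    exact mul_lt_mul_of_pos_right h3 (by linarith)
  have hi' : (0 : ℝ) < i := by exact_mod_cast hi
  have ha' : (0 : ℝ) < a := by exact_mod_cast ha
  calc a * p ^ a * (1 - p ^ i) ≤ a * p ^ a * (i * (1 - p)) :=
        mul_le_mul_of_nonneg_left h1 (by positivity)
    _ = i * (a * p ^ a * (1 - p)) := by ring
    _ < _ := mul_lt_mul_of_pos_left h2 hi'

lemma mul_pow_sub_mul_le (hp0 : 0 < p) (hp1 : p < 1) {i k : ℕ} (hi : 0 < i) (hik : i ≤ k) :
    k * p ^ (k - i) * (1 - p ^ i) ≤ i * (1 - p ^ k) := by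
  rcases hik.eq_or_lt with rfl | h
  · simp
  · have := mul_pow_mul_one_sub_pow_lt hp0 hp1 (a := k - i) (by omega) hi
    obtain ⟨a, rfl⟩ := Nat.exists_eq_add_of_le hik
    simp only [Nat.add_sub_cancel_left] at this ⊢
    push_cast
    rw [pow_add]
    nlinarith

lemma mul_pow_sub_mul_lt (hp0 : 0 < p) (hp1 : p < 1) {i k : ℕ} (hi : 0 < i) (hik : i < k) :
    k * p ^ (k - i) * (1 - p ^ i) < i * (1 - p ^ k) := by
  have := mul_pow_mul_one_sub_pow_lt hp0 hp1 (a := k - i) (by omega) hi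
  obtain ⟨a, rfl⟩ := Nat.exists_eq_add_of_le hik.le
  simp only [Nat.add_sub_cancel_left] at this ⊢
  push_cast
  rw [pow_add]
  nlinarith

/-- The standardized location of the maximal number of common neighbours of `k`-sets. -/
noncomputable def sd (p : ℝ) (k : ℕ) : ℝ := √(k * (p ^ k * (1 - p ^ k)))

lemma one_sub_pow_pos (hp0 : 0 < p) (hp1 : p < 1) {k : ℕ} (hk : 0 < k) : 0 < 1 - p ^ k := by
  have := pow_lt_one₀ hp0.le hp1 hk.ne'
  linarith

lemma sd_pos (hp0 : 0 < p) (hp1 : p < 1) {k : ℕ} (hk : 0 < k) : 0 < sd p k := by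
  have := one_sub_pow_pos hp0 hp1 hk
  exact Real.sqrt_pos.2 (by positivity)

lemma sd_sq (hp0 : 0 < p) (hp1 : p < 1) (k : ℕ) : sd p k ^ 2 = k * (p ^ k * (1 - p ^ k)) := by
  have : p ^ k ≤ 1 := pow_le_one₀ hp0.le hp1.le
  have : 0 ≤ 1 - p ^ k := by linarith
  exact Real.sq_sqrt (by positivity)

/-- Extending a `j`-set with the largest number of common neighbours does not produce a `k`-set
with an extreme number of common neighbours. -/
lemma overlap_const (hp0 : 0 < p) (hp1 : p < 1) {j a : ℕ} (hj : 0 < j) (ha : 0 < a) :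
    0 < sd p (j + a) - p ^ a * sd p j ∧
      a * (p ^ (j + a) * (1 - p ^ a)) < (sd p (j + a) - p ^ a * sd p j) ^ 2 := by
  have h := mul_pow_mul_one_sub_pow_lt hp0 hp1 ha hj
  have h1 := sd_sq hp0 hp1 (j + a)
  have h2 := sd_sq hp0 hp1 j
  have hB := one_sub_pow_pos hp0 hp1 ha
  have hA := one_sub_pow_pos hp0 hp1 hj
  have hj' : (0 : ℝ) < j := by exact_mod_cast hj
  have ha' : (0 : ℝ) < a := by exact_mod_cast ha
  set x := p ^ a * sd p j with hx
  set y := √(a * (p ^ (j + a) * (1 - p ^ a))) with hy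
  have hx2 : x ^ 2 = j * (p ^ (j + a) * (p ^ a * (1 - p ^ j))) := by
    rw [hx, mul_pow, h2]; ring
  have hy2 : y ^ 2 = a * (p ^ (j + a) * (1 - p ^ a)) := Real.sq_sqrt (by positivity)
  have hx0 : 0 < x := mul_pos (by positivity) (sd_pos hp0 hp1 hj)
  have hy0 : 0 < y := Real.sqrt_pos.2 (by positivity)
  have hz0 := sd_pos hp0 hp1 (k := j + a) (by omega)
  have hP : 0 < p ^ (j + a) := by positivity
  -- A strict arithmetic-geometric mean inequality: with u, v as below, x² = jv and y² = au, so
  -- (2xy)² = 4(ju)(av), and ju ≠ av by `mul_pow_mul_one_sub_pow_lt`. Since `sd p (j + a)` squared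
  -- is x² + y² + ju + av, this yields x + y < `sd p (j + a)`.
  have key : 2 * x * y < j * (p ^ (j + a) * (1 - p ^ a)) + a * (p ^ (j + a) * (p ^ a * (1 - p ^ j))) := by
    set u := p ^ (j + a) * (1 - p ^ a) with hu
    set v := p ^ (j + a) * (p ^ a * (1 - p ^ j)) with hv
    have huv : a * v < j * u := by
      have := mul_lt_mul_of_pos_left h hP
      simp only [hu, hv]; linarith
    have hsq : (2 * x * y) ^ 2 < (j * u + a * v) ^ 2 := by
      have : (2 * x * y) ^ 2 = 4 * (j * v) * (a * u) := by
        rw [mul_pow, mul_pow, hx2, hy2]; ring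
      rw [this]
      nlinarith [mul_pos (sub_pos.2 huv) (sub_pos.2 huv)]
    have hv0 : 0 < v := by positivity
    have hu0 : 0 < u := by positivity
    exact lt_of_pow_lt_pow_left₀ 2 (by positivity) hsq
  have hlt : x + y < sd p (j + a) := by
    refine lt_of_pow_lt_pow_left₀ 2 hz0.le ?_
    rw [h1, add_sq, hx2, hy2]
    push_cast
    have : (1 : ℝ) - p ^ (j + a) = (1 - p ^ a) + p ^ a * (1 - p ^ j) := by ring
    rw [this]
    nlinarith
  refine ⟨by linarith, ?_⟩
  rw [← hy2]
  exact pow_lt_pow_left₀ (by linarith) hy0.le two_ne_zero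

/-- After squaring, the left side splits into a factor for k and a factor for j, each bounded by
`mul_pow_sub_mul_le`. The left side is what an extreme k-set meeting a j-set in i points adds to the
latter's codegree, and the bound is the share i/j of the extreme value; equality needs the two sets
to coincide. -/
lemma tilt_term_le (hp0 : 0 < p) (hp1 : p < 1) {i j k : ℕ} (hi : 0 < i) (hik : i ≤ k)
    (hij : i ≤ j) :
    k / sd p k * (p ^ (k + j - i) * (1 - p ^ i)) ≤ i * (sd p j / j) ∧
    ((i < k ∨ i < j) → k / sd p k * (p ^ (k + j - i) * (1 - p ^ i)) < i * (sd p j / j)) := by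
  have hk : 0 < k := by omega
  have hj : 0 < j := by omega
  have hsk := sd_pos hp0 hp1 hk
  have hsj := sd_pos hp0 hp1 hj
  have hA := one_sub_pow_pos hp0 hp1 hi
  have hk' : (0 : ℝ) < k := by exact_mod_cast hk
  have hj' : (0 : ℝ) < j := by exact_mod_cast hj
  have hi' : (0 : ℝ) < i := by exact_mod_cast hi
  have hAk := one_sub_pow_pos hp0 hp1 hk
  have hAj := one_sub_pow_pos hp0 hp1 hj
  set X := k / sd p k * (p ^ (k + j - i) * (1 - p ^ i)) with hX
  set Y := i * (sd p j / j) with hY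
  have hX0 : 0 ≤ X := by positivity
  have hY0 : 0 ≤ Y := by positivity
  have hXX : X ^ 2 = (k * p ^ (k - i) * (1 - p ^ i)) * (j * p ^ (j - i) * (1 - p ^ i)) *
      (p ^ j / (j * (1 - p ^ k))) := by
    have e2 : p ^ k = p ^ (k - i) * p ^ i := by rw [← pow_add]; congr 1; omega
    have e3 : p ^ j = p ^ (j - i) * p ^ i := by rw [← pow_add]; congr 1; omega
    have e4 : p ^ (k + j - i) = p ^ (k - i) * p ^ j := by rw [← pow_add]; congr 1; omega
    rw [hX, mul_pow, div_pow, sd_sq hp0 hp1, e4]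
    generalize 1 - p ^ k = Z at *
    rw [e2, e3]
    have : 0 < p ^ (k - i) := by positivity
    field_simp
  have hYY : Y ^ 2 = (i * (1 - p ^ k)) * (i * (1 - p ^ j)) * (p ^ j / (j * (1 - p ^ k))) := by
    rw [hY, mul_pow, div_pow, sd_sq hp0 hp1]
    field_simp
  have f1 := mul_pow_sub_mul_le hp0 hp1 hi hik
  have f2 := mul_pow_sub_mul_le hp0 hp1 hi hij
  have hc : 0 < p ^ j / (j * (1 - p ^ k)) := by positivity
  constructor
  · refine le_of_sq_le_sq ?_ hY0
    rw [hXX, hYY]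
    refine mul_le_mul_of_nonneg_right (mul_le_mul f1 f2 (by positivity) (by positivity)) hc.le
  · rintro (h | h)
    · refine lt_of_pow_lt_pow_left₀ 2 hY0 ?_
      rw [hXX, hYY]
      exact mul_lt_mul_of_pos_right (mul_lt_mul (mul_pow_sub_mul_lt hp0 hp1 hi h) f2
        (by positivity) (by positivity)) hc
    · refine lt_of_pow_lt_pow_left₀ 2 hY0 ?_
      rw [hXX, hYY]
      exact mul_lt_mul_of_pos_right (mul_lt_mul' f1 (mul_pow_sub_mul_lt hp0 hp1 hi h)
        (by positivity) (by positivity)) hc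

/-- Conditionally on disjoint sets `B b` having extreme numbers of common neighbours, the expected
number of common neighbours of another set `J` is below its maximal value. -/
lemma tilt_const {α ι : Type*} [DecidableEq α] [Fintype ι] (hp0 : 0 < p) (hp1 : p < 1)
    (B : ι → Finset α) (hB : Pairwise fun b b' => Disjoint (B b) (B b')) {J : Finset α}
    (hJ : J.Nonempty) (hJB : ∀ b, J ≠ B b) :
    ∑ b, (B b).card / sd p (B b).card * (p ^ (B b ∪ J).card - p ^ ((B b).card + J.card)) <
      sd p J.card := by
  have hj : 0 < J.card := hJ.card_pos
  have hj' : (0 : ℝ) < J.card := by exact_mod_cast hj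
  have hsj := sd_pos hp0 hp1 hj
  have hterm : ∀ b, (B b).card / sd p (B b).card *
      (p ^ (B b ∪ J).card - p ^ ((B b).card + J.card)) ≤ (B b ∩ J).card * (sd p J.card / J.card) ∧
      (0 < (B b ∩ J).card → (B b).card / sd p (B b).card *
      (p ^ (B b ∪ J).card - p ^ ((B b).card + J.card)) <
        (B b ∩ J).card * (sd p J.card / J.card)) := by
    intro b
    have hcard : (B b ∪ J).card + (B b ∩ J).card = (B b).card + J.card :=
      Finset.card_union_add_card_inter _ _
    have hik : (B b ∩ J).card ≤ (B b).card := Finset.card_le_card Finset.inter_subset_left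
    have hij : (B b ∩ J).card ≤ J.card := Finset.card_le_card Finset.inter_subset_right
    have hpow : p ^ (B b ∪ J).card - p ^ ((B b).card + J.card) =
        p ^ ((B b).card + J.card - (B b ∩ J).card) * (1 - p ^ (B b ∩ J).card) := by
      rw [mul_sub, mul_one, ← pow_add]
      congr 2 <;> omega
    rcases Nat.eq_zero_or_pos (B b ∩ J).card with h0 | h0
    · rw [hpow, h0]; simp
    · rw [hpow]
      obtain ⟨h1, h2⟩ := tilt_term_le hp0 hp1 h0 hik hij
      refine ⟨h1, fun _ => h2 ?_⟩
      by_contra hcon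
      push Not at hcon
      have e1 := Finset.eq_of_subset_of_card_le (Finset.inter_subset_left (s₁ := B b) (s₂ := J)) hcon.1
      have e2 := Finset.eq_of_subset_of_card_le (Finset.inter_subset_right (s₁ := B b) (s₂ := J)) hcon.2
      exact hJB b (e2.symm.trans e1)
  -- Disjoint sets claim disjoint parts of `J`, so the shares add up to at most one. Strictness
  -- comes from a set that meets `J` without being equal to it; if there is none, the sum is at most
  -- 0.
  have hsum : ∑ b, (B b ∩ J).card ≤ J.card := by
    rw [← Finset.card_biUnion]
    · exact Finset.card_le_card (Finset.biUnion_subset.2 fun b _ => Finset.inter_subset_right)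
    · intro b _ b' _ hbb'
      exact (hB hbb').mono Finset.inter_subset_left Finset.inter_subset_left
  by_cases hex : ∃ b, 0 < (B b ∩ J).card
  · obtain ⟨b, hb⟩ := hex
    calc _ < ∑ b, ((B b ∩ J).card : ℝ) * (sd p J.card / J.card) :=
          Finset.sum_lt_sum (fun b _ => (hterm b).1) ⟨b, Finset.mem_univ _, (hterm b).2 hb⟩
      _ = ((∑ b, (B b ∩ J).card : ℕ) : ℝ) * (sd p J.card / J.card) := by
          push_cast; rw [Finset.sum_mul]
      _ ≤ J.card * (sd p J.card / J.card) :=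
          mul_le_mul_of_nonneg_right (by exact_mod_cast hsum) (by positivity)
      _ = _ := by field_simp
  · push Not at hex
    refine lt_of_le_of_lt (Finset.sum_nonpos fun b _ => ?_) hsj
    have := (hterm b).1
    rwa [Nat.le_zero.1 (hex b), Nat.cast_zero, zero_mul] at this

end Constants

/-! ### Common neighbourhoods: independence, exact laws, joint Chernoff bounds. -/

section CommonNeighbours

variable {W : Type*}

/-- All vertices of `J` are joined to `v` by edges marked by `ω`. -/
def AdjAll (ω : Sym2 W → Bool) (J : Finset W) (v : W) : Prop := ∀ u ∈ J, ω s(u, v) = true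

instance (ω : Sym2 W → Bool) (J : Finset W) : DecidablePred (AdjAll ω J) := fun v => by
  unfold AdjAll; infer_instance

/-- The potential edges between `v` and `J`. -/
def star (J : Finset W) (v : W) : Set (Sym2 W) := {e | ∃ u ∈ J, e = s(u, v)}

lemma dependsOn_adjAll (J : Finset W) (v : W) :
    DependsOn (fun ω : Sym2 W → Bool => AdjAll ω J v) (star J v) := fun x y hxy =>
  propext (forall₂_congr fun u hu => by rw [hxy s(u, v) ⟨u, hu, rfl⟩])

/-- A common pair s(u, v) = s(u', v') forces u = u' and v = v', or v = u'. The second case is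
excluded by `hv`, so a condition on one side suffices. -/
lemma disjoint_star {J J' : Finset W} {v v' : W} (hv : v ∉ J') (h : v ≠ v' ∨ Disjoint J J') :
    Disjoint (star J v) (star J' v') := by
  rw [Set.disjoint_left]
  rintro e ⟨u, hu, rfl⟩ ⟨u', hu', he⟩
  rcases Sym2.eq_iff.1 he with ⟨h1, h2⟩ | ⟨h1, h2⟩
  · rcases h with h | h
    · exact h h2
    · exact Finset.disjoint_left.1 h hu (h1 ▸ hu')
  · exact hv (h2 ▸ hu')

lemma AdjAll.mono {ω ω' : Sym2 W → Bool} (h : ω ≤ ω') {J : Finset W} {v : W}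
    (hJ : AdjAll ω J v) : AdjAll ω' J v := fun u hu => by
  have := h s(u, v)
  rw [hJ u hu] at this
  exact le_antisymm le_top this

variable [DecidableEq W]

lemma adjAll_union {ω : Sym2 W → Bool} {J J' : Finset W} {v : W} :
    AdjAll ω (J ∪ J') v ↔ AdjAll ω J v ∧ AdjAll ω J' v := by
  simp only [AdjAll, Finset.mem_union]
  exact ⟨fun h => ⟨fun u hu => h u (Or.inl hu), fun u hu => h u (Or.inr hu)⟩,
    fun h u hu => hu.elim (h.1 u) (h.2 u)⟩

variable [Fintype W] {p : ℝ}

lemma pr_adjAll (p : ℝ) (J : Finset W) (v : W) :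
    pr p (fun ω => AdjAll ω J v) = p ^ J.card := by
  have h : ∀ ω : Sym2 W → Bool, AdjAll ω J v ↔ ∀ e ∈ J.image (fun u => s(u, v)), ω e = true := by
    intro ω; simp [AdjAll]
  rw [pr_congr h, pr_forall_mem, Finset.card_image_of_injective]
  intro a b hab
  exact Sym2.congr_left.1 hab

/-- The number of common neighbours of `J` outside `S`. -/
def outDeg (S J : Finset W) (ω : Sym2 W → Bool) : ℕ := (Sᶜ.filter (AdjAll ω J)).card

/-- The number of common neighbours of `C`. -/
def codeg (ω : Sym2 W → Bool) (C : Finset W) : ℕ := outDeg C C ω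

/-- A joint Chernoff bound for the numbers of common neighbours of several sets. -/
lemma pr_sum_card_ge_le {κ : Type*} [Fintype κ] (hp : p ∈ Set.Icc (0 : ℝ) 1) (s : Finset W)
    (F : κ → Finset W) (hF : ∀ a, ∀ v ∈ s, v ∉ F a) (c : κ → ℝ) {τ : ℝ} (hτ : 0 < τ)
    (hτc : τ * ∑ a, |c a| ≤ 1 / 4) (t : ℝ) :
    pr p (fun ω => t ≤ ∑ a, c a * ((s.filter (AdjAll ω (F a))).card : ℝ)) ≤
      Real.exp (-(τ * (t - s.card * ∑ a, c a * p ^ (F a).card)) +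
        s.card * (τ ^ 2 * (∑ a, ∑ a', c a * c a' *
          (p ^ (F a ∪ F a').card - p ^ ((F a).card + (F a').card))) / 2 +
          8 * (τ * ∑ a, |c a|) ^ 3)) := by
  classical
  -- The contribution of a single vertex `v`. Different `v` use disjoint sets of pairs, and the
  -- covariance of the indicators for two sets F, F' is p^|F ∪ F'| - p^(|F| + |F'|).
  set Y : W → (Sym2 W → Bool) → ℝ := fun v ω => τ * ∑ a, c a * ind (AdjAll ω (F a) v) with hY
  set Q : W → Set (Sym2 W) := fun v => ⋃ a, star (F a) v with hQ
  have hdep : ∀ v ∈ s, DependsOn (Y v) (Q v) := by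
    intro v _ x y hxy
    simp only [hY]
    congr 1
    refine Finset.sum_congr rfl fun a _ => ?_
    rw [show AdjAll x (F a) v = AdjAll y (F a) v from dependsOn_adjAll (F a) v fun e he =>
      hxy e (Set.mem_iUnion.2 ⟨a, he⟩)]
  have hdisj : (s : Set W).PairwiseDisjoint Q := by
    intro v hv v' _ hvv'
    simp only [Function.onFun, hQ, Set.disjoint_iUnion_left, Set.disjoint_iUnion_right]
    exact fun a a' => disjoint_star (hF _ v hv) (Or.inl hvv')
  have hμ : ∀ v ∈ s, ex p (Y v) = τ * ∑ a, c a * p ^ (F a).card := by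
    intro v _
    simp only [hY, ex_const_mul, ex_sum]
    congr 1
    refine Finset.sum_congr rfl fun a _ => ?_
    rw [← pr_adjAll p (F a) v, pr]
  have hV : ∀ v ∈ s, ex p (fun ω => Y v ω ^ 2) - (τ * ∑ a, c a * p ^ (F a).card) ^ 2 ≤
      τ ^ 2 * (∑ a, ∑ a', c a * c a' *
          (p ^ (F a ∪ F a').card - p ^ ((F a).card + (F a').card))) := by
    intro v _
    apply le_of_eq
    have h1 : (fun ω => Y v ω ^ 2) = fun ω => τ ^ 2 * ∑ a, ∑ a', c a * c a' *
        ind (AdjAll ω (F a ∪ F a') v) := by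
      ext ω
      simp only [hY, mul_pow, pow_two (∑ a, _), Finset.sum_mul_sum, adjAll_union, ind_and]
      congr 1
      exact Finset.sum_congr rfl fun a _ => Finset.sum_congr rfl fun a' _ => by ring
    have h2 : ∀ J : Finset W, ex p (fun ω => ind (AdjAll ω J v)) = p ^ J.card := fun J =>
      pr_adjAll p J v
    rw [h1]
    simp only [ex_const_mul, ex_sum, h2]
    rw [mul_pow, pow_two (∑ a, _), Finset.sum_mul_sum, ← mul_sub, ← Finset.sum_sub_distrib]
    congr 1
    refine Finset.sum_congr rfl fun a _ => ?_
    rw [← Finset.sum_sub_distrib]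
    exact Finset.sum_congr rfl fun a' _ => by rw [pow_add]; ring
  have hbd : ∀ v ∈ s, ∀ ω, |Y v ω| ≤ τ * ∑ a, |c a| := by
    intro v _ ω
    simp only [hY, abs_mul, abs_of_pos hτ]
    refine mul_le_mul_of_nonneg_left ((Finset.abs_sum_le_sum_abs _ _).trans
      (Finset.sum_le_sum fun a _ => ?_)) hτ.le
    rw [abs_mul, abs_of_nonneg (ind_nonneg _)]
    exact mul_le_of_le_one_right (abs_nonneg _) (ind_le_one _)
  have h := pr_sum_ge_le hp s (t := τ * t) hdep hdisj hτc hbd hμ hV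
  have hev : ∀ ω, t ≤ ∑ a, c a * ((s.filter (AdjAll ω (F a))).card : ℝ) ↔
      τ * t ≤ ∑ v ∈ s, Y v ω := by
    intro ω
    have : ∑ v ∈ s, Y v ω = τ * ∑ a, c a * ((s.filter (AdjAll ω (F a))).card : ℝ) := by
      simp only [hY, card_filter_eq_sum_ind, Finset.mul_sum]
      rw [Finset.sum_comm]
    rw [this, mul_le_mul_iff_right₀ hτ]
  rw [pr_congr hev]
  refine h.trans (Real.exp_le_exp.2 (le_of_eq ?_))
  ring

lemma filter_adjAll_card_law (p : ℝ) (s F : Finset W) (hF : ∀ v ∈ s, v ∉ F) (l : ℕ) :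
    pr p (fun ω => (s.filter (AdjAll ω F)).card = l) = binom s.card (p ^ F.card) l :=
  pr_card_filter_eq p _ s (fun v ω => AdjAll ω F v) (fun v _ => dependsOn_adjAll F v)
    (fun v hv _ _ hvv' => disjoint_star (hF v hv) (Or.inl hvv')) (fun v _ => pr_adjAll p F v) l

lemma pr_card_filter_ge (p : ℝ) (s F : Finset W) (hF : ∀ v ∈ s, v ∉ F) (l : ℕ) :
    pr p (fun ω => l ≤ (s.filter (AdjAll ω F)).card) = binomTail s.card (p ^ F.card) l := by
  classical
  have h : ∀ ω : Sym2 W → Bool, ind (l ≤ (s.filter (AdjAll ω F)).card) =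
      ∑ j ∈ Finset.Ico l (s.card + 1), ind ((s.filter (AdjAll ω F)).card = j) := by
    intro ω
    have hle : (s.filter (AdjAll ω F)).card ≤ s.card := Finset.card_filter_le _ _
    by_cases hl : l ≤ (s.filter (AdjAll ω F)).card
    · rw [ind_of_true hl, Finset.sum_eq_single_of_mem (s.filter (AdjAll ω F)).card
        (by rw [Finset.mem_Ico]; omega) fun j _ hj => ind_of_false hj.symm, ind_of_true rfl]
    · rw [ind_of_false hl, Finset.sum_eq_zero]
      intro j hj
      rw [Finset.mem_Ico] at hj
      exact ind_of_false (by omega)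
  simp only [pr, h]
  rw [ex_sum, binomTail]
  exact Finset.sum_congr rfl fun j _ => filter_adjAll_card_law p s F hF j

lemma dependsOn_outDeg (S J : Finset W) :
    DependsOn (outDeg S J) (⋃ v ∈ Sᶜ, star J v) := fun x y hxy => by
  unfold outDeg
  congr 1
  refine Finset.filter_congr fun v hv => ?_
  rw [show AdjAll x J v = AdjAll y J v from dependsOn_adjAll J v fun e he =>
    hxy e (Set.mem_biUnion hv he)]

/-- The numbers of outer common neighbours of disjoint sets are independent. -/
lemma pr_outDeg_eq {ι : Type*} [Fintype ι] (p : ℝ) (S : Finset W) (B : ι → Finset W)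
    (hBS : ∀ b, B b ⊆ S) (hB : Pairwise fun b b' => Disjoint (B b) (B b')) (l : ι → ℕ) :
    pr p (fun ω => ∀ b, outDeg S (B b) ω = l b) =
      ∏ b, binom Sᶜ.card (p ^ (B b).card) (l b) := by
  simp only [pr, ind_forall]
  rw [ex_prod_of_dependsOn p Finset.univ (Q := fun b => ⋃ v ∈ Sᶜ, star (B b) v)]
  · exact Finset.prod_congr rfl fun b _ => filter_adjAll_card_law p _ _
      (fun v hv h => Finset.mem_compl.1 hv (hBS b h)) _
  · intro b _ x y hxy
    beta_reduce
    rw [dependsOn_outDeg S (B b) hxy]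
  · intro b _ b' _ hbb'
    simp only [Function.onFun, Set.disjoint_iUnion_left, Set.disjoint_iUnion_right]
    exact fun v hv v' hv' => disjoint_star (fun h => Finset.mem_compl.1 hv' (hBS b' h))
      (Or.inr (hB hbb'))

end CommonNeighbours

/-! ### Polynomial bounds for rival codegrees. -/

section Deviations

open Topology

variable {p : ℝ}

/-- The exponential tilting parameter at the extreme scale. -/
noncomputable def tilt (n : ℕ) : ℝ := √(2 * Real.log n / n)

/-- The threshold `n p ^ j + (1 + ε) √(2 n ln n) sd p j` for numbers of common neighbours. -/
noncomputable def level (p ε : ℝ) (j n : ℕ) : ℝ :=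
  n * p ^ j + (1 + ε) * (√(2 * n * Real.log n) * sd p j)

lemma tilt_pos {n : ℕ} (hn : 1 < n) : 0 < tilt n := by
  have := Real.log_pos (x := n) (by exact_mod_cast hn)
  have : (0 : ℝ) < n := by positivity
  exact Real.sqrt_pos.2 (by positivity)

/-- Together with `tilt_mul_sqrt` this makes the linear and the quadratic term of the Chernoff
exponent multiples of log n, so the bounds become powers of n; the cubic term vanishes in the limit
by `tendsto_mul_tilt_cube`. -/
lemma tilt_sq {n : ℕ} (hn : 1 < n) : n * tilt n ^ 2 = 2 * Real.log n := by
  have := Real.log_pos (x := n) (by exact_mod_cast hn)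
  have : (0 : ℝ) < n := by positivity
  rw [tilt, Real.sq_sqrt (by positivity)]; field_simp

lemma tilt_mul_sqrt {n : ℕ} (hn : 1 < n) :
    tilt n * √(2 * n * Real.log n) = 2 * Real.log n := by
  have := Real.log_pos (x := n) (by exact_mod_cast hn)
  have : (0 : ℝ) < n := by positivity
  rw [tilt, ← Real.sqrt_mul (by positivity), ← Real.sqrt_sq (by positivity : 0 ≤ 2 * Real.log n)]
  congr 1
  rw [Real.sqrt_sq (by positivity)]
  field_simp

lemma tendsto_tilt : Tendsto tilt atTop (𝓝 0) := by
  have := ((tendsto_log_pow_div 1).const_mul 2).sqrt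
  rw [mul_zero, Real.sqrt_zero] at this
  refine this.congr fun n => ?_
  rw [tilt, pow_one, mul_div_assoc]

lemma tendsto_log_mul_tilt : Tendsto (fun n : ℕ => Real.log n * tilt n) atTop (𝓝 0) := by
  have := ((tendsto_log_pow_div 3).const_mul 2).sqrt
  rw [mul_zero, Real.sqrt_zero] at this
  refine this.congr' ?_
  filter_upwards [eventually_gt_atTop 1] with n hn
  have h1 := Real.log_pos (x := n) (by exact_mod_cast hn)
  have h2 : (0 : ℝ) < n := by positivity
  have h3 := tilt_pos hn
  rw [← Real.sqrt_sq (by positivity : 0 ≤ Real.log n * tilt n), mul_pow]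
  congr 1
  have := tilt_sq hn
  field_simp
  linarith

lemma tendsto_mul_tilt_cube (C : ℝ) :
    Tendsto (fun n : ℕ => n * (8 * (tilt n * C) ^ 3)) atTop (𝓝 0) := by
  have := tendsto_log_mul_tilt.const_mul (16 * C ^ 3)
  rw [mul_zero] at this
  refine this.congr' ?_
  filter_upwards [eventually_gt_atTop 1] with n hn
  have := tilt_sq hn
  linear_combination (-8 * C ^ 3 * tilt n) * this

lemma tendsto_pow_mul_exp {K : ℕ} {G : ℝ} (hG : K < G) {err : ℕ → ℝ} {c : ℝ}
    (herr : Tendsto err atTop (𝓝 c)) :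
    Tendsto (fun n : ℕ => (n : ℝ) ^ K * Real.exp (-(Real.log n * G) + err n)) atTop (𝓝 0) := by
  have h1 : Tendsto (fun n : ℕ => -(Real.log n * (G - K)) + err n) atTop atBot := by
    refine Tendsto.atBot_add ?_ herr
    exact tendsto_neg_atTop_atBot.comp (tendsto_log_natCast.atTop_mul_const (by linarith))
  refine (Real.tendsto_exp_atBot.comp h1).congr' ?_
  filter_upwards [eventually_gt_atTop 1] with n hn
  have h2 : (0 : ℝ) < n := by positivity
  have : (n : ℝ) ^ K = Real.exp (K * Real.log n) := by rw [Real.exp_nat_mul, Real.exp_log h2]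
  rw [this, ← Real.exp_add, Function.comp_apply]
  congr 1; ring

/-- If disjoint sets have extreme numbers of common neighbours, then no other set does. -/
lemma atypical_set_bound {α ι : Type*} [Fintype α] [DecidableEq α] [Fintype ι]
    (hp0 : 0 < p) (hp1 : p < 1) (A : ι → Finset α) (hA0 : ∀ b, (A b).Nonempty)
    (hA : Pairwise fun b b' => Disjoint (A b) (A b')) {J : Finset α} (hJ : J.Nonempty)
    (hJA : ∀ b, J ≠ A b) :
    ∀ᶠ ε in 𝓝[>] (0 : ℝ), ∃ e : ℕ → ℝ,
      Tendsto (fun n : ℕ => (n : ℝ) ^ (∑ b, (A b).card) * e n) atTop (𝓝 0) ∧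
      ∀ᶠ n in atTop, ∀ T : α ↪ Fin n, pr p (fun ω =>
        (∀ b, level p (-ε) (A b).card n ≤ outDeg (Finset.univ.map T) ((A b).map T) ω) ∧
        level p (-ε) J.card n ≤ outDeg (Finset.univ.map T) (J.map T) ω) ≤ e n := by
  classical
  have hpI : p ∈ Set.Icc (0 : ℝ) 1 := ⟨hp0.le, hp1.le⟩
  set K : ℕ := ∑ b, (A b).card with hK
  set cov : ℝ := ∑ b, (A b).card / sd p (A b).card *
    (p ^ (A b ∪ J).card - p ^ ((A b).card + J.card)) with hcov
  -- The weight of `J` in the Chernoff bound; `A b` gets the optimal weight |A b| / `sd`, for which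
  -- its variance is |A b| per unit. Here `cov` is the level that `J` reaches because the `A b` are
  -- extreme, so `m` is the part still to be explained, positive by `tilt_const`.
  set m : ℝ := sd p J.card - cov with hm
  have hm0 : 0 < m := sub_pos.2 (tilt_const hp0 hp1 A hA hJ hJA)
  set v : ℝ := p ^ J.card * (1 - p ^ J.card) with hv
  have hv0 : 0 < v := mul_pos (by positivity) (one_sub_pow_pos hp0 hp1 hJ.card_pos)
  have hv1 : v ≤ 1 := mul_le_one₀ (pow_le_one₀ hp0.le hp1.le)
    (one_sub_pow_pos hp0 hp1 hJ.card_pos).le (by linarith [pow_pos hp0 J.card])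
  have hσ := fun b => sd_pos hp0 hp1 (hA0 b).card_pos
  set VAR : ℝ := K + 2 * m * cov + m ^ 2 * v with hVAR
  have hcov0 : 0 ≤ cov := Finset.sum_nonneg fun b _ => by
    refine mul_nonneg (div_nonneg (Nat.cast_nonneg _) (hσ b).le) (sub_nonneg.2 ?_)
    exact pow_le_pow_of_le_one hp0.le hp1.le (Finset.card_union_le _ _)
  have hVAR0 : 0 ≤ VAR := by positivity
  -- At ε = 0 the right side is K + 2m(sd - cov) - m²v = K + m²(2 - v), which exceeds K because v ≤
  -- 1. So asking `J` to be large costs a power of n beyond the n^K tuples, and this persists for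
  -- small ε.
  have hG : ∀ᶠ ε in 𝓝[>] (0 : ℝ), (K : ℝ) < 2 * (1 + -ε) * (K + m * sd p J.card) - VAR := by
    have hcont : Tendsto (fun ε : ℝ => 2 * (1 + -ε) * (K + m * sd p J.card) - VAR) (𝓝[>] 0)
        (𝓝 (2 * (1 + -0) * (K + m * sd p J.card) - VAR)) := by
      refine (Continuous.tendsto ?_ 0).mono_left nhdsWithin_le_nhds
      fun_prop
    refine hcont.eventually (lt_mem_nhds ?_)
    have : sd p J.card = m + cov := by rw [hm]; ring
    rw [this, hVAR]
    nlinarith [mul_pos hm0 hm0]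
  filter_upwards [hG] with ε hε
  set c : Option ι → ℝ := fun a => a.elim m fun b => (A b).card / sd p (A b).card with hc
  have hc0 : ∀ a, 0 ≤ c a := by
    rintro (_ | b)
    · exact hm0.le
    · exact div_nonneg (Nat.cast_nonneg _) (hσ b).le
  set C : ℝ := ∑ a, |c a| with hC
  refine ⟨fun n => Real.exp (-(Real.log n * (2 * (1 + -ε) * (K + m * sd p J.card) - VAR)) +
    n * (8 * (tilt n * C) ^ 3)), tendsto_pow_mul_exp hε (tendsto_mul_tilt_cube C), ?_⟩
  have hsmall : ∀ᶠ n in atTop, tilt n * C < 1 / 4 := by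
    have := tendsto_tilt.mul_const C
    rw [zero_mul] at this
    exact this.eventually (gt_mem_nhds (by norm_num))
  filter_upwards [eventually_gt_atTop 1, hsmall] with n hn hs T
  set S := Finset.univ.map T with hS
  set F : Option ι → Finset (Fin n) := fun a => a.elim (J.map T) fun b => (A b).map T with hF
  have hFS : ∀ a, F a ⊆ S := by
    rintro (_ | b) <;> exact Finset.map_subset_map.2 (Finset.subset_univ _)
  set t : ℝ := (∑ b, (A b).card / sd p (A b).card * level p (-ε) (A b).card n) +
    m * level p (-ε) J.card n with ht
  have h1 := pr_sum_card_ge_le hpI Sᶜ F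
    (fun a v hv h => Finset.mem_compl.1 hv (hFS a h)) c (tilt_pos hn) hs.le t
  have hvar : ∑ a, ∑ a', c a * c a' *
      (p ^ (F a ∪ F a').card - p ^ ((F a).card + (F a').card)) = VAR := by
    have hbb : ∑ b, ∑ b', (A b).card / sd p (A b).card * ((A b').card / sd p (A b').card) *
        (p ^ ((A b).map T ∪ (A b').map T).card - p ^ (((A b).map T).card + ((A b').map T).card)) =
        K := by
      rw [hK]
      push_cast
      refine Finset.sum_congr rfl fun b _ => ?_
      rw [Finset.sum_eq_single_of_mem b (Finset.mem_univ _)]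
      · have h2 := sd_sq hp0 hp1 (A b).card
        have h3 := hσ b
        rw [Finset.union_self, Finset.card_map, div_mul_div_comm, ← pow_two (sd p _), h2]
        have h4 := one_sub_pow_pos hp0 hp1 (hA0 b).card_pos
        have h5 : (0 : ℝ) < (A b).card := by exact_mod_cast (hA0 b).card_pos
        rw [pow_add]
        field_simp
      · intro b' _ hb'
        have hd : Disjoint ((A b).map T) ((A b').map T) :=
          (Finset.disjoint_map T).2 (hA hb'.symm)
        rw [Finset.card_union_of_disjoint hd, sub_self, mul_zero]
    have hbJ : ∑ b, (A b).card / sd p (A b).card *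
        (p ^ ((A b).map T ∪ J.map T).card - p ^ (((A b).map T).card + (J.map T).card)) = cov := by
      rw [hcov]
      refine Finset.sum_congr rfl fun b _ => ?_
      rw [← Finset.map_union, Finset.card_map, Finset.card_map, Finset.card_map]
    simp only [Fintype.sum_option, hc, hF, Option.elim]
    rw [Finset.sum_add_distrib, hbb]
    have e1 : ∑ b, m * ((A b).card / sd p (A b).card) *
        (p ^ (J.map T ∪ (A b).map T).card - p ^ ((J.map T).card + ((A b).map T).card)) =
        m * cov := by
      rw [← hbJ, Finset.mul_sum]
      refine Finset.sum_congr rfl fun b _ => ?_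
      rw [Finset.union_comm, add_comm (J.map T).card]; ring
    have e2 : ∑ b, (A b).card / sd p (A b).card * m *
        (p ^ ((A b).map T ∪ J.map T).card - p ^ (((A b).map T).card + (J.map T).card)) =
        m * cov := by
      rw [← hbJ, Finset.mul_sum]
      exact Finset.sum_congr rfl fun b _ => by ring
    rw [e1, e2, Finset.union_self, Finset.card_map, hVAR, hv, pow_add]
    ring
  rw [hvar] at h1
  refine (pr_mono hpI fun ω hω => ?_).trans (h1.trans (Real.exp_le_exp.2 ?_))
  · simp only [Fintype.sum_option, hc, hF, Option.elim, ht]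
    rw [add_comm]
    refine add_le_add (mul_le_mul_of_nonneg_left hω.2 hm0.le)
      (Finset.sum_le_sum fun b _ => mul_le_mul_of_nonneg_left (hω.1 b) (hc0 (some b)))
  · have hcard : ((Sᶜ.card : ℕ) : ℝ) ≤ n := by
      have := Finset.card_le_univ Sᶜ
      rw [Fintype.card_fin] at this
      exact_mod_cast this
    have hmean : ∑ a, c a * p ^ (F a).card = (∑ b, (A b).card / sd p (A b).card * p ^ (A b).card) +
        m * p ^ J.card := by
      simp only [Fintype.sum_option, hc, hF, Option.elim, Finset.card_map]
      ring
    have hmean0 : 0 ≤ ∑ a, c a * p ^ (F a).card :=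
      Finset.sum_nonneg fun a _ => mul_nonneg (hc0 a) (by positivity)
    have htn : t - n * ∑ a, c a * p ^ (F a).card =
        (1 + -ε) * (√(2 * n * Real.log n) * (K + m * sd p J.card)) := by
      rw [hmean, ht, hK, mul_add, Finset.mul_sum, add_sub_add_comm, ← Finset.sum_sub_distrib]
      have : ∀ b ∈ Finset.univ, (A b).card / sd p (A b).card * level p (-ε) (A b).card n -
          n * ((A b).card / sd p (A b).card * p ^ (A b).card) =
          (1 + -ε) * √(2 * n * Real.log n) * (A b).card := by
        intro b _
        have := hσ b
        rw [level]; field_simp; ring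
      rw [Finset.sum_congr rfl this, ← Finset.mul_sum, level]
      push_cast
      ring
    have h2 : tilt n * (t - n * ∑ a, c a * p ^ (F a).card) ≤
        tilt n * (t - Sᶜ.card * ∑ a, c a * p ^ (F a).card) :=
      mul_le_mul_of_nonneg_left (by nlinarith) (tilt_pos hn).le
    rw [htn] at h2
    have h3 := tilt_mul_sqrt hn
    have h4 := tilt_sq hn
    have hC0 : 0 ≤ C := Finset.sum_nonneg fun a _ => abs_nonneg _
    have ht0 := (tilt_pos hn).le
    have h5 : (Sᶜ.card : ℝ) * (tilt n ^ 2 * VAR / 2 + 8 * (tilt n * C) ^ 3) ≤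
        n * (tilt n ^ 2 * VAR / 2 + 8 * (tilt n * C) ^ 3) :=
      mul_le_mul_of_nonneg_right hcard (by positivity)
    have h6 : tilt n * ((1 + -ε) * (√(2 * n * Real.log n) * (K + m * sd p J.card))) =
        2 * Real.log n * ((1 + -ε) * (K + m * sd p J.card)) := by
      rw [← h3]; ring
    have h7 : n * (tilt n ^ 2 * VAR / 2 + 8 * (tilt n * C) ^ 3) =
        Real.log n * VAR + n * (8 * (tilt n * C) ^ 3) := by
      linear_combination (VAR / 2) * h4
    rw [h6] at h2
    rw [h7] at h5
    linarith

/-- Extending a set with at most extremely many common neighbours by `a` further vertices. -/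
lemma overlap_bound (hp0 : 0 < p) (hp1 : p < 1) {j a : ℕ} (hj : 0 < j) (ha : 0 < a) :
    ∀ᶠ ε in 𝓝[>] (0 : ℝ), ∀ C : ℝ, ∃ e : ℕ → ℝ,
      Tendsto (fun n : ℕ => (n : ℝ) ^ a * e n) atTop (𝓝 0) ∧
      ∀ᶠ n in atTop, ∀ s F : Finset (Fin n), (∀ v ∈ s, v ∉ F) → F.card = a →
        (s.card : ℝ) ≤ level p ε j n →
        pr p (fun ω => level p (-ε) (j + a) n - C ≤ ((s.filter (AdjAll ω F)).card : ℝ)) ≤ e n := by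
  have hpI : p ∈ Set.Icc (0 : ℝ) 1 := ⟨hp0.le, hp1.le⟩
  obtain ⟨hΔ, hΔ2⟩ := overlap_const hp0 hp1 hj ha
  set Δ := sd p (j + a) - p ^ a * sd p j with hΔdef
  have hva := one_sub_pow_pos hp0 hp1 ha
  set v : ℝ := p ^ (j + a) * (1 - p ^ a) with hv
  have hv0 : 0 < v := by positivity
  -- The maximizer of 2λΔ - λ²v. The maximum Δ²/v exceeds `a` by `overlap_const`, which beats the
  -- n^a choices of the additional vertices.
  set lam := Δ / v with hlam
  have hlam0 : 0 < lam := by positivity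
  have hsj := sd_pos hp0 hp1 hj
  have hsk := sd_pos hp0 hp1 (k := j + a) (by omega)
  have hG : ∀ᶠ ε in 𝓝[>] (0 : ℝ), (a : ℝ) <
      2 * lam * ((1 + -ε) * sd p (j + a) - (1 + ε) * (p ^ a * sd p j)) - lam ^ 2 * v := by
    have hcont : Tendsto (fun ε : ℝ =>
        2 * lam * ((1 + -ε) * sd p (j + a) - (1 + ε) * (p ^ a * sd p j)) - lam ^ 2 * v) (𝓝[>] 0)
        (𝓝 (2 * lam * ((1 + -0) * sd p (j + a) - (1 + 0) * (p ^ a * sd p j)) - lam ^ 2 * v)) := by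
      refine (Continuous.tendsto ?_ 0).mono_left nhdsWithin_le_nhds
      fun_prop
    refine hcont.eventually (lt_mem_nhds ?_)
    have : 2 * lam * ((1 + -0) * sd p (j + a) - (1 + 0) * (p ^ a * sd p j)) - lam ^ 2 * v =
        Δ ^ 2 / v := by
      rw [show (1 + -0) * sd p (j + a) - (1 + 0) * (p ^ a * sd p j) = Δ by rw [hΔdef]; ring, hlam]
      field_simp; ring
    rw [this, lt_div_iff₀ hv0]
    exact hΔ2
  filter_upwards [hG, self_mem_nhdsWithin] with ε hε hε0 C
  have hε0 : 0 < ε := hε0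
  refine ⟨fun n => Real.exp (-(Real.log n * (2 * lam * ((1 + -ε) * sd p (j + a) -
    (1 + ε) * (p ^ a * sd p j)) - lam ^ 2 * v)) + (tilt n * (lam * C) +
    (Real.log n * tilt n) * ((1 + ε) * sd p j * lam ^ 2 * (p ^ a * (1 - p ^ a))) +
    n * (8 * (tilt n * lam) ^ 3))), ?_, ?_⟩
  · exact tendsto_pow_mul_exp hε (((tendsto_tilt.mul_const _).add
      (tendsto_log_mul_tilt.mul_const _)).add (tendsto_mul_tilt_cube lam))
  have hsmall : ∀ᶠ n in atTop, tilt n * lam < 1 / 4 := by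
    have := tendsto_tilt.mul_const lam
    rw [zero_mul] at this
    exact this.eventually (gt_mem_nhds (by norm_num))
  filter_upwards [eventually_gt_atTop 1, hsmall] with n hn hs s F hsF hFa hsc
  have ht0 := tilt_pos hn
  have h1 := pr_sum_card_ge_le (κ := Unit) hpI s (fun _ => F) (fun _ => hsF) (fun _ => 1)
    (τ := tilt n * lam) (by positivity) (by simpa using hs.le) (level p (-ε) (j + a) n - C)
  simp only [Finset.univ_unique, Finset.sum_singleton, one_mul, abs_one, mul_one,
    Finset.union_self, hFa] at h1
  refine h1.trans (Real.exp_le_exp.2 ?_)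
  have h3 := tilt_mul_sqrt hn
  have h4 := tilt_sq hn
  have hL := Real.log_pos (x := n) (by exact_mod_cast hn)
  have hcard : ((s.card : ℕ) : ℝ) ≤ n := by
    have := Finset.card_le_univ s
    rw [Fintype.card_fin] at this
    exact_mod_cast this
  have g1 : (s.card : ℝ) * (8 * (tilt n * lam) ^ 3) ≤ n * (8 * (tilt n * lam) ^ 3) :=
    mul_le_mul_of_nonneg_right hcard (by positivity)
  have g2 : (s.card : ℝ) * (tilt n * lam * p ^ a + (tilt n * lam) ^ 2 * (p ^ a * (1 - p ^ a)) / 2) ≤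
      level p ε j n * (tilt n * lam * p ^ a + (tilt n * lam) ^ 2 * (p ^ a * (1 - p ^ a)) / 2) :=
    mul_le_mul_of_nonneg_right hsc (by positivity)
  have g3 : level p ε j n * (tilt n * lam * p ^ a + (tilt n * lam) ^ 2 * (p ^ a * (1 - p ^ a)) / 2) -
      tilt n * lam * (level p (-ε) (j + a) n - C) =
      -(Real.log n * (2 * lam * ((1 + -ε) * sd p (j + a) -
        (1 + ε) * (p ^ a * sd p j)) - lam ^ 2 * v)) + (tilt n * (lam * C) +
        (Real.log n * tilt n) * ((1 + ε) * sd p j * lam ^ 2 * (p ^ a * (1 - p ^ a)))) := by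
    simp only [level, hv]
    rw [pow_add]
    linear_combination (lam * (1 + ε) * sd p j * p ^ a - lam * (1 + -ε) * sd p (j + a) +
      (1 + ε) * sd p j * tilt n * lam ^ 2 * (p ^ a * (1 - p ^ a)) / 2) * h3 +
      (p ^ j * lam ^ 2 * (p ^ a * (1 - p ^ a)) / 2) * h4
  rw [pow_add p a a]
  calc _ = (s.card : ℝ) * (tilt n * lam * p ^ a + (tilt n * lam) ^ 2 * (p ^ a * (1 - p ^ a)) / 2) -
        tilt n * lam * (level p (-ε) (j + a) n - C) + s.card * (8 * (tilt n * lam) ^ 3) := by ring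
    _ ≤ _ := by linarith

end Deviations

/-! ### Exposing the edges at the roots: sets that overlap the exposed part. -/

section Exploration

open Topology

lemma binomTail_le_one {N : ℕ} {q : ℝ} (hq : q ∈ Set.Icc (0 : ℝ) 1) (l : ℕ) :
    binomTail N q l ≤ 1 := by
  have h := add_pow q (1 - q) N
  rw [add_sub_cancel, one_pow] at h
  rw [h, binomTail, Finset.range_eq_Ico]
  refine (Finset.sum_le_sum_of_subset_of_nonneg
    (Finset.Ico_subset_Ico_left (Nat.zero_le l)) fun j _ _ => binom_nonneg hq j).trans
    (le_of_eq (Finset.sum_congr rfl fun j _ => ?_))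
  rw [binom]; ring

section Merge

variable {W : Type*}

/-- The potential edges with an endpoint in `S`. -/
def touching (S : Finset W) : Set (Sym2 W) := {e | ∃ u ∈ S, u ∈ e}

lemma star_subset_touching {S J : Finset W} (h : J ⊆ S) (v : W) : star J v ⊆ touching S := by
  rintro e ⟨u, hu, rfl⟩
  exact ⟨u, h hu, Sym2.mem_mk_left _ _⟩

lemma merge_mono_right {E : Type*} (Q : Set E) (ω : E → Bool) {ω' ω'' : E → Bool} (h : ω' ≤ ω'') :
    merge Q ω ω' ≤ merge Q ω ω'' := fun e => by
  by_cases he : e ∈ Q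
  · rw [merge_of_mem he, merge_of_mem he]
  · rw [merge_of_notMem he, merge_of_notMem he]; exact h e

lemma adjAll_merge_of_subset {S J : Finset W} (h : J ⊆ S) (ω ω' : Sym2 W → Bool) (v : W) :
    AdjAll (merge (touching S) ω ω') J v ↔ AdjAll ω J v :=
  iff_of_eq (dependsOn_adjAll J v fun _ he => merge_of_mem (star_subset_touching h v he) ω ω')

lemma adjAll_merge_of_disjoint {S J : Finset W} (h : Disjoint J S) (ω ω' : Sym2 W → Bool) {v : W}
    (hv : v ∉ S) : AdjAll (merge (touching S) ω ω') J v ↔ AdjAll ω' J v := by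
  refine iff_of_eq (dependsOn_adjAll J v ?_)
  rintro e ⟨u, hu, rfl⟩
  refine merge_of_notMem ?_ ω ω'
  rintro ⟨w, hw, hwe⟩
  rcases Sym2.mem_iff.1 hwe with rfl | rfl
  · exact Finset.disjoint_left.1 h hu hw
  · exact hv hw

variable [DecidableEq W] [Fintype W]

lemma outDeg_merge {S J : Finset W} (h : J ⊆ S) (ω ω' : Sym2 W → Bool) :
    outDeg S J (merge (touching S) ω ω') = outDeg S J ω := by
  unfold outDeg
  congr 1
  exact Finset.filter_congr fun v _ => adjAll_merge_of_subset h ω ω' v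

lemma codeg_mono {ω ω' : Sym2 W → Bool} (h : ω ≤ ω') (C : Finset W) : codeg ω C ≤ codeg ω' C :=
  Finset.card_le_card fun v hv => by
    rw [Finset.mem_filter] at hv ⊢
    exact ⟨hv.1, hv.2.mono h⟩

lemma codeg_le_add_outDeg (S C : Finset W) (ω : Sym2 W → Bool) :
    codeg ω C ≤ S.card + outDeg S C ω := by
  refine (Finset.card_le_card (t := S ∪ Sᶜ.filter (AdjAll ω C)) fun v hv => ?_).trans
    (Finset.card_union_le _ _)
  rw [Finset.mem_filter] at hv
  rw [Finset.mem_union, Finset.mem_filter, Finset.mem_compl]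
  by_cases h : v ∈ S
  · exact Or.inl h
  · exact Or.inr ⟨h, hv.2⟩

lemma outDeg_le_codeg {S C : Finset W} (hC : C ⊆ S) (ω : Sym2 W → Bool) :
    outDeg S C ω ≤ codeg ω C :=
  Finset.card_le_card (Finset.filter_subset_filter _ (Finset.compl_subset_compl.2 hC))

/-- For vertices outside `S`, pairs with `C ∩ S` are exposed and pairs with `C \ S` are fresh. Given
ω, what remains is a binomial count inside the known common neighbourhood of `C ∩ S`; the vertices
of `S` cost at most |S|. -/
lemma codeg_merge_le (S C : Finset W) (ω ω' : Sym2 W → Bool) :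
    codeg (merge (touching S) ω ω') C ≤ S.card +
      (((S ∪ C)ᶜ.filter (AdjAll ω (C ∩ S))).filter (AdjAll ω' (C \ S))).card := by
  refine (Finset.card_le_card (t := S ∪ ((S ∪ C)ᶜ.filter (AdjAll ω (C ∩ S))).filter
    (AdjAll ω' (C \ S))) fun v hv => ?_).trans (Finset.card_union_le _ _)
  rw [Finset.mem_filter, Finset.mem_compl] at hv
  simp only [Finset.mem_union, Finset.mem_filter, Finset.mem_compl]
  by_cases h : v ∈ S
  · exact Or.inl h
  · refine Or.inr ⟨⟨by simp [h, hv.1], ?_⟩, ?_⟩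
    · rw [← adjAll_merge_of_subset Finset.inter_subset_right ω ω']
      exact fun u hu => hv.2 u (Finset.mem_inter.1 hu).1
    · rw [← adjAll_merge_of_disjoint Finset.sdiff_disjoint ω ω' h]
      exact fun u hu => hv.2 u (Finset.mem_sdiff.1 hu).1

lemma card_filter_adjAll_le_outDeg (S C : Finset W) (ω : Sym2 W → Bool) :
    ((S ∪ C)ᶜ.filter (AdjAll ω (C ∩ S))).card ≤ outDeg S (C ∩ S) ω :=
  Finset.card_le_card (Finset.filter_subset_filter _
    (Finset.compl_subset_compl.2 Finset.subset_union_left))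

end Merge

variable {p : ℝ} {α : Type*} [Fintype α] [DecidableEq α] {r : ℕ} {m k : Fin r → ℕ}

/-- No set of size `k i`, except for the images under `T` of the sets `A ⟨i, j⟩`, has `th i` or more
common neighbours. -/
def NoRival (k : Fin r → ℕ) (A : (Σ i : Fin r, Fin (m i)) → Finset α) {W : Type*} [Fintype W]
    [DecidableEq W] (T : α ↪ W) (th : Fin r → ℕ) (ω : Sym2 W → Bool) : Prop :=
  ∀ i, ∀ C : Finset W, C.card = k i → (∀ j, C ≠ (A ⟨i, j⟩).map T) → codeg ω C < th i

/-- The images under `T` of all sets other than the `A b` have few common neighbours. -/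
def Typical (p ε : ℝ) (A : (Σ i : Fin r, Fin (m i)) → Finset α) {n : ℕ} (T : α ↪ Fin n)
    (ω : Sym2 (Fin n) → Bool) : Prop :=
  ∀ J : Finset α, J.Nonempty → (∀ b, J ≠ A b) →
    (outDeg (Finset.univ.map T) (J.map T) ω : ℝ) < level p (-ε) J.card n

lemma level_mono {n : ℕ} (p : ℝ) (j : ℕ) {ε ε' : ℝ} (h : ε ≤ ε') :
    level p ε j n ≤ level p ε' j n := by
  unfold level sd
  have : 0 ≤ √(2 * n * Real.log n) * √(j * (p ^ j * (1 - p ^ j))) := by positivity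
  nlinarith

omit [DecidableEq α] in
lemma exists_map_eq_inter {W : Type*} [DecidableEq W] (T : α ↪ W) (C : Finset W) :
    ∃ J : Finset α, J.map T = C ∩ Finset.univ.map T := by
  refine ⟨Finset.univ.filter fun u => T u ∈ C, ?_⟩
  ext w
  simp only [Finset.mem_map, Finset.mem_filter, Finset.mem_univ, true_and, Finset.mem_inter]
  constructor
  · rintro ⟨u, hu, rfl⟩; exact ⟨hu, u, rfl⟩
  · rintro ⟨hw, u, rfl⟩; exact ⟨u, hw, rfl⟩

/-- Sets disjoint from the explored part. -/
lemma pr_codeg_merge_ge_of_disjoint (hp : p ∈ Set.Icc (0 : ℝ) 1) {n : ℕ} {S C : Finset (Fin n)}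
    (hC : Disjoint C S) (ω : Sym2 (Fin n) → Bool) (t : ℕ) :
    pr p (fun ω' => t ≤ codeg (merge (touching S) ω ω') C) ≤
      binomTail (n - S.card - C.card) (p ^ C.card) (t - S.card) := by
  have h0 : C ∩ S = ∅ := Finset.disjoint_iff_inter_eq_empty.1 hC
  have hs : (S ∪ C)ᶜ.filter (AdjAll ω (C ∩ S)) = (S ∪ C)ᶜ := by
    rw [h0]; exact Finset.filter_true_of_mem fun v _ u hu => absurd hu (Finset.notMem_empty u)
  have hd : C \ S = C := Finset.sdiff_eq_self_of_disjoint hC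
  have hcard : (S ∪ C)ᶜ.card = n - S.card - C.card := by
    rw [Finset.card_compl, Finset.card_union_of_disjoint hC.symm, Fintype.card_fin]; omega
  have h := pr_card_filter_ge p (S ∪ C)ᶜ C
    (fun v hv hvC => Finset.mem_compl.1 hv (Finset.mem_union_right _ hvC)) (t - S.card)
  rw [hcard] at h
  rw [← h]
  refine pr_mono hp fun ω' hω' => ?_
  have := codeg_merge_le S C ω ω'
  rw [hs, hd] at this
  omega

/-- With its trace on `S` fixed, `C` is determined by the k - |J| vertices of `C \ S`. This is the
power of n against which `overlap_bound` is stated. -/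
lemma card_powersetCard_filter_inter_le {n : ℕ} (S J : Finset (Fin n)) (k : ℕ) :
    (((Finset.univ.powersetCard k).filter fun C : Finset (Fin n) => C ∩ S = J).card : ℝ) ≤
      (n : ℝ) ^ (k - J.card) := by
  have h1 : ((Finset.univ.powersetCard k).filter fun C : Finset (Fin n) => C ∩ S = J).card ≤
      ((Finset.univ : Finset (Fin n)).powersetCard (k - J.card)).card := by
    refine Finset.card_le_card_of_injOn (fun C => C \ S) ?_ ?_
    · intro C hC
      simp only [Finset.coe_filter, Finset.mem_powersetCard, Finset.subset_univ, true_and,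
        Set.mem_ofPred_eq, Finset.mem_coe] at hC ⊢
      have := Finset.card_sdiff_add_card_inter C S
      rw [hC.2, hC.1] at this
      omega
    · intro C hC C' hC' h
      simp only [Finset.coe_filter, Set.mem_ofPred_eq] at hC hC'
      have h' : C \ S = C' \ S := h
      rw [← Finset.sdiff_union_inter C S, ← Finset.sdiff_union_inter C' S, h', hC.2, hC'.2]
  have h2 : ((Finset.univ : Finset (Fin n)).powersetCard (k - J.card)).card ≤ n ^ (k - J.card) := by
    rw [Finset.card_powersetCard, Finset.card_univ, Fintype.card_fin]
    exact Nat.choose_le_pow _ _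
  exact_mod_cast h1.trans h2

/-- Conditionally on the explored edges, with probability tending to one no set overlapping with the
explored part becomes a rival. -/
lemma overlapping_bound (hp0 : 0 < p) (hp1 : p < 1) (hk : Function.Injective k)
    (A : (Σ i : Fin r, Fin (m i)) → Finset α) (hAk : ∀ i j, (A ⟨i, j⟩).card = k i) :
    ∀ᶠ ε in 𝓝[>] (0 : ℝ), ∃ err : ℕ → ℝ, Tendsto err atTop (𝓝 0) ∧
      ∀ᶠ n in atTop, ∀ (T : α ↪ Fin n) (th : Fin r → ℕ) (ω : Sym2 (Fin n) → Bool),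
        (∀ i, level p (-ε) (k i) n + Fintype.card α ≤ th i) →
        (∀ b, (outDeg (Finset.univ.map T) ((A b).map T) ω : ℝ) ≤ level p ε (A b).card n) →
        Typical p ε A T ω →
        ∑ i, ∑ C ∈ (Finset.univ.powersetCard (k i)).filter (fun C : Finset (Fin n) =>
          (∀ j, C ≠ (A ⟨i, j⟩).map T) ∧ ¬ Disjoint C (Finset.univ.map T)),
          pr p (fun ω' => th i ≤ codeg (merge (touching (Finset.univ.map T)) ω ω') C) ≤ err n := by
  have hpI : p ∈ Set.Icc (0 : ℝ) 1 := ⟨hp0.le, hp1.le⟩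
  -- There are finitely many pairs (size index, trace), so one small ε serves all of them.
  have hall : ∀ᶠ ε in 𝓝[>] (0 : ℝ), ∀ x : Fin r × Finset α, 0 < x.2.card → x.2.card < k x.1 →
      ∀ C : ℝ, ∃ e : ℕ → ℝ,
      Tendsto (fun n : ℕ => (n : ℝ) ^ (k x.1 - x.2.card) * e n) atTop (𝓝 0) ∧
      ∀ᶠ n in atTop, ∀ s F : Finset (Fin n), (∀ v ∈ s, v ∉ F) → F.card = k x.1 - x.2.card →
        (s.card : ℝ) ≤ level p ε x.2.card n →
        pr p (fun ω => level p (-ε) (k x.1) n - C ≤ ((s.filter (AdjAll ω F)).card : ℝ)) ≤ e n := by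
    rw [eventually_all]
    rintro ⟨i, J⟩
    by_cases h : 0 < J.card ∧ J.card < k i
    · have := overlap_bound hp0 hp1 h.1 (Nat.sub_pos_of_lt h.2)
      filter_upwards [this] with ε hε _ _
      rwa [Nat.add_sub_cancel' h.2.le] at hε
    · exact Eventually.of_forall fun ε h1 h2 => absurd ⟨h1, h2⟩ h
  filter_upwards [hall, self_mem_nhdsWithin] with ε hε hε0
  have hε0 : 0 < ε := hε0
  have hch : ∀ x : Fin r × Finset α, ∃ e : ℕ → ℝ,
      Tendsto (fun n : ℕ => (n : ℝ) ^ (k x.1 - x.2.card) * e n) atTop (𝓝 0) ∧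
      ∀ᶠ n in atTop, 0 < x.2.card → x.2.card < k x.1 →
        ∀ s F : Finset (Fin n), (∀ v ∈ s, v ∉ F) → F.card = k x.1 - x.2.card →
        (s.card : ℝ) ≤ level p ε x.2.card n →
        pr p (fun ω => level p (-ε) (k x.1) n - 0 ≤ ((s.filter (AdjAll ω F)).card : ℝ)) ≤ e n := by
    intro x
    by_cases h : 0 < x.2.card ∧ x.2.card < k x.1
    · obtain ⟨e, h1, h2⟩ := hε x h.1 h.2 0
      exact ⟨e, h1, h2.mono fun n hn _ _ => hn⟩
    · exact ⟨0, by simp, Eventually.of_forall fun n h1 h2 => absurd ⟨h1, h2⟩ h⟩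
  choose e he1 he2 using hch
  refine ⟨fun n => ∑ i, ∑ J : Finset α, |(n : ℝ) ^ (k i - J.card) * e (i, J) n|, ?_, ?_⟩
  · rw [← Finset.sum_const_zero (s := (Finset.univ : Finset (Fin r)))]
    refine tendsto_finsetSum _ fun i _ => ?_
    rw [← Finset.sum_const_zero (s := (Finset.univ : Finset (Finset α)))]
    refine tendsto_finsetSum _ fun J _ => ?_
    simpa using (he1 (i, J)).abs
  filter_upwards [eventually_all.2 he2] with n hn T th ω hth hhi htyp
  set S := Finset.univ.map T with hS
  have hScard : S.card = Fintype.card α := by rw [hS, Finset.card_map, Finset.card_univ]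
  refine Finset.sum_le_sum fun i _ => ?_
  set P := (Finset.univ.powersetCard (k i)).filter (fun C : Finset (Fin n) =>
          (∀ j, C ≠ (A ⟨i, j⟩).map T) ∧ ¬ Disjoint C S) with hP
  have hterm : ∀ J : Finset α, ∀ C ∈ P, C ∩ S = J.map T →
      pr p (fun ω' => th i ≤ codeg (merge (touching S) ω ω') C) ≤ |e (i, J) n| := by
    intro J C hC hCJ
    simp only [hP, Finset.mem_filter, Finset.mem_powersetCard, Finset.subset_univ, true_and] at hC
    obtain ⟨hCk, hCA, hCS⟩ := hC
    have hJ0 : 0 < J.card := by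
      rw [← Finset.card_map T, ← hCJ, Finset.card_pos, ← Finset.not_disjoint_iff_nonempty_inter]
      exact hCS
    have hout : (outDeg S (J.map T) ω : ℝ) ≤ level p ε J.card n := by
      by_cases hJA : ∃ b, J = A b
      · obtain ⟨b, rfl⟩ := hJA; exact hhi b
      · push Not at hJA
        exact (htyp J (Finset.card_pos.1 hJ0) hJA).le.trans (level_mono p _ (by linarith))
    have hJk : J.card ≤ k i := by
      rw [← Finset.card_map T, ← hCJ, ← hCk]; exact Finset.card_le_card Finset.inter_subset_left
    rcases hJk.eq_or_lt with heq | hlt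
    -- A set contained in `S` has all its outer codegree exposed, and `Typical` then excludes it
    -- with certainty. Injectivity of `k` guarantees that it is not the image of a class of another
    -- index.
    · have hCsub : C ∩ S = C := Finset.eq_of_subset_of_card_le Finset.inter_subset_left
        (by rw [hCJ, Finset.card_map, heq, hCk])
      have hCJ' : C = J.map T := by rw [← hCsub, hCJ]
      have hJA : ∀ b, J ≠ A b := by
        rintro ⟨i', j⟩ rfl
        have : i' = i := hk (by rw [← hAk i' j, heq])
        subst this
        exact hCA j hCJ'
      have h1 := htyp J (Finset.card_pos.1 hJ0) hJA
      have h2 := hth i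
      refine le_trans (le_of_eq ?_) (abs_nonneg _)
      rw [← ex_const (E := Sym2 (Fin n)) p 0]
      unfold pr
      congr 1; ext ω'
      apply ind_of_false
      rw [not_le]
      have hCS' : C ⊆ S := Finset.inter_eq_left.1 hCsub
      have h3 := codeg_le_add_outDeg S C (merge (touching S) ω ω')
      rw [outDeg_merge hCS', hScard] at h3
      rw [← hCJ', heq] at h1
      have h4 : (codeg (merge (touching S) ω ω') C : ℝ) ≤ Fintype.card α + outDeg S C ω := by
        exact_mod_cast h3
      have : (codeg (merge (touching S) ω ω') C : ℝ) < th i := by linarith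
      exact_mod_cast this
    -- A set that is only partly exposed: the common neighbourhood of its exposed part has at most
    -- the extreme size, and `overlap_bound` applies to the fresh vertices.
    · have h1 := hn (i, J) hJ0 hlt ((S ∪ C)ᶜ.filter (AdjAll ω (C ∩ S))) (C \ S)
        (fun v hv hvC => by
          rw [Finset.mem_filter, Finset.mem_compl] at hv
          exact hv.1 (Finset.mem_union_right _ (Finset.mem_sdiff.1 hvC).1))
        (by
          have := Finset.card_sdiff_add_card_inter C S
          rw [hCJ, Finset.card_map, hCk] at this
          simp only; omega)
        (by
          have := card_filter_adjAll_le_outDeg S C ω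
          have h' : (((S ∪ C)ᶜ.filter (AdjAll ω (C ∩ S))).card : ℝ) ≤ outDeg S (C ∩ S) ω := by
            exact_mod_cast this
          rw [hCJ] at h' ⊢
          exact h'.trans hout)
      refine (pr_mono hpI fun ω' hω' => ?_).trans (h1.trans (le_abs_self _))
      have h3 : (th i : ℝ) ≤ codeg (merge (touching S) ω ω') C := by exact_mod_cast hω'
      have h4 : (codeg (merge (touching S) ω ω') C : ℝ) ≤ Fintype.card α +
          (((S ∪ C)ᶜ.filter (AdjAll ω (C ∩ S))).filter (AdjAll ω' (C \ S))).card := by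
        rw [← hScard]; exact_mod_cast codeg_merge_le S C ω ω'
      have h5 := hth i
      linarith
  -- The sum is sorted by the trace on `S`, pulled back along `T` to a subset of α.
  calc _ ≤ ∑ C ∈ P, ∑ J : Finset α, if C ∩ S = J.map T then |e (i, J) n| else 0 := by
        refine Finset.sum_le_sum fun C hC => ?_
        obtain ⟨J, hJ⟩ := exists_map_eq_inter T C
        refine (hterm J C hC hJ.symm).trans ?_
        refine le_trans (le_of_eq (if_pos hJ.symm).symm)
          (Finset.single_le_sum (f := fun J : Finset α => if C ∩ S = J.map T then |e (i, J) n| else 0)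
            (fun J _ => ?_) (Finset.mem_univ J))
        split_ifs
        · exact abs_nonneg _
        · exact le_rfl
    _ = ∑ J : Finset α, ((P.filter fun C => C ∩ S = J.map T).card : ℝ) * |e (i, J) n| := by
        rw [Finset.sum_comm]
        refine Finset.sum_congr rfl fun J _ => ?_
        rw [← Finset.sum_filter, Finset.sum_const, nsmul_eq_mul]
    _ ≤ _ := by
        refine Finset.sum_le_sum fun J _ => ?_
        rw [abs_mul, abs_of_nonneg (by positivity : (0 : ℝ) ≤ (n : ℝ) ^ (k i - J.card))]
        refine mul_le_mul_of_nonneg_right ?_ (abs_nonneg _)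
        have h1 := card_powersetCard_filter_inter_le S (J.map T) (k i)
        rw [Finset.card_map] at h1
        refine le_trans ?_ h1
        have : (P.filter fun C => C ∩ S = J.map T) ⊆
            (Finset.univ.powersetCard (k i)).filter fun C : Finset (Fin n) => C ∩ S = J.map T :=
          Finset.filter_subset_filter _ (Finset.filter_subset _ _)
        exact_mod_cast Finset.card_le_card this

end Exploration

/-! ### The conditional probability of having no rivals. -/

section Exploration

open Topology

variable {p : ℝ} {α : Type*} [Fintype α] [DecidableEq α] {r : ℕ} {m k : Fin r → ℕ}

omit [Fintype α] [DecidableEq α] in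
/-- If an event `N` has conditional probability at least `c` given the coordinates in `Q`, on an
event `P` determined by them. -/
lemma mul_pr_and_le_of_merge {E : Type*} [Fintype E] [DecidableEq E] (hp : p ∈ Set.Icc (0 : ℝ) 1)
    (Q : Set E) {P N Y : (E → Bool) → Prop} {c : ℝ} (hP : ∀ ω ω', P (merge Q ω ω') ↔ P ω)
    (h : ∀ ω, P ω → Y ω → c ≤ pr p (fun ω' => N (merge Q ω ω'))) :
    c * pr p (fun ω => P ω ∧ Y ω) ≤ pr p (fun ω => P ω ∧ N ω) := by
  unfold pr
  rw [ex_merge p Q (fun ω => ind (P ω ∧ N ω)), ← ex_const_mul]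
  refine ex_mono hp fun ω => ?_
  by_cases hω : P ω ∧ Y ω
  · rw [ind_of_true hω, mul_one]
    simp only [ind_and, hP, ind_of_true hω.1, one_mul]
    exact h ω hω.1 hω.2
  · rw [ind_of_false hω, mul_zero]
    exact ex_nonneg hp fun _ => ind_nonneg _

omit [DecidableEq α] in
/-- The conditional probability that there are no rivals, by the Harris inequality. -/
lemma pr_noRival_merge_ge (hpI : p ∈ Set.Icc (0 : ℝ) 1)
    (A : (Σ i : Fin r, Fin (m i)) → Finset α) {n : ℕ} (T : α ↪ Fin n) (th : Fin r → ℕ)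
    (ω : Sym2 (Fin n) → Bool) {S : Finset (Fin n)} (hScard : S.card = Fintype.card α) {err : ℝ}
    (hsum : ∑ i, ∑ C ∈ (Finset.univ.powersetCard (k i)).filter (fun C : Finset (Fin n) =>
          (∀ j, C ≠ (A ⟨i, j⟩).map T) ∧ ¬ Disjoint C S),
          pr p (fun ω' => th i ≤ codeg (merge (touching S) ω ω') C) ≤ err) :
    (1 - err) * (∏ i, (1 - binomTail (n - Fintype.card α - k i) (p ^ k i)
      (th i - Fintype.card α)) ^ n.choose (k i)) ≤
        pr p (fun ω' => NoRival k A T th (merge (touching S) ω ω')) := by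
  have hqI : ∀ i, p ^ k i ∈ Set.Icc (0 : ℝ) 1 := fun i =>
    ⟨pow_nonneg hpI.1 _, pow_le_one₀ hpI.1 hpI.2⟩
  set Φ := ∏ i, (1 - binomTail (n - Fintype.card α - k i) (p ^ k i) (th i - Fintype.card α)) ^
            n.choose (k i) with hΦ
  have hfac0 : ∀ i, 0 ≤ 1 - binomTail (n - Fintype.card α - k i) (p ^ k i)
      (th i - Fintype.card α) := fun i => sub_nonneg.2 (binomTail_le_one (hqI i) _)
  have hfac1 : ∀ i, 1 - binomTail (n - Fintype.card α - k i) (p ^ k i)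
      (th i - Fintype.card α) ≤ 1 := fun i => sub_le_self _ (binomTail_nonneg (hqI i) _)
  have hΦ0 : 0 ≤ Φ := Finset.prod_nonneg fun i _ => pow_nonneg (hfac0 i) _
  -- Candidates disjoint from `S` go into `D`; their codegrees are bounded through fresh pairs only,
  -- and they produce the main factor. Candidates meeting `S` go into `O` and are handled by the
  -- union bound `hsum`.
  set D : Fin r → Finset (Finset (Fin n)) := fun i => (Finset.univ.powersetCard (k i)).filter
    (fun C => (∀ j, C ≠ (A ⟨i, j⟩).map T) ∧ Disjoint C S) with hD
  set O : Fin r → Finset (Finset (Fin n)) := fun i => (Finset.univ.powersetCard (k i)).filter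
    (fun C => (∀ j, C ≠ (A ⟨i, j⟩).map T) ∧ ¬ Disjoint C S) with hO
  set E : (Σ _ : Fin r, Finset (Fin n)) → (Sym2 (Fin n) → Bool) → Prop := fun x ω' =>
    codeg (merge (touching S) ω ω') x.2 < th x.1 with hE
  have hEanti : ∀ x, ∀ ω₁ ω₂ : Sym2 (Fin n) → Bool, ω₁ ≤ ω₂ → E x ω₂ → E x ω₁ :=
    fun x ω₁ ω₂ h12 h => lt_of_le_of_lt (codeg_mono (merge_mono_right _ ω h12) x.2) h
  have h1 : Φ ≤ pr p (fun ω' => ∀ x ∈ Finset.univ.sigma D, E x ω') := by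
    refine le_trans ?_ (prod_pr_le_of_antitone hpI _ E fun x _ => hEanti x)
    rw [Finset.prod_sigma, hΦ]
    refine Finset.prod_le_prod (fun i _ => pow_nonneg (hfac0 i) _) fun i _ => ?_
    have hle : ∀ C ∈ D i, 1 - binomTail (n - Fintype.card α - k i) (p ^ k i)
        (th i - Fintype.card α) ≤ pr p (E ⟨i, C⟩) := by
      intro C hC
      simp only [hD, Finset.mem_filter, Finset.mem_powersetCard, Finset.subset_univ,
        true_and] at hC
      have h2 := pr_codeg_merge_ge_of_disjoint hpI hC.2.2 ω (th i)
      rw [hC.1, hScard] at h2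
      have h3 : pr p (E ⟨i, C⟩) =
          1 - pr p (fun ω' => th i ≤ codeg (merge (touching S) ω ω') C) := by
        rw [← pr_not]; exact pr_congr fun ω' => by simp [hE]
      rw [h3]; linarith
    calc _ ≤ (1 - binomTail (n - Fintype.card α - k i) (p ^ k i)
            (th i - Fintype.card α)) ^ (D i).card := by
          refine pow_le_pow_of_le_one (hfac0 i) (hfac1 i) ?_
          refine (Finset.card_filter_le _ _).trans ?_
          rw [Finset.card_powersetCard, Finset.card_univ, Fintype.card_fin]
      _ = ∏ C ∈ D i, (1 - binomTail (n - Fintype.card α - k i) (p ^ k i)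
            (th i - Fintype.card α)) := by rw [Finset.prod_const]
      _ ≤ _ := Finset.prod_le_prod (fun C _ => hfac0 i) hle
  have h2 : 1 - err ≤ pr p (fun ω' => ∀ x ∈ Finset.univ.sigma O, E x ω') := by
    have h3 : pr p (fun ω' => ∃ x ∈ Finset.univ.sigma O, ¬ E x ω') ≤ err := by
      refine (pr_exists_mem_le hpI _ _).trans ?_
      rw [Finset.sum_sigma]
      simpa only [hE, not_lt] using hsum
    have h4 : pr p (fun ω' => ∀ x ∈ Finset.univ.sigma O, E x ω') =
        1 - pr p (fun ω' => ∃ x ∈ Finset.univ.sigma O, ¬ E x ω') := by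
      rw [← pr_not]; exact pr_congr fun ω' => by push Not; rfl
    rw [h4]; linarith
  -- Both events are decreasing in the fresh edges, so they are positively correlated, although they
  -- share edges.
  calc (1 - err) * Φ ≤ pr p (fun ω' => ∀ x ∈ Finset.univ.sigma O, E x ω') * Φ :=
        mul_le_mul_of_nonneg_right h2 hΦ0
    _ ≤ pr p (fun ω' => ∀ x ∈ Finset.univ.sigma O, E x ω') *
        pr p (fun ω' => ∀ x ∈ Finset.univ.sigma D, E x ω') :=
        mul_le_mul_of_nonneg_left h1 (pr_nonneg hpI _)
    _ ≤ _ := ex_mul_ge_of_antitone hpI (fun _ => ind_nonneg _) (fun _ => ind_nonneg _)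
          (fun ω₁ ω₂ h => ind_mono fun h' x hx => hEanti x ω₁ ω₂ h (h' x hx))
          (fun ω₁ ω₂ h => ind_mono fun h' x hx => hEanti x ω₁ ω₂ h (h' x hx))
    _ ≤ _ := by
        unfold pr
        refine ex_mono hpI fun ω' => ?_
        rw [← ind_and]
        refine ind_mono fun h i C hCk hCA => ?_
        by_cases hCS : Disjoint C S
        · exact h.2 ⟨i, C⟩ (by simp [hD, hCk, hCA, hCS])
        · exact h.1 ⟨i, C⟩ (by simp [hO, hCk, hCA, hCS])

/-- A lower bound for the probability that the images under `T` of the sets `A b` are the sets with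
most common neighbours. -/
lemma noRival_lower_bound (hp0 : 0 < p) (hp1 : p < 1) (hk : Function.Injective k)
    (A : (Σ i : Fin r, Fin (m i)) → Finset α) (hAk : ∀ i j, (A ⟨i, j⟩).card = k i) :
    ∀ᶠ ε in 𝓝[>] (0 : ℝ), ∃ c : ℕ → ℝ, Tendsto c atTop (𝓝 1) ∧
      ∀ᶠ n in atTop, ∀ (T : α ↪ Fin n) (l : (Σ i : Fin r, Fin (m i)) → ℕ) (th : Fin r → ℕ),
        (∀ i, level p (-ε) (k i) n + Fintype.card α ≤ th i) →
        (∀ b, (l b : ℝ) ≤ level p ε (A b).card n) →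
        c n * (∏ i, (1 - binomTail (n - Fintype.card α - k i) (p ^ k i) (th i - Fintype.card α)) ^
            n.choose (k i)) *
          pr p (fun ω => (∀ b, outDeg (Finset.univ.map T) ((A b).map T) ω = l b) ∧
            Typical p ε A T ω) ≤
        pr p (fun ω => (∀ b, outDeg (Finset.univ.map T) ((A b).map T) ω = l b) ∧
          NoRival k A T th ω) := by
  have hpI : p ∈ Set.Icc (0 : ℝ) 1 := ⟨hp0.le, hp1.le⟩
  filter_upwards [overlapping_bound hp0 hp1 hk A hAk] with ε hε
  obtain ⟨err, herr, hε⟩ := hε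
  refine ⟨fun n => 1 - err n, by simpa using herr.const_sub 1, ?_⟩
  filter_upwards [hε] with n hn T l th hth hl
  set S := Finset.univ.map T with hS
  have hScard : S.card = Fintype.card α := by rw [hS, Finset.card_map, Finset.card_univ]
  have hAS : ∀ b, (A b).map T ⊆ S := fun b => Finset.map_subset_map.2 (Finset.subset_univ _)
  set Φ := ∏ i, (1 - binomTail (n - Fintype.card α - k i) (p ^ k i) (th i - Fintype.card α)) ^
            n.choose (k i)
  have hcond : ∀ ω : Sym2 (Fin n) → Bool, (∀ b, outDeg S ((A b).map T) ω = l b) →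
      Typical p ε A T ω → (1 - err n) * Φ ≤
        pr p (fun ω' => NoRival k A T th (merge (touching S) ω ω')) := fun ω hω htyp =>
    pr_noRival_merge_ge hpI A T th ω hScard
      (hn T th ω hth (fun b => by rw [hω b]; exact hl b) htyp)
  exact mul_pr_and_le_of_merge hpI (touching S)
    (fun ω ω' => forall_congr' fun b => by rw [outDeg_merge (hAS b)]) hcond

end Exploration

/-! ### The sets of largest codegree are determined by their ranks. -/

section TopSets

open Topology

variable {p : ℝ} {α : Type*} [Fintype α] [DecidableEq α] {r : ℕ} {m k : Fin r → ℕ}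

/-- If the images of the sets `A b` have many common neighbours, then typically no other set has. -/
lemma atypical_bound (hp0 : 0 < p) (hp1 : p < 1) (A : (Σ i : Fin r, Fin (m i)) → Finset α)
    (hA0 : ∀ b, (A b).Nonempty) (hA : Pairwise fun b b' => Disjoint (A b) (A b')) :
    ∀ᶠ ε in 𝓝[>] (0 : ℝ), ∃ e : ℕ → ℝ,
      Tendsto (fun n : ℕ => (n : ℝ) ^ (∑ b, (A b).card) * e n) atTop (𝓝 0) ∧
      ∀ᶠ n in atTop, ∀ T : α ↪ Fin n, pr p (fun ω =>
        (∀ b, level p (-ε) (A b).card n ≤ outDeg (Finset.univ.map T) ((A b).map T) ω) ∧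
        ¬ Typical p ε A T ω) ≤ e n := by
  classical
  have hpI : p ∈ Set.Icc (0 : ℝ) 1 := ⟨hp0.le, hp1.le⟩
  have h : ∀ᶠ ε in 𝓝[>] (0 : ℝ), ∀ J : {J : Finset α // J.Nonempty ∧ ∀ b, J ≠ A b},
      ∃ e : ℕ → ℝ, Tendsto (fun n : ℕ => (n : ℝ) ^ (∑ b, (A b).card) * e n) atTop (𝓝 0) ∧
      ∀ᶠ n in atTop, ∀ T : α ↪ Fin n, pr p (fun ω =>
        (∀ b, level p (-ε) (A b).card n ≤ outDeg (Finset.univ.map T) ((A b).map T) ω) ∧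
        level p (-ε) J.1.card n ≤ outDeg (Finset.univ.map T) (J.1.map T) ω) ≤ e n :=
    eventually_all.2 fun J => atypical_set_bound hp0 hp1 A hA0 hA J.2.1 J.2.2
  filter_upwards [h] with ε hε
  choose e he1 he2 using hε
  refine ⟨fun n => ∑ J, e J n, ?_, ?_⟩
  · simp only [Finset.mul_sum]
    simpa using tendsto_finsetSum Finset.univ fun J _ => he1 J
  · filter_upwards [eventually_all.2 he2] with n hn T
    calc _ ≤ pr p (fun ω => ∃ J ∈ (Finset.univ : Finset {J : Finset α // J.Nonempty ∧ ∀ b, J ≠ A b}),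
          (∀ b, level p (-ε) (A b).card n ≤ outDeg (Finset.univ.map T) ((A b).map T) ω) ∧
          level p (-ε) J.1.card n ≤ outDeg (Finset.univ.map T) (J.1.map T) ω) := by
          refine pr_mono hpI fun ω hω => ?_
          have h2 := hω.2
          simp only [Typical, not_forall, not_lt] at h2
          obtain ⟨J, hJ, hJA, h3⟩ := h2
          exact ⟨⟨J, hJ, hJA⟩, Finset.mem_univ _, hω.1, h3⟩
      _ ≤ _ := (pr_exists_mem_le hpI _ _).trans (Finset.sum_le_sum fun J _ => hn J T)

/-- The last index of a nonempty range. -/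
def lastIdx (m : ℕ) [NeZero m] : Fin m := ⟨m - 1, Nat.sub_lt (NeZero.pos m) Nat.one_pos⟩

lemma le_lastIdx {m : ℕ} [NeZero m] (j : Fin m) : j ≤ lastIdx m := Nat.le_sub_one_of_lt j.2

variable [∀ i, NeZero (m i)]

/-- The images under `T` of the sets `A b` have `l b` outer common neighbours, and no other sets of
the same sizes have as many common neighbours as the last of them. -/
def TopSets (k : Fin r → ℕ) (A : (Σ i : Fin r, Fin (m i)) → Finset α) {W : Type*} [Fintype W]
    [DecidableEq W] (T : α ↪ W) (l : (Σ i : Fin r, Fin (m i)) → ℕ) (ω : Sym2 W → Bool) : Prop :=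
  (∀ b, outDeg (Finset.univ.map T) ((A b).map T) ω = l b) ∧
    NoRival k A T (fun i => l ⟨i, lastIdx (m i)⟩) ω

/-- The numbers `l ⟨i, j⟩` decrease in `j` with gaps greater than `c`. -/
def Separated (c : ℕ) (l : (Σ i : Fin r, Fin (m i)) → ℕ) : Prop :=
  ∀ i, ∀ j j' : Fin (m i), j < j' → l ⟨i, j'⟩ + c < l ⟨i, j⟩

variable {W : Type*} [Fintype W] [DecidableEq W] {A : (Σ i : Fin r, Fin (m i)) → Finset α}
  {T : α ↪ W} {l : (Σ i : Fin r, Fin (m i)) → ℕ} {ω : Sym2 W → Bool}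

omit [DecidableEq α] in
lemma TopSets.le_codeg (h : TopSets k A T l ω) (b : Σ i : Fin r, Fin (m i)) :
    l b ≤ codeg ω ((A b).map T) := by
  rw [← h.1 b]
  exact outDeg_le_codeg (Finset.map_subset_map.2 (Finset.subset_univ _)) ω

omit [DecidableEq α] in
lemma TopSets.codeg_le (h : TopSets k A T l ω) (b : Σ i : Fin r, Fin (m i)) :
    codeg ω ((A b).map T) ≤ l b + Fintype.card α := by
  have := codeg_le_add_outDeg (Finset.univ.map T) ((A b).map T) ω
  rw [h.1 b, Finset.card_map, Finset.card_univ] at this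
  omega

lemma Separated.last_le {c : ℕ} (hl : Separated c l) (i : Fin r) (j : Fin (m i)) :
    l ⟨i, lastIdx (m i)⟩ ≤ l ⟨i, j⟩ := by
  rcases (le_lastIdx j).eq_or_lt with h | h
  · rw [← h]
  · have := hl i j _ h; omega

-- Each codegree lies between `l b` and `l b + Fintype.card α`, because inner vertices add at most
-- the size of the image of `T`. Separation by more than this amount carries the order of `l` over
-- to the codegrees.
omit [DecidableEq α] in
lemma TopSets.codeg_lt_iff (h : TopSets k A T l ω) (hl : Separated (Fintype.card α) l)
    (i : Fin r) (j j' : Fin (m i)) :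
    codeg ω ((A ⟨i, j⟩).map T) < codeg ω ((A ⟨i, j'⟩).map T) ↔ j' < j := by
  have h1 : ∀ j j' : Fin (m i), j' < j →
      codeg ω ((A ⟨i, j⟩).map T) < codeg ω ((A ⟨i, j'⟩).map T) := fun j j' hj => by
    have := h.codeg_le ⟨i, j⟩
    have := h.le_codeg ⟨i, j'⟩
    have := hl i j' j hj
    omega
  refine ⟨fun hc => ?_, h1 j j'⟩
  by_contra hj
  rcases (not_lt.1 hj).eq_or_lt with hj | hj
  · rw [hj] at hc; exact lt_irrefl _ hc
  · exact lt_asymm hc (h1 j' j hj)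

omit [DecidableEq α] in
/-- The sets with most common neighbours are determined by their ranks. -/
lemma TopSets.card_filter_lt_iff (h : TopSets k A T l ω) (hl : Separated (Fintype.card α) l)
    (hAk : ∀ i j, (A ⟨i, j⟩).card = k i) (i : Fin r) (j : Fin (m i)) {C : Finset W}
    (hC : C.card = k i) :
    ((Finset.univ : Finset (Finset W)).filter fun C' => C'.card = k i ∧
      codeg ω C < codeg ω C').card = j ↔ C = (A ⟨i, j⟩).map T := by
  have hinj : Function.Injective fun j : Fin (m i) => (A ⟨i, j⟩).map T := fun j j' hjj => by
    have hjj : (A ⟨i, j⟩).map T = (A ⟨i, j'⟩).map T := hjj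
    have h1 := h.codeg_lt_iff hl i j j'
    have h2 := h.codeg_lt_iff hl i j' j
    rw [hjj] at h1 h2
    simp only [lt_irrefl, false_iff, not_lt] at h1 h2
    exact le_antisymm h1 h2
  have hcard : ∀ j : Fin (m i), ((Finset.univ : Finset (Finset W)).filter fun C' =>
      C'.card = k i ∧ codeg ω ((A ⟨i, j⟩).map T) < codeg ω C').card = j := fun j => by
    have : (Finset.univ : Finset (Finset W)).filter (fun C' => C'.card = k i ∧
        codeg ω ((A ⟨i, j⟩).map T) < codeg ω C') = (Finset.Iio j).map ⟨_, hinj⟩ := by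
      ext C'
      simp only [Finset.mem_filter, Finset.mem_univ, true_and, Finset.mem_map, Finset.mem_Iio,
        Function.Embedding.coeFn_mk]
      constructor
      · rintro ⟨hk', hlt⟩
        by_contra hne
        push Not at hne
        by_cases hC' : ∀ j', C' ≠ (A ⟨i, j'⟩).map T
        · have h1 := h.2 i C' hk' hC'
          have h2 := h.le_codeg ⟨i, j⟩
          have h3 := hl.last_le i j
          dsimp only at h1
          omega
        · push Not at hC'
          obtain ⟨j', rfl⟩ := hC'
          exact hne j' ((h.codeg_lt_iff hl i j j').1 hlt) rfl
      · rintro ⟨j', hj', rfl⟩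
        exact ⟨by rw [Finset.card_map, hAk], (h.codeg_lt_iff hl i j j').2 hj'⟩
    rw [this, Finset.card_map, Fin.card_Iio]
  constructor
  · intro hj
    by_cases hC' : ∀ j', C ≠ (A ⟨i, j'⟩).map T
    -- A set other than the images lies strictly behind all `m i` of them, so its rank is at least
    -- `m i`, beyond every index `j`.
    · exfalso
      have h1 := h.2 i C hC hC'
      have : (Finset.univ : Finset (Fin (m i))).map ⟨_, hinj⟩ ⊆
          (Finset.univ : Finset (Finset W)).filter (fun C' => C'.card = k i ∧
            codeg ω C < codeg ω C') := by
        intro C' hC''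
        simp only [Finset.mem_map, Finset.mem_univ, true_and, Function.Embedding.coeFn_mk] at hC''
        obtain ⟨j', rfl⟩ := hC''
        have h2 := h.le_codeg ⟨i, j'⟩
        have h3 := hl.last_le i j'
        simp only [Finset.mem_filter, Finset.mem_univ, true_and, Finset.card_map, hAk]
        dsimp only at h1
        omega
      have h4 := Finset.card_le_card this
      rw [Finset.card_map, Finset.card_univ, Fintype.card_fin, hj] at h4
      exact absurd j.2 (not_lt.2 h4)
    · push Not at hC'
      obtain ⟨j', rfl⟩ := hC'
      rw [hcard] at hj
      rw [Fin.ext hj]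
  · rintro rfl
    exact hcard j

/-- Only boundedly many tuples are mapped to the sets with most common neighbours. -/
lemma card_topSets_le (hAk : ∀ i j, (A ⟨i, j⟩).card = k i)
    {f : α → Σ i : Fin r, Fin (m i)} (hf : ∀ u b, u ∈ A b ↔ f u = b) (ω : Sym2 W → Bool)
    [DecidablePred fun T : α ↪ W => ∃ l, Separated (Fintype.card α) l ∧ TopSets k A T l ω] :
    ((Finset.univ : Finset (α ↪ W)).filter fun T =>
      ∃ l, Separated (Fintype.card α) l ∧ TopSets k A T l ω).card ≤ ∏ b, (A b).card.factorial := by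
  classical
  set F := (Finset.univ : Finset (α ↪ W)).filter fun T =>
      ∃ l, Separated (Fintype.card α) l ∧ TopSets k A T l ω with hF
  rcases F.eq_empty_or_nonempty with h | ⟨T₀, hT₀⟩
  · rw [h]; simp
  -- Ranks by codegree depend on ω alone, so any two admissible `T` map each class onto the same
  -- set.
  have key : ∀ T ∈ F, ∀ b, (A b).map T = (A b).map T₀ := by
    rintro T hT ⟨i, j⟩
    obtain ⟨l, hl, h⟩ := (Finset.mem_filter.1 hT).2
    obtain ⟨l₀, hl₀, h₀⟩ := (Finset.mem_filter.1 hT₀).2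
    have hc : ((A ⟨i, j⟩).map T).card = k i := by rw [Finset.card_map, hAk]
    rw [← h₀.card_filter_lt_iff hl₀ hAk i j hc, h.card_filter_lt_iff hl hAk i j hc]
  -- An admissible `T` therefore differs from `T₀` by a permutation of α that preserves every class,
  -- and these number the product of the factorials.
  have hex : ∀ T ∈ F, ∃ g : {g : Equiv.Perm α // f ∘ g = f}, ∀ u, T u = T₀ (g.1 u) := by
    intro T hT
    have h1 : ∀ u, ∃ v, f v = f u ∧ T₀ v = T u := fun u => by
      have : T u ∈ (A (f u)).map T₀ := by
        rw [← key T hT]; exact Finset.mem_map_of_mem _ ((hf _ _).2 rfl)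
      obtain ⟨v, hv, hvT⟩ := Finset.mem_map.1 this
      exact ⟨v, (hf _ _).1 hv, hvT⟩
    choose g hg1 hg2 using h1
    have hgi : Function.Injective g := fun u v huv => T.injective (by rw [← hg2, ← hg2, huv])
    exact ⟨⟨Equiv.ofBijective g (Finite.injective_iff_bijective.1 hgi), funext hg1⟩,
      fun u => (hg2 u).symm⟩
  have : Nonempty {g : Equiv.Perm α // f ∘ g = f} := ⟨⟨Equiv.refl _, rfl⟩⟩
  choose! G hG using hex
  have hcard : ∀ b, Fintype.card {a // f a = b} = (A b).card := fun b => by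
    rw [Fintype.card_subtype]
    congr 1; ext u; simp [hf]
  calc F.card ≤ (Finset.univ : Finset {g : Equiv.Perm α // f ∘ g = f}).card := by
        refine Finset.card_le_card_of_injOn G (fun _ _ => Finset.mem_coe.2 (Finset.mem_univ _)) ?_
        intro T hT T' hT' hTT'
        ext u
        rw [hG T hT u, hTT', ← hG T' hT' u]
    _ = _ := by
        rw [Finset.card_univ, DomMulAct.stabilizer_card]
        exact Finset.prod_congr rfl fun b _ => by rw [hcard]

omit [DecidableEq α] in
lemma TopSets.eq (h : TopSets k A T l ω) {l' : (Σ i : Fin r, Fin (m i)) → ℕ}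
    (h' : TopSets k A T l' ω) : l = l' := funext fun b => (h.1 b).symm.trans (h'.1 b)

/-- Double counting: a configuration belongs to the event for at most the stated number of `T`, and
each `T` determines its `l`. This gives a lower bound for the probability of a union from first
moments alone. -/
lemma sum_pr_topSets_le (hpI : p ∈ Set.Icc (0 : ℝ) 1) (hAk : ∀ i j, (A ⟨i, j⟩).card = k i)
    {f : α → Σ i : Fin r, Fin (m i)} (hf : ∀ u b, u ∈ A b ↔ f u = b)
    (G : Finset ((Σ i : Fin r, Fin (m i)) → ℕ)) (hG : ∀ l ∈ G, Separated (Fintype.card α) l) :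
    ∑ T : α ↪ W, ∑ l ∈ G, pr p (TopSets k A T l) ≤
      (∏ b, (A b).card.factorial : ℕ) * pr p (fun ω => ∃ T : α ↪ W, ∃ l ∈ G, TopSets k A T l ω) := by
  classical
  unfold pr
  simp only [← ex_sum]
  rw [← ex_const_mul]
  refine ex_mono hpI fun ω => ?_
  by_cases hω : ∃ T : α ↪ W, ∃ l ∈ G, TopSets k A T l ω
  · rw [ind_of_true hω, mul_one]
    refine le_trans ?_ (Nat.cast_le.2 (card_topSets_le hAk hf ω))
    rw [card_filter_eq_sum_ind]
    refine Finset.sum_le_sum fun T _ => ?_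
    by_cases hT : ∃ l ∈ G, TopSets k A T l ω
    · obtain ⟨l, hlG, hl⟩ := hT
      rw [Finset.sum_eq_single_of_mem l hlG fun l' _ hne => ind_of_false fun h => hne (h.eq hl)]
      exact ind_mono fun h => ⟨l, hG l hlG, h⟩
    · rw [Finset.sum_eq_zero fun l hl => ind_of_false fun h => hT ⟨l, hl, h⟩]
      exact ind_nonneg _
  · rw [ind_of_false hω, mul_zero]
    refine (Finset.sum_eq_zero fun T _ => Finset.sum_eq_zero fun l hl => ind_of_false fun h => ?_).le
    exact hω ⟨T, l, hl, h⟩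

end TopSets

/-! ### The lower bound for the joint law of the top codegrees at finite n. -/

section TopSets

open Topology

variable {p : ℝ} {α : Type*} [Fintype α] {r : ℕ} {m k : Fin r → ℕ}
  {A : (Σ i : Fin r, Fin (m i)) → Finset α}

lemma sum_card_eq_card {f : α → Σ i : Fin r, Fin (m i)} (hf : ∀ u b, u ∈ A b ↔ f u = b) :
    ∑ b, (A b).card = Fintype.card α := by
  classical
  rw [← Finset.card_univ, Finset.card_eq_sum_card_fiberwise (f := f) (t := Finset.univ)
    fun _ _ => Finset.mem_coe.2 (Finset.mem_univ _)]
  refine Finset.sum_congr rfl fun b _ => ?_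
  congr 1; ext u; simp [hf]

/-- The limit mass function of the numbers of outer common neighbours, with the probability that
there are no rivals. -/
noncomputable def topMass (p : ℝ) (k : Fin r → ℕ) [∀ i, NeZero (m i)] (s n : ℕ)
    (l : (Σ i : Fin r, Fin (m i)) → ℕ) : ℝ :=
  (∏ i, (1 - binomTail (n - s - k i) (p ^ k i) (l ⟨i, lastIdx (m i)⟩ - s)) ^ n.choose (k i)) *
    ∏ b : Σ i : Fin r, Fin (m i), binom (n - s) (p ^ k b.1) (l b)

variable [DecidableEq α] [∀ i, NeZero (m i)]

/-- A lower bound for the probability that the largest numbers of common neighbours lie in a given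
set. -/
lemma topSets_lower_bound (hp0 : 0 < p) (hp1 : p < 1) (hk : Function.Injective k)
    (hk0 : ∀ i, 0 < k i) (hAk : ∀ i j, (A ⟨i, j⟩).card = k i)
    {f : α → Σ i : Fin r, Fin (m i)} (hf : ∀ u b, u ∈ A b ↔ f u = b) :
    ∀ᶠ ε in 𝓝[>] (0 : ℝ), ∃ c : ℕ → ℝ, Tendsto c atTop (𝓝 1) ∧ ∃ e : ℕ → ℝ,
      Tendsto e atTop (𝓝 0) ∧
      ∀ᶠ n in atTop, ∀ G : Finset ((Σ i : Fin r, Fin (m i)) → ℕ),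
        (∀ l ∈ G, Separated (Fintype.card α) l ∧
          (∀ i, level p (-ε) (k i) n + Fintype.card α ≤ l ⟨i, lastIdx (m i)⟩) ∧
          ∀ b, (l b : ℝ) ≤ level p ε (k b.1) n) →
        c n * (n.descFactorial (Fintype.card α) / (∏ b, (A b).card.factorial : ℕ) *
          ∑ l ∈ G, topMass p k (Fintype.card α) n l) - e n ≤
        pr p (fun ω => ∃ T : α ↪ Fin n, ∃ l ∈ G, TopSets k A T l ω) := by
  classical
  have hpI : p ∈ Set.Icc (0 : ℝ) 1 := ⟨hp0.le, hp1.le⟩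
  have hcard : ∀ b, (A b).card = k b.1 := fun b => hAk b.1 b.2
  have hA0 : ∀ b, (A b).Nonempty := fun b => Finset.card_pos.1 (by rw [hcard]; exact hk0 _)
  have hdis : Pairwise fun b b' => Disjoint (A b) (A b') := fun b b' hbb =>
    Finset.disjoint_left.2 fun u h h' => hbb (((hf u b).1 h).symm.trans ((hf u b').1 h'))
  filter_upwards [noRival_lower_bound hp0 hp1 hk A hAk, atypical_bound hp0 hp1 A hA0 hdis]
    with ε ⟨c, hc, hn1⟩ ⟨e, he, hn2⟩
  set s := Fintype.card α with hs
  set κ : ℝ := ((∏ b, (A b).card.factorial : ℕ) : ℝ) with hκ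
  have hκ0 : 0 < κ := Nat.cast_pos.2 (Finset.prod_pos fun b _ => Nat.factorial_pos _)
  rw [sum_card_eq_card hf] at he
  -- The atypical part enters with coefficient `c n * Φ l ≤ 2`, once for each of at most n^s
  -- embeddings, and the multiplicity κ is divided out.
  refine ⟨c, hc, fun n => 2 * (n ^ s * |e n|) / κ, ?_, ?_⟩
  · have := (he.abs.const_mul 2).div_const κ
    simp only [abs_zero, mul_zero, zero_div, abs_mul] at this
    refine this.congr fun n => ?_
    rw [abs_of_nonneg (a := (n : ℝ) ^ s) (by positivity)]
  filter_upwards [hn1, hn2, hc.eventually_lt_const one_lt_two, hc.eventually_const_lt one_pos]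
    with n hn1 hn2 hc2 hc0 G hG
  have hqI : ∀ i, p ^ k i ∈ Set.Icc (0 : ℝ) 1 := fun i =>
    ⟨pow_nonneg hpI.1 _, pow_le_one₀ hpI.1 hpI.2⟩
  have hΦ : ∀ l : (Σ i : Fin r, Fin (m i)) → ℕ, ∃ Φ : ℝ, Φ = ∏ i, (1 - binomTail (n - s - k i)
      (p ^ k i) (l ⟨i, lastIdx (m i)⟩ - s)) ^ n.choose (k i) := fun l => ⟨_, rfl⟩
  choose Φ hΦ using hΦ
  have hΦ0 : ∀ l, 0 ≤ Φ l := fun l => by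
    rw [hΦ]
    exact Finset.prod_nonneg fun i _ => pow_nonneg (sub_nonneg.2 (binomTail_le_one (hqI i) _)) _
  have hΦ1 : ∀ l, Φ l ≤ 1 := fun l => by
    rw [hΦ]
    exact Finset.prod_le_one
      (fun i _ => pow_nonneg (sub_nonneg.2 (binomTail_le_one (hqI i) _)) _)
      fun i _ => pow_le_one₀ (sub_nonneg.2 (binomTail_le_one (hqI i) _))
        (sub_le_self _ (binomTail_nonneg (hqI i) _))
  have hT : ∀ T : α ↪ Fin n, c n * ∑ l ∈ G, topMass p k s n l - 2 * |e n| ≤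
      ∑ l ∈ G, pr p (TopSets k A T l) := by
    intro T
    have h1 : ∀ l ∈ G, c n * topMass p k s n l - 2 * pr p (fun ω =>
        (∀ b, outDeg (Finset.univ.map T) ((A b).map T) ω = l b) ∧ ¬ Typical p ε A T ω) ≤
        pr p (TopSets k A T l) := by
      intro l hl
      obtain ⟨_, hl1, hl2⟩ := hG l hl
      have h2 := hn1 T l (fun i => l ⟨i, lastIdx (m i)⟩) hl1 (fun b => by rw [hcard]; exact hl2 b)
      rw [← hΦ] at h2
      have h3 : pr p (fun ω => ∀ b, outDeg (Finset.univ.map T) ((A b).map T) ω = l b) =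
          ∏ b : Σ i : Fin r, Fin (m i), binom (n - s) (p ^ k b.1) (l b) := by
        rw [pr_outDeg_eq p _ _ (fun b => Finset.map_subset_map.2 (Finset.subset_univ _))
          fun b b' hbb => (Finset.disjoint_map T).2 (hdis hbb)]
        refine Finset.prod_congr rfl fun b _ => ?_
        rw [Finset.card_map, hcard, Finset.card_compl, Finset.card_map, Finset.card_univ,
          Fintype.card_fin]
      have h4 : pr p (fun ω => ∀ b, outDeg (Finset.univ.map T) ((A b).map T) ω = l b) ≤
          pr p (fun ω => (∀ b, outDeg (Finset.univ.map T) ((A b).map T) ω = l b) ∧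
            Typical p ε A T ω) +
          pr p (fun ω => (∀ b, outDeg (Finset.univ.map T) ((A b).map T) ω = l b) ∧
            ¬ Typical p ε A T ω) :=
        (pr_mono hpI fun ω hω => by
          by_cases h : Typical p ε A T ω
          · exact Or.inl ⟨hω, h⟩
          · exact Or.inr ⟨hω, h⟩).trans (pr_or_le hpI _ _)
      rw [h3] at h4
      refine le_trans ?_ h2
      rw [topMass, ← hΦ]
      have h5 := pr_nonneg hpI (fun ω => (∀ b, outDeg (Finset.univ.map T) ((A b).map T) ω = l b) ∧
            ¬ Typical p ε A T ω)
      have h6 : c n * Φ l ≤ 2 := by nlinarith [hΦ0 l, hΦ1 l]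
      have h7 : 0 ≤ c n * Φ l := mul_nonneg hc0.le (hΦ0 l)
      nlinarith [mul_le_mul_of_nonneg_left h4 h7, mul_le_mul_of_nonneg_right h6 h5]
    -- For different `l` the events are disjoint, and all lie in the event of `atypical_bound`. So
    -- the error is paid once for each `T`, whatever the size of `G`.
    have h2 : ∑ l ∈ G, pr p (fun ω => (∀ b, outDeg (Finset.univ.map T) ((A b).map T) ω = l b) ∧
        ¬ Typical p ε A T ω) ≤ |e n| := by
      refine le_trans ?_ ((hn2 T).trans (le_abs_self _))
      unfold pr
      rw [← ex_sum]
      refine ex_mono hpI fun ω => ?_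
      by_cases h : ∃ l ∈ G, (∀ b, outDeg (Finset.univ.map T) ((A b).map T) ω = l b) ∧
        ¬ Typical p ε A T ω
      · obtain ⟨l, hlG, hl⟩ := h
        rw [Finset.sum_eq_single_of_mem l hlG fun l' _ hne => ind_of_false fun h =>
          hne (funext fun b => (h.1 b).symm.trans (hl.1 b))]
        refine ind_mono fun h => ⟨fun b => ?_, h.2⟩
        obtain ⟨hsep, hl1, _⟩ := hG l hlG
        rw [h.1 b, hcard]
        have h3 := hl1 b.1
        have h4 : ((l ⟨b.1, lastIdx (m b.1)⟩ : ℕ) : ℝ) ≤ l b :=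
          Nat.cast_le.2 (hsep.last_le b.1 b.2)
        have h5 : (0 : ℝ) ≤ s := Nat.cast_nonneg _
        linarith
      · rw [Finset.sum_eq_zero fun l hl => ind_of_false fun h' => h ⟨l, hl, h'⟩]
        exact ind_nonneg _
    have h3 := Finset.sum_le_sum h1
    rw [Finset.sum_sub_distrib, ← Finset.mul_sum, ← Finset.mul_sum] at h3
    linarith
  have hsum := (Finset.sum_le_sum fun T (_ : T ∈ Finset.univ) => hT T).trans
    (sum_pr_topSets_le hpI hAk hf G fun l hl => (hG l hl).1)
  rw [Finset.sum_const, Finset.card_univ, Fintype.card_embedding_eq, Fintype.card_fin,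
    nsmul_eq_mul] at hsum
  have hdes : (n.descFactorial s : ℝ) ≤ (n : ℝ) ^ s := by
    exact_mod_cast Nat.descFactorial_le_pow n s
  have he0 := abs_nonneg (e n)
  rw [← mul_le_mul_iff_right₀ hκ0]
  refine le_trans ?_ hsum
  rw [mul_sub, mul_sub]
  have e1 : κ * (c n * (n.descFactorial s / κ * ∑ l ∈ G, topMass p k s n l)) =
      n.descFactorial s * (c n * ∑ l ∈ G, topMass p k s n l) := by
    field_simp
  have e2 : κ * (2 * (n ^ s * |e n|) / κ) = n ^ s * (2 * |e n|) := by field_simp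
  rw [e1, e2]
  nlinarith
end TopSets

/-! ### The ordered Gumbel density has total mass one. -/

section OrderedGumbel

open Topology

lemma measurable_orderedGumbelDensity (m : ℕ) [NeZero m] :
    Measurable (orderedGumbelDensity m) := by
  classical
  unfold orderedGumbelDensity
  have h : MeasurableSet {x : Fin m → ℝ | Antitone x} := isClosed_antitone.measurableSet
  refine Measurable.ite (by convert h) (by fun_prop) measurable_const

lemma orderedGumbelDensity_nonneg (m : ℕ) [NeZero m] (x : Fin m → ℝ) :
    0 ≤ orderedGumbelDensity m x := by
  unfold orderedGumbelDensity
  split_ifs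
  · exact mul_nonneg (Finset.prod_nonneg fun j _ => (Real.exp_pos _).le) (Real.exp_pos _).le
  · exact le_rfl

lemma hasDerivAt_exp_neg_exp_neg (x : ℝ) :
    HasDerivAt (fun x => Real.exp (-Real.exp (-x))) (Real.exp (-x) * Real.exp (-Real.exp (-x))) x := by
  have h : HasDerivAt (fun x => Real.exp (-Real.exp (-x)))
      (Real.exp (-Real.exp (-x)) * -(Real.exp (-x) * -1)) x := ((hasDerivAt_neg x).exp.neg).exp
  exact h.congr_deriv (by ring)

lemma tendsto_exp_neg_exp_neg_atBot :
    Tendsto (fun x : ℝ => Real.exp (-Real.exp (-x))) atBot (𝓝 0) :=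
  Real.tendsto_exp_atBot.comp (tendsto_neg_atTop_atBot.comp
    (Real.tendsto_exp_atTop.comp tendsto_neg_atBot_atTop))

lemma tendsto_exp_neg_exp_neg_atTop :
    Tendsto (fun x : ℝ => Real.exp (-Real.exp (-x))) atTop (𝓝 1) := by
  have h := (Real.tendsto_exp_atBot.comp tendsto_neg_atTop_atBot).neg
  rw [neg_zero] at h
  have := (Real.continuous_exp.tendsto 0).comp h
  rwa [Real.exp_zero] at this

lemma lintegral_Ioi_comp_neg (f : ℝ → ENNReal) (y : ℝ) :
    ∫⁻ x in Set.Iic y, f x = ∫⁻ x in Set.Ici (-y), f (-x) := by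
  have h := (Measure.measurePreserving_neg (volume : Measure ℝ)).setLIntegral_comp_preimage_emb
    (MeasurableEquiv.neg ℝ).measurableEmbedding f (Set.Iic y)
  rw [← h]
  congr 2
  ext x; simp

/-- The integrand is the derivative of exp(-e^{-x}), which tends to 0 at -∞. The half-line is
reflected because the fundamental theorem invoked is for half-lines unbounded above. -/
lemma lintegral_gumbel_Iic (y : ℝ) :
    ∫⁻ x in Set.Iic y, ENNReal.ofReal (Real.exp (-x) * Real.exp (-Real.exp (-x))) =
      ENNReal.ofReal (Real.exp (-Real.exp (-y))) := by
  have hd : ∀ x ∈ Set.Ici (-y), HasDerivAt (fun x => -Real.exp (-Real.exp (- -x)))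
      (Real.exp (- -x) * Real.exp (-Real.exp (- -x))) x := fun x _ => by
    have h : HasDerivAt (fun x => -Real.exp (-Real.exp (- -x)))
      (-(Real.exp (- -x) * Real.exp (-Real.exp (- -x)) * -1)) x :=
      ((hasDerivAt_exp_neg_exp_neg (-x)).comp x (hasDerivAt_neg x)).neg
    exact h.congr_deriv (by ring)
  have ht : Tendsto (fun x => -Real.exp (-Real.exp (- -x))) atTop (𝓝 0) := by
    simpa using (tendsto_exp_neg_exp_neg_atBot.comp tendsto_neg_atTop_atBot).neg
  have hpos : ∀ x : ℝ, 0 ≤ Real.exp (- -x) * Real.exp (-Real.exp (- -x)) := fun x => by positivity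
  rw [lintegral_Ioi_comp_neg, ← setLIntegral_congr Ioi_ae_eq_Ici,
    ← ofReal_integral_eq_lintegral_ofReal
      (integrableOn_Ioi_deriv_of_nonneg' hd (fun x _ => hpos x) ht)
      (ae_of_all _ hpos),
    integral_Ioi_of_hasDerivAt_of_nonneg' hd (fun x _ => hpos x) ht]
  congr 1
  simp

lemma lintegral_gumbel :
    ∫⁻ x : ℝ, ENNReal.ofReal (Real.exp (-x) * Real.exp (-Real.exp (-x))) = 1 := by
  have hU : (⋃ n : ℕ, Set.Iic (n : ℝ)) = Set.univ := by
    ext x; simpa using exists_nat_ge x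
  have hdir : Directed (· ⊆ ·) fun n : ℕ => Set.Iic (n : ℝ) :=
    directed_of_isDirected_le fun i j hij => Set.Iic_subset_Iic.2 (Nat.cast_le.2 hij)
  have h := setLIntegral_iUnion_of_directed (μ := (volume : Measure ℝ))
    (fun x => ENNReal.ofReal (Real.exp (-x) * Real.exp (-Real.exp (-x)))) hdir
  rw [hU, Measure.restrict_univ] at h
  simp only [lintegral_gumbel_Iic] at h
  rw [h]
  have hmono : Monotone fun n : ℕ => ENNReal.ofReal (Real.exp (-Real.exp (-n))) :=
    fun i j hij => ENNReal.ofReal_le_ofReal (Real.exp_le_exp.2 (neg_le_neg (Real.exp_le_exp.2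
      (neg_le_neg (Nat.cast_le.2 hij)))))
  refine tendsto_nhds_unique (tendsto_atTop_iSup hmono) ?_
  rw [← ENNReal.ofReal_one]
  exact ENNReal.tendsto_ofReal (tendsto_exp_neg_exp_neg_atTop.comp tendsto_natCast_atTop_atTop)

lemma lastIdx_succ (k : ℕ) : lastIdx (k + 1) = Fin.last k := rfl

lemma orderedGumbelDensity_of_antitone {m : ℕ} [NeZero m] {x : Fin m → ℝ} (hx : Antitone x) :
    orderedGumbelDensity m x =
      (∏ j, Real.exp (-x j)) * Real.exp (-Real.exp (-x (lastIdx m))) := if_pos hx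

lemma antitone_snoc_iff {k : ℕ} (x : Fin (k + 1) → ℝ) (t : ℝ) :
    Antitone (Fin.snoc x t : Fin (k + 2) → ℝ) ↔ Antitone x ∧ t ≤ x (Fin.last k) := by
  constructor
  · intro h
    refine ⟨fun i j hij => ?_, ?_⟩
    · simpa using h (Fin.castSucc_le_castSucc_iff.2 hij)
    · simpa using h (Fin.le_last (Fin.castSucc (Fin.last k)))
  · rintro ⟨h1, h2⟩ i j hij
    induction j using Fin.lastCases with
    | last =>
      induction i using Fin.lastCases with
      | last => exact le_rfl
      | cast i => simpa using h2.trans (h1 (Fin.le_last i))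
    | cast j =>
      induction i using Fin.lastCases with
      | last => exact absurd hij (not_le.2 (Fin.castSucc_lt_last j))
      | cast i => simpa using h1 (Fin.castSucc_le_castSucc_iff.1 hij)

/-- Integrating the smallest coordinate over (-∞, y], with y the next larger one, replaces its
factors by exp(-e^{-y}), by `lintegral_gumbel_Iic`. This is the induction step for total mass one.
-/
lemma lintegral_orderedGumbelDensity_snoc {k : ℕ} (x : Fin (k + 1) → ℝ) :
    ∫⁻ t : ℝ, ENNReal.ofReal (orderedGumbelDensity (k + 2) (Fin.snoc x t)) =
      ENNReal.ofReal (orderedGumbelDensity (k + 1) x) := by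
  by_cases hx : Antitone x
  · have h : ∀ t, ENNReal.ofReal (orderedGumbelDensity (k + 2) (Fin.snoc x t)) =
        ENNReal.ofReal (∏ j, Real.exp (-x j)) * (Set.Iic (x (Fin.last k))).indicator
          (fun t => ENNReal.ofReal (Real.exp (-t) * Real.exp (-Real.exp (-t)))) t := by
      intro t
      by_cases ht : t ≤ x (Fin.last k)
      · rw [orderedGumbelDensity_of_antitone ((antitone_snoc_iff x t).2 ⟨hx, ht⟩),
          Set.indicator_of_mem (Set.mem_Iic.2 ht), ← ENNReal.ofReal_mul
          (Finset.prod_nonneg fun j _ => (Real.exp_pos _).le), Fin.prod_univ_castSucc,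
          lastIdx_succ]
        simp [mul_assoc]
      · rw [Set.indicator_of_notMem (by simpa using ht), mul_zero, orderedGumbelDensity,
          if_neg fun h => ht ((antitone_snoc_iff x t).1 h).2, ENNReal.ofReal_zero]
    simp only [h]
    rw [lintegral_const_mul _ (Measurable.indicator (by fun_prop) measurableSet_Iic),
      lintegral_indicator measurableSet_Iic, lintegral_gumbel_Iic, ← ENNReal.ofReal_mul
          (Finset.prod_nonneg fun j _ => (Real.exp_pos _).le),
      orderedGumbelDensity_of_antitone hx, lastIdx_succ]
  · have h : ∀ t, orderedGumbelDensity (k + 2) (Fin.snoc x t) = 0 := fun t =>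
      if_neg fun h => hx ((antitone_snoc_iff x t).1 h).1
    simp only [h, ENNReal.ofReal_zero, lintegral_zero]
    rw [orderedGumbelDensity, if_neg hx, ENNReal.ofReal_zero]

lemma lintegral_orderedGumbelDensity_succ (k : ℕ) :
    ∫⁻ x : Fin (k + 1) → ℝ, ENNReal.ofReal (orderedGumbelDensity (k + 1) x) = 1 := by
  induction k with
  | zero =>
    have h := (volume_preserving_funUnique (Fin 1) ℝ).symm.lintegral_comp_emb
      (MeasurableEquiv.measurableEmbedding _)
      fun x : Fin 1 → ℝ => ENNReal.ofReal (orderedGumbelDensity 1 x)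
    refine h.symm.trans (Eq.trans (lintegral_congr fun t => ?_) lintegral_gumbel)
    rw [orderedGumbelDensity_of_antitone fun i j _ => (congrArg _ (Subsingleton.elim _ _)).le]
    simp
  | succ k ih =>
    have h := (volume_preserving_piFinSuccAbove (fun _ : Fin (k + 2) => ℝ)
      (Fin.last (k + 1))).symm.lintegral_comp_emb (MeasurableEquiv.measurableEmbedding _)
      fun x : Fin (k + 2) → ℝ => ENNReal.ofReal (orderedGumbelDensity (k + 2) x)
    rw [← h, ← ih, Measure.volume_eq_prod, lintegral_prod_symm]
    · refine lintegral_congr fun x => ?_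
      rw [← lintegral_orderedGumbelDensity_snoc]
      refine lintegral_congr fun t => ?_
      congr 2
      exact Fin.insertNth_last' t x
    · exact ((measurable_orderedGumbelDensity _).ennreal_ofReal.comp
        (MeasurableEquiv.measurable _)).aemeasurable

instance isProbabilityMeasure_orderedGumbel (m : ℕ) [NeZero m] :
    IsProbabilityMeasure (orderedGumbel m) := by
  obtain ⟨k, rfl⟩ : ∃ k, m = k + 1 := ⟨m - 1, (Nat.sub_add_cancel (NeZero.pos m)).symm⟩
  refine ⟨?_⟩
  rw [orderedGumbel, withDensity_apply _ MeasurableSet.univ, Measure.restrict_univ]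
  exact lintegral_orderedGumbelDensity_succ k

lemma integrable_orderedGumbelDensity (m : ℕ) [NeZero m] :
    Integrable (orderedGumbelDensity m) := by
  refine ⟨(measurable_orderedGumbelDensity m).aestronglyMeasurable, ?_⟩
  rw [hasFiniteIntegral_iff_ofReal (ae_of_all _ (orderedGumbelDensity_nonneg m))]
  have h := measure_univ (μ := orderedGumbel m)
  rw [orderedGumbel, withDensity_apply _ MeasurableSet.univ, Measure.restrict_univ] at h
  rw [h]; exact ENNReal.one_lt_top

/-- The product of the measures `orderedGumbel (m i)` has the product density. -/
lemma pi_orderedGumbel {r : ℕ} (m : Fin r → ℕ) [∀ i, NeZero (m i)] :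
    Measure.pi (fun i => orderedGumbel (m i)) = (volume : Measure (∀ i, Fin (m i) → ℝ)).withDensity
      fun x => ENNReal.ofReal (∏ i, orderedGumbelDensity (m i) (x i)) := by
  refine Measure.pi_eq fun s hs => ?_
  rw [withDensity_apply _ (MeasurableSet.univ_pi hs), ← lintegral_indicator (MeasurableSet.univ_pi hs)]
  have h1 : ∀ x : ∀ i, Fin (m i) → ℝ, (Set.univ.pi s).indicator
      (fun x => ENNReal.ofReal (∏ i, orderedGumbelDensity (m i) (x i))) x =
      ENNReal.ofReal (∏ i, (s i).indicator (orderedGumbelDensity (m i)) (x i)) := by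
    intro x
    by_cases hx : x ∈ Set.univ.pi s
    · rw [Set.indicator_of_mem hx]
      congr 1
      exact Finset.prod_congr rfl fun i _ => (Set.indicator_of_mem (hx i trivial) _).symm
    · rw [Set.indicator_of_notMem hx]
      simp only [Set.mem_univ_pi, not_forall] at hx
      obtain ⟨i, hi⟩ := hx
      rw [Finset.prod_eq_zero (Finset.mem_univ i) (Set.indicator_of_notMem hi _),
        ENNReal.ofReal_zero]
  have h0 : ∀ i x, 0 ≤ (s i).indicator (orderedGumbelDensity (m i)) x := fun i x =>
    Set.indicator_nonneg (fun x _ => orderedGumbelDensity_nonneg (m i) x) x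
  have hi : ∀ i, Integrable ((s i).indicator (orderedGumbelDensity (m i))) := fun i =>
    (integrable_orderedGumbelDensity (m i)).indicator (hs i)
  have hint : Integrable (fun x : ∀ i, Fin (m i) → ℝ =>
      ∏ i, (s i).indicator (orderedGumbelDensity (m i)) (x i)) := Integrable.fintype_prod_dep hi
  simp only [h1]
  rw [← ofReal_integral_eq_lintegral_ofReal hint
    (ae_of_all _ fun x => Finset.prod_nonneg fun i _ => h0 i _),
    integral_fintype_prod_volume_eq_prod, ENNReal.ofReal_prod_of_nonneg fun i _ =>
      integral_nonneg (h0 i)]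
  refine Finset.prod_congr rfl fun i _ => ?_
  rw [ofReal_integral_eq_lintegral_ofReal (hi i) (ae_of_all _ (h0 i)), orderedGumbel,
    withDensity_apply _ (hs i), ← lintegral_indicator (hs i)]
  refine lintegral_congr fun x => ?_
  by_cases hx : x ∈ s i <;> simp [hx]

end OrderedGumbel

/-! ### Pointwise asymptotic lower bounds for the mass function. -/

section Pointwise

open Topology

variable {p : ℝ}

/-- The deviation is (1 + o(1)) `gap`, while the two levels sit at (1 ± ε) `gap`. The distance of
order ε `gap` tends to infinity and absorbs any constant. -/
lemma eventually_level_of_tendsto (hp0 : 0 < p) (hp1 : p < 1) {k : ℕ} (hk : 0 < k) {l : ℕ → ℕ}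
    {x : ℝ} (hl : Tendsto (fun n => ((l n : ℝ) - center k (p ^ k) n) / spread k (p ^ k) n)
      atTop (𝓝 x)) {ε : ℝ} (hε : 0 < ε) (c : ℕ) :
    ∀ᶠ n in atTop, level p (-ε) k n + c ≤ l n ∧ (l n : ℝ) ≤ level p ε k n := by
  have hq0 : 0 < p ^ k := pow_pos hp0 k
  have hq1 : p ^ k < 1 := pow_lt_one₀ hp0.le hp1 hk.ne'
  obtain ⟨δ, hδ1, -, hδ3⟩ := exists_deviation hk hq0 hq1 0 hl
  have hδ0 : Tendsto δ atTop (𝓝 0) := by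
    have := hδ1.mul (Real.tendsto_sqrt_atTop.comp tendsto_log_natCast).inv_tendsto_atTop
    rw [zero_mul] at this
    refine this.congr' ?_
    filter_upwards [eventually_gt_atTop 1] with n hn
    have h5 := Real.sqrt_pos.2 (Real.log_pos (x := n) (by exact_mod_cast hn))
    simp only [Pi.inv_apply, Function.comp_apply]
    field_simp
  have hg := (tendsto_gap_atTop hk hq0 hq1).const_mul_atTop (half_pos hε)
  filter_upwards [hδ3, hδ0.eventually_lt_const (half_pos hε),
    hδ0.eventually_const_lt (neg_lt_zero.2 (half_pos hε)), hg.eventually_ge_atTop (c : ℝ),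
    eventually_gt_atTop 1] with n h1 h2 h3 h4 hn
  have hgap := gap_pos hk hq0 hq1 hn
  have hlev : ∀ ε, level p ε k n = n * p ^ k + (1 + ε) * gap k (p ^ k) n := fun ε => by
    rw [level, sd, gap, Real.sqrt_mul (mul_nonneg (by positivity) (Real.log_natCast_nonneg n))]
  rw [hlev, hlev]
  rw [Nat.sub_zero] at h1
  constructor <;> nlinarith

lemma eventually_le_center {k : ℕ} (hk : 0 < k) {q : ℝ} (hq0 : 0 < q) (hq1 : q < 1) :
    ∀ᶠ n : ℕ in atTop, n * q ≤ center k q n := by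
  have hkr : (0 : ℝ) < k := by exact_mod_cast hk
  have hL := tendsto_log_natCast
  have h1 : Tendsto (fun n : ℕ => Real.log k.factorial / (2 * k * Real.log n)) atTop (𝓝 0) :=
    (hL.const_mul_atTop (by positivity : (0 : ℝ) < 2 * k)).const_div_atTop _
  have h2 : Tendsto (fun n : ℕ => Real.log (4 * Real.pi * k * Real.log n) / (4 * k * Real.log n))
      atTop (𝓝 0) := by
    have h3 := (Real.isLittleO_log_id_atTop.tendsto_div_nhds_zero.comp
      (hL.const_mul_atTop (by positivity : (0 : ℝ) < 4 * Real.pi * k))).const_mul Real.pi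
    rw [mul_zero] at h3
    refine h3.congr fun n => ?_
    simp only [Function.comp_apply, id]
    rcases eq_or_ne (Real.log n) 0 with h | h
    · simp [h]
    · have := Real.pi_pos; field_simp
  have h3 := ((h1.const_sub 1).sub h2)
  rw [sub_zero, sub_zero] at h3
  filter_upwards [h3.eventually_const_lt one_pos, eventually_gt_atTop 1] with n h hn
  rw [center_eq]
  have := mul_pos (gap_pos hk hq0 hq1 hn) h
  linarith

lemma eventually_center_add_nonneg {k : ℕ} (hk : 0 < k) {q : ℝ} (hq0 : 0 < q) (hq1 : q < 1)
    (x : ℝ) : ∀ᶠ n : ℕ in atTop, 0 ≤ center k q n + spread k q n * x := by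
  have hkr : (1 : ℝ) ≤ k := by exact_mod_cast hk
  have h1 := (Real.tendsto_sqrt_atTop.comp tendsto_natCast_atTop_atTop).eventually_ge_atTop
    (|x| / q)
  filter_upwards [eventually_le_center hk hq0 hq1, h1,
    tendsto_log_natCast.eventually_ge_atTop 1] with n h2 h3 h4
  have h5 : spread k q n ≤ √n := by
    refine Real.sqrt_le_sqrt ?_
    rw [mul_div_assoc]
    refine mul_le_of_le_one_right (Nat.cast_nonneg n) ?_
    rw [div_le_one (by positivity)]
    nlinarith
  simp only [Function.comp_apply] at h3
  rw [div_le_iff₀ hq0] at h3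
  have h6 : spread k q n * |x| ≤ n * q := by
    calc spread k q n * |x| ≤ √n * (√n * q) :=
          mul_le_mul h5 h3 (abs_nonneg x) (Real.sqrt_nonneg _)
      _ = n * q := by rw [← mul_assoc, Real.mul_self_sqrt (Nat.cast_nonneg n)]
  have h7 : -(spread k q n * |x|) ≤ spread k q n * x := by
    rw [← mul_neg]
    exact mul_le_mul_of_nonneg_left (neg_abs_le x) (Real.sqrt_nonneg _)
  linarith

lemma tendsto_floor_normalized {k : ℕ} (hk : 0 < k) {q : ℝ} (hq0 : 0 < q) (hq1 : q < 1) (x : ℝ) :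
    Tendsto (fun n : ℕ => ((⌊center k q n + spread k q n * x⌋₊ : ℝ) - center k q n) / spread k q n)
      atTop (𝓝 x) := by
  have hw := tendsto_spread_atTop hk hq0 hq1
  have h1 : Tendsto (fun n : ℕ => x - (spread k q n)⁻¹) atTop (𝓝 x) := by
    simpa using hw.inv_tendsto_atTop.const_sub x
  refine tendsto_of_tendsto_of_tendsto_of_le_of_le' h1 tendsto_const_nhds ?_ ?_
  · filter_upwards [eventually_center_add_nonneg hk hq0 hq1 x, hw.eventually_gt_atTop 0]
      with n h2 h3
    rw [le_div_iff₀ h3, sub_mul, inv_mul_cancel₀ h3.ne']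
    linarith [Nat.lt_floor_add_one (center k q n + spread k q n * x)]
  · filter_upwards [eventually_center_add_nonneg hk hq0 hq1 x, hw.eventually_gt_atTop 0]
      with n h2 h3
    rw [div_le_iff₀ h3]
    linarith [Nat.floor_le h2]

/-- From log(1 - u) ≥ -u/(1 - u) one gets (1 - u)^N ≥ exp(-Nu/(1 - u)). Only an upper bound on Nu is
needed, and the tail estimates give no more. -/
lemma exists_le_one_sub_pow {u t : ℕ → ℝ} {N : ℕ → ℕ} {τ : ℝ} (hu : Tendsto u atTop (𝓝 0))
    (ht : Tendsto t atTop (𝓝 τ)) (hut : ∀ᶠ n in atTop, N n * u n ≤ t n) :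
    ∃ ψ : ℕ → ℝ, Tendsto ψ atTop (𝓝 (Real.exp (-τ))) ∧ ∀ᶠ n in atTop, ψ n ≤ (1 - u n) ^ N n := by
  refine ⟨fun n => Real.exp (-(t n / (1 - u n))), ?_, ?_⟩
  · have h := (ht.div (hu.const_sub 1) (by norm_num)).neg
    rw [sub_zero, div_one] at h
    exact (Real.continuous_exp.tendsto _).comp h
  · filter_upwards [hut, hu.eventually_lt_const one_pos] with n h1 h2
    have h3 : 0 < 1 - u n := by linarith
    rw [← Real.exp_log (pow_pos h3 (N n)), Real.exp_le_exp, Real.log_pow]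
    have h4 := Real.one_sub_inv_le_log_of_pos h3
    have h5 : 1 - (1 - u n)⁻¹ = -(u n / (1 - u n)) := by field_simp; ring
    rw [h5] at h4
    calc -(t n / (1 - u n)) ≤ -(N n * u n / (1 - u n)) :=
          neg_le_neg (div_le_div_of_nonneg_right h1 h3.le)
      _ = N n * -(u n / (1 - u n)) := by ring
      _ ≤ _ := mul_le_mul_of_nonneg_left h4 (Nat.cast_nonneg _)

lemma tendsto_descFactorial_div_pow (s : ℕ) :
    Tendsto (fun n : ℕ => (n.descFactorial s : ℝ) / n ^ s) atTop (𝓝 1) := by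
  induction s with
  | zero => simp
  | succ s ih =>
    have h := (tendsto_div_natSub s).inv₀ one_ne_zero
    have h2 := h.mul ih
    rw [inv_one, one_mul] at h2
    refine h2.congr fun n => ?_
    rw [Nat.descFactorial_succ, pow_succ']
    push_cast
    rw [inv_div, div_mul_div_comm]

variable {r : ℕ} {m k : Fin r → ℕ} [∀ i, NeZero (m i)]

/-- The probability that there are no rivals, in the limit. -/
lemma exists_le_noRival_factor (hp0 : 0 < p) (hp1 : p < 1) {k : ℕ} (hk : 0 < k) (s : ℕ)
    {l : ℕ → ℕ} {x : ℝ}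
    (hl : Tendsto (fun n => ((l n : ℝ) - center k (p ^ k) n) / spread k (p ^ k) n) atTop (𝓝 x)) :
    ∃ ψ : ℕ → ℝ, Tendsto ψ atTop (𝓝 (Real.exp (-Real.exp (-x)))) ∧
      ∀ᶠ n in atTop, 0 ≤ ψ n ∧
        ψ n ≤ (1 - binomTail (n - s - k) (p ^ k) (l n - s)) ^ n.choose k := by
  have hq0 : 0 < p ^ k := pow_pos hp0 k
  have hq1 : p ^ k < 1 := pow_lt_one₀ hp0.le hp1 hk.ne'
  have hw := tendsto_spread_atTop hk hq0 hq1
  -- Lowering the threshold by the constant `s` does not change the limit, because `spread` tends to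
  -- infinity. The truncated subtraction is harmless since l n is eventually at least `s`.
  have hl' : Tendsto (fun n => (((l n - s : ℕ) : ℝ) - center k (p ^ k) n) / spread k (p ^ k) n)
      atTop (𝓝 x) := by
    have h1 := hl.sub (hw.inv_tendsto_atTop.const_mul (s : ℝ))
    rw [mul_zero, sub_zero] at h1
    refine h1.congr' ?_
    filter_upwards [eventually_level_of_tendsto hp0 hp1 hk hl one_pos s] with n hn
    have h2 : (s : ℝ) ≤ l n := by
      refine le_trans ?_ hn.1
      rw [level]
      have : (0 : ℝ) ≤ n * p ^ k := by positivity
      linarith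
    rw [Nat.cast_sub (by exact_mod_cast h2)]
    simp only [Pi.inv_apply]
    ring
  obtain ⟨t, ht, htn⟩ := binomTail_extreme_le hk hq0 hq1 (s + k) hl'
  have hqI : p ^ k ∈ Set.Icc (0 : ℝ) 1 := ⟨hq0.le, hq1.le⟩
  have htail0 : ∀ n : ℕ, 0 ≤ binomTail (n - s - k) (p ^ k) (l n - s) := fun n =>
    binomTail_nonneg hqI _
  have hu : Tendsto (fun n : ℕ => binomTail (n - s - k) (p ^ k) (l n - s)) atTop (𝓝 0) := by
    have h1 : Tendsto (fun n : ℕ => t n * (((n : ℝ) ^ k)⁻¹ * k.factorial)) atTop (𝓝 0) := by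
      have := ht.mul ((((tendsto_pow_atTop hk.ne').comp
        (tendsto_natCast_atTop_atTop (R := ℝ))).inv_tendsto_atTop).mul_const (k.factorial : ℝ))
      simpa using this
    refine squeeze_zero' (Eventually.of_forall htail0) ?_ h1
    filter_upwards [htn, eventually_gt_atTop 0] with n hn h0
    rw [Nat.sub_sub]
    have h2 : (0 : ℝ) < n ^ k := by positivity
    have h3 : (0 : ℝ) < k.factorial := by positivity
    calc _ = ((n : ℝ) ^ k / k.factorial * binomTail (n - (s + k)) (p ^ k) (l n - s)) *
          (((n : ℝ) ^ k)⁻¹ * k.factorial) := by field_simp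
      _ ≤ _ := mul_le_mul_of_nonneg_right hn (by positivity)
  obtain ⟨ψ, hψ, hψn⟩ := exists_le_one_sub_pow (N := fun n => n.choose k) hu ht (by
    filter_upwards [htn] with n hn
    refine le_trans ?_ hn
    rw [Nat.sub_sub]
    exact mul_le_mul_of_nonneg_right (Nat.choose_le_pow_div k n) (binomTail_nonneg hqI _))
  refine ⟨ψ, hψ, ?_⟩
  filter_upwards [hψn, hψ.eventually_const_lt (Real.exp_pos _)] with n h1 h2
  exact ⟨h2.le, h1⟩

/-- A pointwise asymptotic lower bound for the mass function of the largest numbers of common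
neighbours. -/
lemma exists_le_topMass (hp0 : 0 < p) (hp1 : p < 1) (hk0 : ∀ i, 0 < k i) {s : ℕ}
    (hs : ∑ b : Σ i : Fin r, Fin (m i), k b.1 = s)
    {l : ℕ → (Σ i : Fin r, Fin (m i)) → ℕ} {x : ∀ i, Fin (m i) → ℝ}
    (hl : ∀ i j, Tendsto (fun n => ((l n ⟨i, j⟩ : ℝ) - center (k i) (p ^ k i) n) /
      spread (k i) (p ^ k i) n) atTop (𝓝 (x i j))) :
    ∃ ψ : ℕ → ℝ, Tendsto ψ atTop (𝓝 (∏ i, ((∏ j, Real.exp (-x i j)) *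
        Real.exp (-Real.exp (-x i (lastIdx (m i))))))) ∧
      ∀ᶠ n in atTop, ψ n ≤ n.descFactorial s /
        (∏ b : Σ i : Fin r, Fin (m i), (k b.1).factorial : ℕ) * topMass p k s n (l n) *
        ∏ b : Σ i : Fin r, Fin (m i), spread (k b.1) (p ^ k b.1) n := by
  have hq0 : ∀ i, 0 < p ^ k i := fun i => pow_pos hp0 _
  have hq1 : ∀ i, p ^ k i < 1 := fun i => pow_lt_one₀ hp0.le hp1 (hk0 i).ne'
  have h1 := fun i => exists_le_noRival_factor hp0 hp1 (hk0 i) s (hl i (lastIdx (m i)))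
  choose ψ hψ hψn using h1
  refine ⟨fun n => n.descFactorial s / (n : ℝ) ^ s * ((∏ i, ψ i n) *
    ∏ b : Σ i : Fin r, Fin (m i), ((n : ℝ) ^ k b.1 / (k b.1).factorial *
      spread (k b.1) (p ^ k b.1) n * binom (n - s) (p ^ k b.1) (l n b))), ?_, ?_⟩
  · have h2 := (tendsto_descFactorial_div_pow s).mul
      ((tendsto_finsetProd Finset.univ fun i _ => hψ i).mul
      (tendsto_finsetProd Finset.univ fun (b : Σ i : Fin r, Fin (m i)) _ =>
        tendsto_binom_extreme (hk0 b.1) (hq0 b.1) (hq1 b.1) s (hl b.1 b.2)))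
    refine h2.trans (le_of_eq ?_)
    rw [one_mul, Fintype.prod_sigma, Finset.prod_mul_distrib, mul_comm]
  · filter_upwards [eventually_all.2 hψn, eventually_gt_atTop 0] with n hn h0
    -- Since the class sizes add up to `s`, the factor n^s, which approximates the number of
    -- embeddings, splits into one n^k per class, the normalization in `tendsto_binom_extreme`.
    have hprod : ∏ b : Σ i : Fin r, Fin (m i), ((n : ℝ) ^ k b.1 / (k b.1).factorial *
        spread (k b.1) (p ^ k b.1) n * binom (n - s) (p ^ k b.1) (l n b)) =
        n ^ s / (∏ b : Σ i : Fin r, Fin (m i), (k b.1).factorial : ℕ) *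
        (∏ b : Σ i : Fin r, Fin (m i), spread (k b.1) (p ^ k b.1) n) *
        ∏ b : Σ i : Fin r, Fin (m i), binom (n - s) (p ^ k b.1) (l n b) := by
      rw [Finset.prod_mul_distrib, Finset.prod_mul_distrib, Finset.prod_div_distrib,
        Finset.prod_pow_eq_pow_sum, hs]
      push_cast
      rfl
    have hψle : ∏ i, ψ i n ≤ ∏ i, (1 - binomTail (n - s - k i) (p ^ k i)
        (l n ⟨i, lastIdx (m i)⟩ - s)) ^ n.choose (k i) :=
      Finset.prod_le_prod (fun i _ => (hn i).1) fun i _ => (hn i).2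
    have hb0 : 0 ≤ ∏ b : Σ i : Fin r, Fin (m i), binom (n - s) (p ^ k b.1) (l n b) :=
      Finset.prod_nonneg fun b _ => binom_nonneg ⟨(hq0 _).le, (hq1 _).le⟩ _
    have hs0 : 0 ≤ ∏ b : Σ i : Fin r, Fin (m i), spread (k b.1) (p ^ k b.1) n :=
      Finset.prod_nonneg fun b _ => Real.sqrt_nonneg _
    rw [hprod, topMass]
    have hns : (0 : ℝ) < (n : ℝ) ^ s := by positivity
    calc _ = n.descFactorial s / (∏ b : Σ i : Fin r, Fin (m i), (k b.1).factorial : ℕ) *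
          ((∏ i, ψ i n) * ∏ b : Σ i : Fin r, Fin (m i), binom (n - s) (p ^ k b.1) (l n b)) *
          ∏ b : Σ i : Fin r, Fin (m i), spread (k b.1) (p ^ k b.1) n := by
          field_simp
      _ ≤ _ := by gcongr

end Pointwise

/-! ### From lattice masses to Lebesgue densities. -/

section Fatou

open Topology

/-- Passing to a `liminf` with a vanishing error. -/
lemma le_liminf_ofReal_of_le_add {a : ENNReal} {u v δ : ℕ → ℝ} (hδ : Tendsto δ atTop (𝓝 0))
    (huv : ∀ᶠ n in atTop, u n ≤ v n + δ n)
    (ha : a ≤ liminf (fun n => ENNReal.ofReal (u n)) atTop) :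
    a ≤ liminf (fun n => ENNReal.ofReal (v n)) atTop := by
  refine ENNReal.le_of_forall_pos_le_add fun η hη _ => ?_
  rw [← liminf_add_const atTop _ _ (by isBoundedDefault) (by isBoundedDefault)]
  refine ha.trans (liminf_le_liminf ?_)
  filter_upwards [huv, hδ.eventually_lt_const (NNReal.coe_pos.2 hη)] with n h1 h2
  calc ENNReal.ofReal (u n) ≤ ENNReal.ofReal (v n + η) := ENNReal.ofReal_le_ofReal (by linarith)
    _ ≤ ENNReal.ofReal (v n) + ENNReal.ofReal η := ENNReal.ofReal_add_le
    _ = _ := by rw [ENNReal.ofReal_coe_nnreal]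

variable {r : ℕ} {m : Fin r → ℕ}

/-- The coincidence set is the kernel of a nonzero linear functional. Hence almost every decreasing
vector is strictly decreasing, which later provides the separation of the integer points. -/
lemma ae_ne_of_ne (m : Fin r → ℕ) :
    ∀ᵐ x : ∀ i, Fin (m i) → ℝ, ∀ i, ∀ j j', j ≠ j' → x i j ≠ x i j' := by
  refine ae_all_iff.2 fun i => ae_all_iff.2 fun j => ae_all_iff.2 fun j' => ?_
  by_cases hjj : j = j'
  · exact ae_of_all _ fun x h => absurd hjj h
  let φ : (∀ i, Fin (m i) → ℝ) →ₗ[ℝ] ℝ :=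
    ((LinearMap.proj j : (Fin (m i) → ℝ) →ₗ[ℝ] ℝ) - LinearMap.proj j').comp
      (LinearMap.proj (φ := fun i => Fin (m i) → ℝ) i)
  have hφ : ∀ x, φ x = x i j - x i j' := fun x => rfl
  have h := Measure.addHaar_submodule (volume : Measure (∀ i, Fin (m i) → ℝ)) (LinearMap.ker φ)
    (fun h => by
      have h1 : (Function.update 0 i (Pi.single j 1) : ∀ i, Fin (m i) → ℝ) ∈ LinearMap.ker φ := by
        rw [h]; trivial
      rw [LinearMap.mem_ker, hφ] at h1
      simp [Ne.symm hjj] at h1)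
  rw [ae_iff]
  refine measure_mono_null (fun x hx => ?_) h
  simp only [ne_eq, hjj, not_false_eq_true, forall_const, Set.mem_ofPred_eq, not_not] at hx
  rw [SetLike.mem_coe, LinearMap.mem_ker, hφ, hx, sub_self]

/-- The points `x` with `⌊c b + w b * x b⌋ = l b`. -/
def cell (c w : (Σ i : Fin r, Fin (m i)) → ℝ) (l : (Σ i : Fin r, Fin (m i)) → ℕ) :
    Set (∀ i, Fin (m i) → ℝ) :=
  Set.univ.pi fun i => Set.univ.pi fun j =>
    Set.Ico ((l ⟨i, j⟩ - c ⟨i, j⟩) / w ⟨i, j⟩) ((l ⟨i, j⟩ + 1 - c ⟨i, j⟩) / w ⟨i, j⟩)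

lemma measurableSet_cell (c w : (Σ i : Fin r, Fin (m i)) → ℝ) (l : (Σ i : Fin r, Fin (m i)) → ℕ) :
    MeasurableSet (cell c w l) :=
  MeasurableSet.univ_pi fun _ => MeasurableSet.univ_pi fun _ => measurableSet_Ico

lemma volume_cell {c w : (Σ i : Fin r, Fin (m i)) → ℝ} (hw : ∀ b, 0 < w b)
    (l : (Σ i : Fin r, Fin (m i)) → ℕ) :
    volume (cell c w l) = ENNReal.ofReal (∏ b, w b)⁻¹ := by
  have h : ∀ b, (l b + 1 - c b) / w b - (l b - c b) / w b = (w b)⁻¹ := fun b => by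
    have := (hw b).ne'; field_simp; ring
  rw [cell, volume_pi_pi]
  simp only [Real.volume_pi_Ico, h]
  rw [← Fintype.prod_sigma (fun b : Σ i : Fin r, Fin (m i) => ENNReal.ofReal (w b)⁻¹),
    ← ENNReal.ofReal_prod_of_nonneg fun b _ => (inv_pos.2 (hw b)).le, Finset.prod_inv_distrib]

lemma mem_cell_floor {c w : (Σ i : Fin r, Fin (m i)) → ℝ} (hw : ∀ b, 0 < w b)
    {x : ∀ i, Fin (m i) → ℝ} (h : ∀ i j, 0 ≤ c ⟨i, j⟩ + w ⟨i, j⟩ * x i j) :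
    x ∈ cell c w fun b => ⌊c b + w b * x b.1 b.2⌋₊ := by
  intro i _ j _
  dsimp only
  rw [Set.mem_Ico, div_le_iff₀ (hw _), lt_div_iff₀ (hw _)]
  have h1 := Nat.floor_le (h i j)
  have h2 := Nat.lt_floor_add_one (c ⟨i, j⟩ + w ⟨i, j⟩ * x i j)
  constructor <;> linarith

/-- Fatou's lemma for mass functions on lattices that become dense. -/
lemma lintegral_le_liminf_sum (c w : ℕ → (Σ i : Fin r, Fin (m i)) → ℝ)
    (hw : ∀ᶠ n in atTop, ∀ b, 0 < w n b) (G : ℕ → Finset ((Σ i : Fin r, Fin (m i)) → ℕ))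
    (M : ℕ → ((Σ i : Fin r, Fin (m i)) → ℕ) → ℝ) {ρ : (∀ i, Fin (m i) → ℝ) → ℝ}
    {O : Set (∀ i, Fin (m i) → ℝ)} (hO : MeasurableSet O)
    (h : ∀ᵐ x, x ∈ O → ρ x ≤ 0 ∨ ∃ ψ : ℕ → ℝ, Tendsto ψ atTop (𝓝 (ρ x)) ∧ ∀ᶠ n in atTop,
      (∀ i j, 0 ≤ c n ⟨i, j⟩ + w n ⟨i, j⟩ * x i j) ∧
      (fun b => ⌊c n b + w n b * x b.1 b.2⌋₊) ∈ G n ∧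
      ψ n ≤ M n (fun b => ⌊c n b + w n b * x b.1 b.2⌋₊) * ∏ b, w n b) :
    ∫⁻ x in O, ENNReal.ofReal (ρ x) ≤
      liminf (fun n => ∑ l ∈ G n, ENNReal.ofReal (M n l)) atTop := by
  -- The step function that spreads each mass `M n l` uniformly over the cell of `l`. At `x` it is
  -- at least the value on the cell containing `x`, which is indexed by the rounded-down vector.
  set F : ℕ → (∀ i, Fin (m i) → ℝ) → ENNReal := fun n x => ∑ l ∈ G n,
    (cell (c n) (w n) l).indicator (fun _ => ENNReal.ofReal (M n l * ∏ b, w n b)) x with hF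
  have hFm : ∀ n, Measurable (F n) := fun n => Finset.measurable_fun_sum _ fun l _ =>
    measurable_const.indicator (measurableSet_cell _ _ _)
  have h1 : ∫⁻ x in O, ENNReal.ofReal (ρ x) ≤ ∫⁻ x in O, liminf (fun n => F n x) atTop := by
    refine lintegral_mono_ae ((ae_restrict_iff' hO).2 ?_)
    filter_upwards [h] with x hx hxO
    rcases hx hxO with h0 | ⟨ψ, hψ, hψn⟩
    · rw [ENNReal.ofReal_of_nonpos h0]; exact zero_le
    · rw [← (ENNReal.tendsto_ofReal hψ).liminf_eq]
      refine liminf_le_liminf ?_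
      filter_upwards [hψn, hw] with n hn hwn
      refine (ENNReal.ofReal_le_ofReal hn.2.2).trans ?_
      have := Finset.single_le_sum (f := fun l => (cell (c n) (w n) l).indicator
        (fun _ => ENNReal.ofReal (M n l * ∏ b, w n b)) x) (fun _ _ => zero_le) hn.2.1
      rwa [Set.indicator_of_mem (mem_cell_floor hwn hn.1)] at this
  refine h1.trans ((lintegral_liminf_le hFm).trans (liminf_le_liminf ?_))
  filter_upwards [hw] with n hwn
  have hw0 : 0 < ∏ b, w n b := Finset.prod_pos fun b _ => hwn b
  -- Cells may stick out of `O`. Dropping the restriction only enlarges the integral, and the total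
  -- is exactly the sum of the masses.
  refine (lintegral_mono' Measure.restrict_le_self le_rfl).trans (le_of_eq ?_)
  simp only [hF]
  rw [lintegral_finsetSum _ fun l _ => measurable_const.indicator (measurableSet_cell _ _ _)]
  refine Finset.sum_congr rfl fun l _ => ?_
  rw [lintegral_indicator (measurableSet_cell _ _ _), setLIntegral_const, volume_cell hwn,
    ← ENNReal.ofReal_mul' (inv_nonneg.2 hw0.le), mul_assoc, mul_inv_cancel₀ hw0.ne', mul_one]

end Fatou

/-! ### The liminf bound for the joint law of the top codegrees. -/

section LimitLaw

open Topology

variable {p : ℝ} {α : Type*} [Fintype α] [DecidableEq α] {r : ℕ} {m k : Fin r → ℕ}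
  [∀ i, NeZero (m i)] {A : (Σ i : Fin r, Fin (m i)) → Finset α}

/-- The numbers `l b`, centered and scaled. -/
noncomputable def normalized (p : ℝ) (k : Fin r → ℕ) (n : ℕ) (l : (Σ i : Fin r, Fin (m i)) → ℕ) :
    ∀ i, Fin (m i) → ℝ :=
  fun i j => (l ⟨i, j⟩ - center (k i) (p ^ k i) n) / spread (k i) (p ^ k i) n

omit [∀ i, NeZero (m i)] in
lemma eventually_separated (hp0 : 0 < p) (hp1 : p < 1) (hk0 : ∀ i, 0 < k i)
    {l : ℕ → (Σ i : Fin r, Fin (m i)) → ℕ} {x : ∀ i, Fin (m i) → ℝ}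
    (hx : ∀ i, StrictAnti (x i))
    (hl : ∀ i j, Tendsto (fun n => normalized p k n (l n) i j) atTop (𝓝 (x i j))) (c : ℕ) :
    ∀ᶠ n in atTop, Separated c (l n) := by
  unfold Separated
  refine eventually_all.2 fun i => eventually_all.2 fun j => eventually_all.2 fun j' => ?_
  by_cases hj : j < j'
  swap
  · exact Eventually.of_forall fun n h => absurd h hj
  have hq0 : 0 < p ^ k i := pow_pos hp0 _
  have hq1 : p ^ k i < 1 := pow_lt_one₀ hp0.le hp1 (hk0 i).ne'
  have hw := tendsto_spread_atTop (hk0 i) hq0 hq1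
  have h1 := ((hl i j).sub (hl i j')).pos_mul_atTop (sub_pos.2 (hx i hj)) hw
  filter_upwards [h1.eventually_gt_atTop (c : ℝ), hw.eventually_gt_atTop 0] with n h2 h3 _
  have h4 : (normalized p k n (l n) i j - normalized p k n (l n) i j') *
      spread (k i) (p ^ k i) n = l n ⟨i, j⟩ - l n ⟨i, j'⟩ := by
    simp only [normalized]; field_simp; ring
  rw [h4] at h2
  have : ((l n ⟨i, j'⟩ + c : ℕ) : ℝ) < l n ⟨i, j⟩ := by push_cast; linarith
  exact_mod_cast this

/-- The asymptotic distribution of the largest numbers of common neighbours: a lower bound for the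
probability that they lie in a given set. -/
lemma le_liminf_topSets (hp0 : 0 < p) (hp1 : p < 1) (hk : Function.Injective k)
    (hk0 : ∀ i, 0 < k i) (hAk : ∀ i j, (A ⟨i, j⟩).card = k i)
    {f : α → Σ i : Fin r, Fin (m i)} (hf : ∀ u b, u ∈ A b ↔ f u = b)
    {O : Set (∀ i, Fin (m i) → ℝ)} (hO : MeasurableSet O) (O' : ℕ → Set (∀ i, Fin (m i) → ℝ))
    (hOO : ∀ x ∈ O, ∀ y : ℕ → ∀ i, Fin (m i) → ℝ, Tendsto y atTop (𝓝 x) → ∀ᶠ n in atTop, y n ∈ O' n) :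
    Measure.pi (fun i => orderedGumbel (m i)) O ≤
      liminf (fun n => ENNReal.ofReal (pr p fun ω => ∃ T : α ↪ Fin n, ∃ l,
        Separated (Fintype.card α) l ∧ normalized p k n l ∈ O' n ∧ TopSets k A T l ω)) atTop := by
  classical
  have hpI : p ∈ Set.Icc (0 : ℝ) 1 := ⟨hp0.le, hp1.le⟩
  have hq0 : ∀ i, 0 < p ^ k i := fun i => pow_pos hp0 _
  have hq1 : ∀ i, p ^ k i < 1 := fun i => pow_lt_one₀ hp0.le hp1 (hk0 i).ne'
  have hcard : ∀ b, (A b).card = k b.1 := fun b => hAk b.1 b.2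
  obtain ⟨ε, ⟨c, hc, e, he, hn⟩, hε⟩ :=
    ((topSets_lower_bound hp0 hp1 hk hk0 hAk hf).and self_mem_nhdsWithin).exists
  have hε : 0 < ε := hε
  set s := Fintype.card α with hs
  have hsum : ∑ b : Σ i : Fin r, Fin (m i), k b.1 = s := by
    rw [hs, ← sum_card_eq_card hf]; exact Finset.sum_congr rfl fun b _ => (hcard b).symm
  simp only [hcard] at hn
  set κ : ℝ := ((∏ b : Σ i : Fin r, Fin (m i), (k b.1).factorial : ℕ) : ℝ) with hκ
  -- The integer vectors to which `topSets_lower_bound` applies and whose normalization lies in `O'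
  -- n`; the upper levels make the set finite.
  set G : ℕ → Finset ((Σ i : Fin r, Fin (m i)) → ℕ) := fun n =>
    (Fintype.piFinset fun b => Finset.range (⌊level p ε (k b.1) n⌋₊ + 1)).filter fun l =>
      (Separated s l ∧ (∀ i, level p (-ε) (k i) n + s ≤ l ⟨i, lastIdx (m i)⟩) ∧
        ∀ b, (l b : ℝ) ≤ level p ε (k b.1) n) ∧ normalized p k n l ∈ O' n with hG
  set M : ℕ → ((Σ i : Fin r, Fin (m i)) → ℕ) → ℝ := fun n l =>
    n.descFactorial s / κ * topMass p k s n l with hM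
  have hM0 : ∀ n l, 0 ≤ M n l := fun n l => by
    have hqI : ∀ i, p ^ k i ∈ Set.Icc (0 : ℝ) 1 := fun i => ⟨(hq0 i).le, (hq1 i).le⟩
    refine mul_nonneg (by positivity) (mul_nonneg (Finset.prod_nonneg fun i _ =>
      pow_nonneg (sub_nonneg.2 (binomTail_le_one (hqI i) _)) _)
      (Finset.prod_nonneg fun b _ => binom_nonneg (hqI _) _))
  have hmain : Measure.pi (fun i => orderedGumbel (m i)) O ≤
      liminf (fun n => ENNReal.ofReal (∑ l ∈ G n, M n l)) atTop := by
    rw [pi_orderedGumbel, withDensity_apply _ hO]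
    simp only [ENNReal.ofReal_sum_of_nonneg fun l _ => hM0 _ l]
    refine lintegral_le_liminf_sum (fun n b => center (k b.1) (p ^ k b.1) n)
      (fun n b => spread (k b.1) (p ^ k b.1) n)
      (eventually_all.2 fun b => (tendsto_spread_atTop (hk0 b.1) (hq0 _) (hq1 _)).eventually_gt_atTop
        0) G M hO ?_
    filter_upwards [ae_ne_of_ne m] with x hx hxO
    -- Off the decreasing vectors the limit density is zero and there is nothing to prove.
    by_cases hanti : ∀ i, Antitone (x i)
    swap
    · left
      push Not at hanti
      obtain ⟨i, hi⟩ := hanti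
      exact (Finset.prod_eq_zero (Finset.mem_univ i) (if_neg hi)).le
    right
    have hstrict : ∀ i, StrictAnti (x i) := fun i =>
      (hanti i).strictAnti_of_injective fun j j' h => by_contra fun hne => hx i j j' hne h
    have hl := fun (i : Fin r) (j : Fin (m i)) =>
      tendsto_floor_normalized (hk0 i) (hq0 i) (hq1 i) (x i j)
    set l : ℕ → (Σ i : Fin r, Fin (m i)) → ℕ := fun n b =>
      ⌊center (k b.1) (p ^ k b.1) n + spread (k b.1) (p ^ k b.1) n * x b.1 b.2⌋₊ with hldef
    obtain ⟨ψ, hψ, hψn⟩ := exists_le_topMass (l := l) hp0 hp1 hk0 hsum hl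
    refine ⟨ψ, ?_, ?_⟩
    · convert hψ using 2
      exact Finset.prod_congr rfl fun i _ => orderedGumbelDensity_of_antitone (hanti i)
    have hlev : ∀ᶠ n in atTop, ∀ b : Σ i : Fin r, Fin (m i),
        level p (-ε) (k b.1) n + s ≤ l n b ∧ (l n b : ℝ) ≤ level p ε (k b.1) n :=
      eventually_all.2 fun b => eventually_level_of_tendsto hp0 hp1 (hk0 b.1) (l := fun n => l n b)
        (hl b.1 b.2) hε s
    filter_upwards [hψn, hlev, eventually_all.2 fun i => eventually_all.2 fun j =>
        eventually_center_add_nonneg (hk0 i) (hq0 i) (hq1 i) (x i j),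
      eventually_separated hp0 hp1 hk0 hstrict (l := l) hl s,
      hOO x hxO (fun n => normalized p k n (l n))
        (tendsto_pi_nhds.2 fun i => tendsto_pi_nhds.2 fun j => hl i j)] with n h1 h2 h3 h4 h5
    refine ⟨h3, ?_, h1⟩
    rw [hG, Finset.mem_filter]
    refine ⟨Fintype.mem_piFinset.2 fun b => Finset.mem_range.2 (Nat.lt_succ_of_le
      (Nat.le_floor (h2 b).2)), ⟨h4, fun i => (h2 ⟨i, lastIdx (m i)⟩).1, fun b => (h2 b).2⟩, h5⟩
  refine le_liminf_ofReal_of_le_add (δ := fun n => |e n| + 4 * |1 - c n|) ?_ ?_ hmain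
  · have := he.abs.add ((hc.const_sub 1).abs.const_mul 4)
    simpa using this
  · filter_upwards [hn, hc.eventually_const_lt (by norm_num : (1 / 2 : ℝ) < 1),
      he.eventually_lt_const one_pos] with n hn hc2 he1
    have h1 := hn (G n) fun l hl => (Finset.mem_filter.1 hl).2.1
    rw [Finset.mul_sum] at h1
    change c n * (∑ l ∈ G n, M n l) - e n ≤ _ at h1
    have h2 : pr p (fun ω => ∃ T : α ↪ Fin n, ∃ l ∈ G n, TopSets k A T l ω) ≤
        pr p (fun ω => ∃ T : α ↪ Fin n, ∃ l, Separated s l ∧ normalized p k n l ∈ O' n ∧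
          TopSets k A T l ω) := by
      refine pr_mono hpI ?_
      rintro ω ⟨T, l, hl, h⟩
      have := (Finset.mem_filter.1 hl).2
      exact ⟨T, l, this.1.1, this.2, h⟩
    have h3 : 0 ≤ ∑ l ∈ G n, M n l := Finset.sum_nonneg fun l _ => hM0 n l
    have h4 := pr_le_one hpI (fun ω => ∃ T : α ↪ Fin n, ∃ l ∈ G n, TopSets k A T l ω)
    -- The lower bound itself controls the total mass: with `c n` above 1/2, the error below 1 and a
    -- probability at most 1, the sum is at most 4. So replacing `c n` by 1 costs at most 4|1 - c
    -- n|.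
    have h5 : ∑ l ∈ G n, M n l ≤ 4 := by nlinarith
    have h6 : (1 - c n) * ∑ l ∈ G n, M n l ≤ |1 - c n| * 4 :=
      (mul_le_mul_of_nonneg_right (le_abs_self _) h3).trans
        (mul_le_mul_of_nonneg_left h5 (abs_nonneg _))
    have h7 := le_abs_self (e n)
    linarith

end LimitLaw

/-! ### Counting homomorphisms in a quasirandom configuration. -/

section Counting

variable {N W : Type*} [Fintype N] [DecidableEq N] [Fintype W]

/-- Exchanging the value of the map at `x` with the auxiliary point is an involution on pairs. -/
lemma sum_update (f : (N → W) → ℝ) (x : N) :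
    ∑ φ, ∑ a, f (Function.update φ x a) = Fintype.card W * ∑ φ, f φ := by
  let σ : (N → W) × W → (N → W) × W := fun z => (Function.update z.1 x z.2, z.1 x)
  have hσ : Function.Involutive σ := fun z => by simp [σ]
  calc ∑ φ, ∑ a, f (Function.update φ x a) = ∑ z : (N → W) × W, f (σ z).1 := by
        rw [Fintype.sum_prod_type]
    _ = ∑ z : (N → W) × W, f z.1 := Fintype.sum_equiv hσ.toPerm _ _ fun z => rfl
    _ = _ := by
        rw [Fintype.sum_prod_type, Finset.mul_sum]
        simp

lemma sum_update_update (f : (N → W) → ℝ) (x y : N) :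
    ∑ φ, ∑ a, ∑ b, f (Function.update (Function.update φ x a) y b) =
      Fintype.card W ^ 2 * ∑ φ, f φ := by
  rw [sum_update (fun φ => ∑ b, f (Function.update φ y b)) x, sum_update]; ring

/-- Averaging over the value at `x` saves one power of |W|: it suffices to bound the sum with all
other values frozen. -/
lemma abs_sum_le_of_update (f : (N → W) → ℝ) (x : N) {B : ℝ}
    (h : ∀ φ, |∑ a, f (Function.update φ x a)| ≤ B) :
    Fintype.card W * |∑ φ, f φ| ≤ Fintype.card W ^ Fintype.card N * B := by
  rw [← Nat.abs_cast (Fintype.card W), ← abs_mul, ← sum_update f x, Nat.abs_cast]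
  refine (Finset.abs_sum_le_sum_abs _ _).trans ((Finset.sum_le_sum fun φ _ => h φ).trans ?_)
  rw [Finset.sum_const, Finset.card_univ, Fintype.card_fun, nsmul_eq_mul]
  push_cast
  exact le_rfl

lemma abs_sum_le_of_update_update (f : (N → W) → ℝ) (x y : N) {B : ℝ}
    (h : ∀ φ, |∑ a, ∑ b, f (Function.update (Function.update φ x a) y b)| ≤ B) :
    Fintype.card W ^ 2 * |∑ φ, f φ| ≤ Fintype.card W ^ Fintype.card N * B := by
  rw [← abs_of_nonneg (by positivity : (0 : ℝ) ≤ (Fintype.card W : ℝ) ^ 2), ← abs_mul,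
    ← sum_update_update f x y]
  refine (Finset.abs_sum_le_sum_abs _ _).trans ((Finset.sum_le_sum fun φ _ => h φ).trans ?_)
  rw [Finset.sum_const, Finset.card_univ, Fintype.card_fun, nsmul_eq_mul]
  push_cast
  exact le_rfl

variable [DecidableEq W]

/-- The maps `φ` that send each `v` to a common neighbour of `J v`, and the pairs in `F` to edges. -/
def IsHom (ω : Sym2 W → Bool) (J : N → Finset W) (F : Finset (Sym2 N)) (φ : N → W) : Prop :=
  (∀ v, AdjAll ω (J v) (φ v)) ∧ ∀ e ∈ F, ω (e.map φ) = true

/-- The number of maps that send each `v` to a common neighbour of `J v`, and the pairs in `F` to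
edges. -/
noncomputable def homCount (ω : Sym2 W → Bool) (J : N → Finset W) (F : Finset (Sym2 N)) : ℝ :=
  ∑ φ : N → W, ind (IsHom ω J F φ)

/-- The discrepancy of the number of edges between two common neighbourhoods. -/
noncomputable def pairDisc (p : ℝ) (ω : Sym2 W → Bool) (X Y : Finset W) : ℝ :=
  ∑ a, ∑ b, ind (AdjAll ω X a ∧ AdjAll ω Y b) * (ind (ω s(a, b) = true) - p)

/-- The number of vertices adjacent to all elements of `J`, with possible loops. -/
noncomputable def loopDeg (ω : Sym2 W → Bool) (J : Finset W) : ℝ := ∑ a, ind (AdjAll ω J a)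

omit [DecidableEq W] in
lemma homCount_empty (ω : Sym2 W → Bool) (J : N → Finset W) :
    homCount ω J ∅ = ∏ v, loopDeg ω (J v) := by
  simp only [loopDeg]
  rw [Finset.prod_univ_sum, Fintype.piFinset_univ, homCount]
  refine Finset.sum_congr rfl fun φ _ => ?_
  rw [← ind_forall]
  exact ind_congr (by simp [IsHom])

omit [Fintype W] in
/-- With all but two values of `φ` fixed, the conditions on the two other values separate. -/
lemma exists_isHom_update_iff (ω : Sym2 W → Bool) (J : N → Finset W) {F : Finset (Sym2 N)}
    (hF : ∀ e ∈ F, ¬ e.IsDiag) {x y : N} (hxy : x ≠ y) (he : s(x, y) ∉ F) (φ : N → W) :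
    ∃ X Y : Finset W, X.card ≤ (J x).card + Fintype.card N ∧ Y.card ≤ (J y).card + Fintype.card N ∧
      ∃ C : Prop, ∀ a b, IsHom ω J F (Function.update (Function.update φ x a) y b) ↔
        C ∧ AdjAll ω X a ∧ AdjAll ω Y b := by
  classical
  -- The new value at `x` must be adjacent to `J x` and to the frozen images of the `F`-neighbours
  -- of `x`, and likewise at `y`. No condition couples the two values because s(x, y) is not in `F`.
  refine ⟨J x ∪ (Finset.univ.filter fun z => s(z, x) ∈ F).image φ,
    J y ∪ (Finset.univ.filter fun z => s(z, y) ∈ F).image φ,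
    (Finset.card_union_le _ _).trans (Nat.add_le_add_left
      (Finset.card_image_le.trans (Finset.card_filter_le _ _)) _),
    (Finset.card_union_le _ _).trans (Nat.add_le_add_left
      (Finset.card_image_le.trans (Finset.card_filter_le _ _)) _),
    (∀ v, v ≠ x → v ≠ y → AdjAll ω (J v) (φ v)) ∧
      ∀ z z', z ≠ x → z ≠ y → z' ≠ x → z' ≠ y → s(z, z') ∈ F → ω s(φ z, φ z') = true, ?_⟩
  intro a b
  set ψ := Function.update (Function.update φ x a) y b with hψ
  have hx : ψ x = a := by simp [hψ, hxy]
  have hy : ψ y = b := by simp [hψ]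
  have ho : ∀ z, z ≠ x → z ≠ y → ψ z = φ z := fun z h1 h2 => by simp [hψ, h1, h2]
  have hFx : ∀ z, s(z, x) ∈ F → z ≠ x ∧ z ≠ y := fun z hz =>
    ⟨fun h => hF _ hz (by simpa using h), fun h => he (by rw [h] at hz; rwa [Sym2.eq_swap])⟩
  have hFy : ∀ z, s(z, y) ∈ F → z ≠ x ∧ z ≠ y := fun z hz =>
    ⟨fun h => he (by rwa [h] at hz), fun h => hF _ hz (by simpa using h)⟩
  simp only [adjAll_union, IsHom]
  constructor
  · rintro ⟨h1, h2⟩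
    refine ⟨⟨fun v hvx hvy => ?_, fun z z' hzx hzy hzx' hzy' hz => ?_⟩, ⟨?_, ?_⟩, ?_, ?_⟩
    · simpa [ho v hvx hvy] using h1 v
    · simpa [ho z hzx hzy, ho z' hzx' hzy'] using h2 _ hz
    · simpa [hx] using h1 x
    · intro u hu
      obtain ⟨z, hz, rfl⟩ := Finset.mem_image.1 hu
      have hz := (Finset.mem_filter.1 hz).2
      simpa [hx, ho z (hFx z hz).1 (hFx z hz).2] using h2 _ hz
    · simpa [hy] using h1 y
    · intro u hu
      obtain ⟨z, hz, rfl⟩ := Finset.mem_image.1 hu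
      have hz := (Finset.mem_filter.1 hz).2
      simpa [hy, ho z (hFy z hz).1 (hFy z hz).2] using h2 _ hz
  · rintro ⟨⟨h1, h2⟩, ⟨h3, h4⟩, h5, h6⟩
    have hxe : ∀ z, s(z, x) ∈ F → ω s(ψ z, ψ x) = true := fun z hz => by
      rw [hx, ho z (hFx z hz).1 (hFx z hz).2]
      exact h4 _ (Finset.mem_image_of_mem _ (Finset.mem_filter.2 ⟨Finset.mem_univ _, hz⟩))
    have hye : ∀ z, s(z, y) ∈ F → ω s(ψ z, ψ y) = true := fun z hz => by
      rw [hy, ho z (hFy z hz).1 (hFy z hz).2]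
      exact h6 _ (Finset.mem_image_of_mem _ (Finset.mem_filter.2 ⟨Finset.mem_univ _, hz⟩))
    refine ⟨fun v => ?_, fun e heF => ?_⟩
    · by_cases hvx : v = x
      · rw [hvx, hx]; exact h3
      by_cases hvy : v = y
      · rw [hvy, hy]; exact h5
      rw [ho v hvx hvy]; exact h1 v hvx hvy
    · induction e with | _ z z' => ?_
      rw [Sym2.map_mk]
      by_cases h7 : z' = x
      · rw [h7] at heF ⊢; exact hxe z heF
      by_cases h8 : z' = y
      · rw [h8] at heF ⊢; exact hye z heF
      by_cases h9 : z = x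
      · rw [h9] at heF ⊢; rw [Sym2.eq_swap] at heF ⊢; exact hxe z' heF
      by_cases h10 : z = y
      · rw [h10] at heF ⊢; rw [Sym2.eq_swap] at heF ⊢; exact hye z' heF
      rw [ho z h9 h10, ho z' h7 h8]
      exact h2 z z' h9 h10 h7 h8 heF

/-- Adding an edge to the pattern multiplies the count by about `p`. -/
lemma abs_homCount_insert_sub_le {p : ℝ} {ω : Sym2 W → Bool} {L : ℕ} {B : ℝ}
    (hB : ∀ X Y : Finset W, X.card ≤ L → Y.card ≤ L → |pairDisc p ω X Y| ≤ B)
    {J : N → Finset W} (hJ : ∀ v, (J v).card + Fintype.card N ≤ L) {F : Finset (Sym2 N)}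
    (hF : ∀ e ∈ F, ¬ e.IsDiag) {e : Sym2 N} (hed : ¬ e.IsDiag) (he : e ∉ F) :
    Fintype.card W ^ 2 * |homCount ω J (insert e F) - p * homCount ω J F| ≤
      Fintype.card W ^ Fintype.card N * B := by
  induction e with | _ x y => ?_
  have hxy : x ≠ y := fun h => hed (by simpa using h)
  -- The difference weights each map by the centred indicator of the new edge. With all values but
  -- those at `x` and `y` frozen, the sum is either zero or a discrepancy between two common
  -- neighbourhoods.
  have h1 : homCount ω J (insert s(x, y) F) - p * homCount ω J F =
      ∑ φ : N → W, ind (IsHom ω J F φ) * (ind (ω s(φ x, φ y) = true) - p) := by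
    rw [homCount, homCount, Finset.mul_sum, ← Finset.sum_sub_distrib]
    refine Finset.sum_congr rfl fun φ _ => ?_
    have : IsHom ω J (insert s(x, y) F) φ ↔ IsHom ω J F φ ∧ ω s(φ x, φ y) = true := by
      simp only [IsHom, Finset.mem_insert, forall_eq_or_imp, Sym2.map_mk]
      tauto
    rw [ind_congr this, ind_and]; ring
  rw [h1]
  refine abs_sum_le_of_update_update _ x y fun φ => ?_
  obtain ⟨X, Y, hX, hY, C, hC⟩ := exists_isHom_update_iff ω J hF hxy he φ
  have h2 : ∑ a, ∑ b, ind (IsHom ω J F (Function.update (Function.update φ x a) y b)) *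
      (ind (ω s(Function.update (Function.update φ x a) y b x,
        Function.update (Function.update φ x a) y b y) = true) - p) =
      ind C * pairDisc p ω X Y := by
    simp only [pairDisc, Finset.mul_sum]
    refine Finset.sum_congr rfl fun a _ => Finset.sum_congr rfl fun b _ => ?_
    rw [ind_congr (hC a b), ind_and]
    simp [hxy, mul_assoc]
  rw [h2, abs_mul, abs_of_nonneg (ind_nonneg C)]
  have h3 := hB X Y (hX.trans (hJ x)) (hY.trans (hJ y))
  exact (mul_le_of_le_one_left (abs_nonneg _) (ind_le_one C)).trans h3

/-- The number of homomorphisms in a quasirandom configuration. -/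
lemma abs_homCount_sub_le {p : ℝ} (hp : p ∈ Set.Icc (0 : ℝ) 1) {ω : Sym2 W → Bool} {L : ℕ} {B : ℝ}
    (hB : ∀ X Y : Finset W, X.card ≤ L → Y.card ≤ L → |pairDisc p ω X Y| ≤ B)
    {J : N → Finset W} (hJ : ∀ v, (J v).card + Fintype.card N ≤ L) {F : Finset (Sym2 N)}
    (hF : ∀ e ∈ F, ¬ e.IsDiag) :
    Fintype.card W ^ 2 * |homCount ω J F - p ^ F.card * ∏ v, loopDeg ω (J v)| ≤
      F.card * (Fintype.card W ^ Fintype.card N * B) := by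
  induction F using Finset.induction_on with
  | empty => simp [homCount_empty]
  | insert e F he ih =>
    have h1 := abs_homCount_insert_sub_le hB hJ (fun e h => hF e (Finset.mem_insert_of_mem h))
      (hF e (Finset.mem_insert_self _ _)) he
    have h2 := ih fun e h => hF e (Finset.mem_insert_of_mem h)
    rw [Finset.card_insert_of_notMem he, pow_succ p]
    have h3 : homCount ω J (insert e F) - p ^ F.card * p * ∏ v, loopDeg ω (J v) =
        (homCount ω J (insert e F) - p * homCount ω J F) +
        p * (homCount ω J F - p ^ F.card * ∏ v, loopDeg ω (J v)) := by ring
    have h4 : |homCount ω J (insert e F) - p ^ F.card * p * ∏ v, loopDeg ω (J v)| ≤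
        |homCount ω J (insert e F) - p * homCount ω J F| +
        |homCount ω J F - p ^ F.card * ∏ v, loopDeg ω (J v)| := by
      rw [h3]
      refine (abs_add_le _ _).trans (add_le_add_right ?_ _)
      rw [abs_mul, abs_of_nonneg hp.1]
      exact mul_le_of_le_one_left (abs_nonneg _) hp.2
    have h5 : (0 : ℝ) ≤ (Fintype.card W : ℝ) ^ 2 := by positivity
    push_cast
    have h6 := mul_le_mul_of_nonneg_left h4 h5
    rw [mul_add] at h6
    linarith

end Counting

/-! ### Concentration of codegrees and of edge discrepancies. -/

section Concentration

open Topology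

/-- A two-sided Chernoff bound for a weighted sum of centered indicators of independent events. -/
lemma pr_abs_sum_ge_le {E α : Type*} [Fintype E] [DecidableEq E] {p : ℝ}
    (hp : p ∈ Set.Icc (0 : ℝ) 1) (s : Finset α) {A : α → (E → Bool) → Prop} {Q : α → Set E}
    (hdep : ∀ v ∈ s, DependsOn (A v) (Q v)) (hQ : (s : Set α).PairwiseDisjoint Q) {q : ℝ}
    (hA : ∀ v ∈ s, pr p (A v) = q) {c : α → ℝ} (hc : ∀ v ∈ s, |c v| ≤ 2) {x : ℝ} (hx0 : 0 ≤ x)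
    (hx : x ≤ 1 / 8) (t : ℝ) :
    pr p (fun ω => t ≤ x * |∑ v ∈ s, c v * (ind (A v ω) - q)|) ≤
      2 * Real.exp (-t + s.card * (2 * x ^ 2 + 64 * x ^ 3)) := by
  rcases s.eq_empty_or_nonempty with rfl | ⟨v₀, hv₀⟩
  · simp only [Finset.sum_empty, abs_zero, mul_zero, Finset.card_empty, Nat.cast_zero, zero_mul,
      add_zero]
    by_cases ht : t ≤ 0
    · have := pr_le_one hp (fun _ : E → Bool => t ≤ 0)
      have h2 := Real.one_le_exp (x := -t) (by linarith)
      linarith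
    · simp only [pr, ind_of_false ht, ex_const]; positivity
  have hqI : 0 ≤ q ∧ q ≤ 1 := by rw [← hA v₀ hv₀]; exact ⟨pr_nonneg hp _, pr_le_one hp _⟩
  have hi : ∀ v ω, |ind (A v ω) - q| ≤ 1 := fun v ω =>
    abs_le.2 ⟨by linarith [ind_nonneg (A v ω)], by linarith [ind_le_one (A v ω)]⟩
  have key : ∀ σ : ℝ, |σ| ≤ 1 → pr p (fun ω => t ≤ ∑ v ∈ s, σ * x * c v * (ind (A v ω) - q)) ≤
      Real.exp (-t + s.card * (2 * x ^ 2 + 64 * x ^ 3)) := by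
    intro σ hσ
    have hY : ∀ v ∈ s, ∀ ω, |σ * x * c v * (ind (A v ω) - q)| ≤ 2 * x := fun v hv ω => by
      rw [abs_mul, abs_mul, abs_mul, abs_of_nonneg hx0]
      calc |σ| * x * |c v| * |ind (A v ω) - q| ≤ 1 * x * 2 * 1 := by
            have := hc v hv; have := hi v ω; gcongr
        _ = 2 * x := by ring
    have hμ : ∀ v ∈ s, ex p (fun ω => σ * x * c v * (ind (A v ω) - q)) = 0 := fun v hv => by
      rw [ex_const_mul, ex_sub, ex_const]
      have := hA v hv
      rw [pr] at this
      rw [this, sub_self, mul_zero]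
    have h := pr_sum_ge_le hp s (Y := fun v ω => σ * x * c v * (ind (A v ω) - q)) (Q := Q)
      (τ := 2 * x) (μ := 0) (V := 4 * x ^ 2) (t := t)
      (fun v hv a b hab => by dsimp only; rw [hdep v hv hab]) hQ (by linarith) hY hμ (fun v hv => by
        have h1 : ex p (fun ω => (σ * x * c v * (ind (A v ω) - q)) ^ 2) ≤
            ex p fun _ => 4 * x ^ 2 := ex_mono hp fun ω => by
          have := hY v hv ω
          rw [← sq_abs]
          calc _ ≤ (2 * x) ^ 2 := pow_le_pow_left₀ (abs_nonneg _) this 2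
            _ = _ := by ring
        rw [ex_const] at h1
        linarith)
    refine h.trans (le_of_eq ?_)
    congr 1; ring
  calc _ ≤ pr p (fun ω => t ≤ ∑ v ∈ s, 1 * x * c v * (ind (A v ω) - q) ∨
        t ≤ ∑ v ∈ s, -1 * x * c v * (ind (A v ω) - q)) := by
        refine pr_mono hp fun ω hω => ?_
        have h1 : ∀ σ : ℝ, ∑ v ∈ s, σ * x * c v * (ind (A v ω) - q) =
            x * (σ * ∑ v ∈ s, c v * (ind (A v ω) - q)) := fun σ => by
          rw [Finset.mul_sum, Finset.mul_sum]
          exact Finset.sum_congr rfl fun v _ => by ring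
        rw [h1, h1]
        rcases abs_choice (∑ v ∈ s, c v * (ind (A v ω) - q)) with h | h
        · left; rwa [h, ← one_mul (∑ v ∈ s, c v * (ind (A v ω) - q))] at hω
        · right; rwa [h, neg_eq_neg_one_mul] at hω
    _ ≤ _ := pr_or_le hp _ _
    _ ≤ _ := by
        have h1 := key 1 (by simp)
        have h2 := key (-1) (by simp)
        linarith

variable {W : Type*} [Fintype W] [DecidableEq W] {p : ℝ}

lemma pr_eq_true (p : ℝ) (e : Sym2 W) : pr p (fun ω : Sym2 W → Bool => ω e = true) = p := by
  have h := pr_forall_mem p ({e} : Finset (Sym2 W))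
  simpa using h

/-- The discrepancy of the number of edges between two fixed sets of vertices. -/
lemma pr_abs_sum_edges_ge_le (hp : p ∈ Set.Icc (0 : ℝ) 1) (P Q : Finset W) {x : ℝ} (hx0 : 0 ≤ x)
    (hx : x ≤ 1 / 8) (t : ℝ) :
    pr p (fun ω => t ≤ x * |∑ a ∈ P, ∑ b ∈ Q, (ind (ω s(a, b) = true) - p)|) ≤
      2 * Real.exp (-t + Fintype.card W ^ 2 * (2 * x ^ 2 + 64 * x ^ 3)) := by
  -- The number of ordered pairs in P × Q over a given unordered pair. It is at most 2, which is the
  -- bound on the weights in `pr_abs_sum_ge_le`.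
  set c : Sym2 W → ℝ := fun e => ((P ×ˢ Q).filter fun z => s(z.1, z.2) = e).card with hc
  have h1 : ∀ ω : Sym2 W → Bool, ∑ a ∈ P, ∑ b ∈ Q, (ind (ω s(a, b) = true) - p) =
      ∑ e, c e * (ind (ω e = true) - p) := fun ω => by
    rw [← Finset.sum_product', ← Finset.sum_fiberwise_of_maps_to (s := P ×ˢ Q) (t := Finset.univ)
      (g := fun z => s(z.1, z.2)) fun _ _ => Finset.mem_univ _]
    refine Finset.sum_congr rfl fun e _ => ?_
    rw [hc, ← nsmul_eq_mul, ← Finset.sum_const]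
    exact Finset.sum_congr rfl fun z hz => by rw [(Finset.mem_filter.1 hz).2]
  have hc2 : ∀ e, |c e| ≤ 2 := fun e => by
    rw [hc, Nat.abs_cast]
    induction e with | _ a b => ?_
    have : ((P ×ˢ Q).filter fun z => s(z.1, z.2) = s(a, b)) ⊆ {(a, b), (b, a)} := fun z hz => by
      have := (Finset.mem_filter.1 hz).2
      rw [Sym2.eq_iff] at this
      rcases this with ⟨h1, h2⟩ | ⟨h1, h2⟩ <;> simp [Prod.ext_iff, h1, h2]
    have h2 := (Finset.card_le_card this).trans Finset.card_le_two
    exact_mod_cast h2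
  simp only [h1]
  refine (pr_abs_sum_ge_le hp Finset.univ (A := fun e ω => ω e = true) (Q := fun e => {e})
    (fun e _ a b hab => by dsimp only; rw [hab e rfl]) (fun e _ e' _ hee => by simpa using hee)
    (fun e _ => pr_eq_true p e) (fun e _ => hc2 e) hx0 hx t).trans ?_
  gcongr
  rw [Finset.card_univ, Sym2.card]
  have h3 : ((Fintype.card W + 1).choose 2) ≤ Fintype.card W ^ 2 := by
    rw [Nat.choose_two_right, Nat.add_sub_cancel]
    refine Nat.div_le_of_le_mul ?_
    nlinarith [Nat.zero_le (Fintype.card W), Nat.le_self_pow two_ne_zero (Fintype.card W)]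
  exact_mod_cast h3

lemma abs_ind_mul_le (hp : p ∈ Set.Icc (0 : ℝ) 1) (P Q : Prop) : |ind P * (ind Q - p)| ≤ 1 := by
  rw [abs_mul, abs_of_nonneg (ind_nonneg P)]
  refine mul_le_one₀ (ind_le_one P) (abs_nonneg _) (abs_le.2 ⟨?_, ?_⟩)
  · linarith [ind_nonneg Q, hp.2]
  · linarith [ind_le_one Q, hp.1]

/-- Discarding the rows and columns indexed by `Z` removes at most 2|Z||W| terms, each bounded by 1
in absolute value. -/
lemma abs_pairDisc_sub_le (hp : p ∈ Set.Icc (0 : ℝ) 1) (ω : Sym2 W → Bool) (X Y Z : Finset W) :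
    |pairDisc p ω X Y - ∑ a ∈ Zᶜ.filter (AdjAll ω X), ∑ b ∈ Zᶜ.filter (AdjAll ω Y),
      (ind (ω s(a, b) = true) - p)| ≤ 2 * Z.card * Fintype.card W := by
  set h : W → W → ℝ := fun a b => ind (AdjAll ω X a ∧ AdjAll ω Y b) * (ind (ω s(a, b) = true) - p)
    with hh
  have hle : ∀ a b, |h a b| ≤ 1 := fun a b => abs_ind_mul_le hp _ _
  have h1 : ∑ a ∈ Zᶜ.filter (AdjAll ω X), ∑ b ∈ Zᶜ.filter (AdjAll ω Y),
      (ind (ω s(a, b) = true) - p) = ∑ a ∈ Zᶜ, ∑ b ∈ Zᶜ, h a b := by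
    rw [Finset.sum_filter]
    refine Finset.sum_congr rfl fun a _ => ?_
    rw [Finset.sum_filter]
    split_ifs with ha
    · refine Finset.sum_congr rfl fun b _ => ?_
      split_ifs with hb
      · rw [hh]; dsimp only; rw [ind_of_true (P := AdjAll ω X a ∧ AdjAll ω Y b) ⟨ha, hb⟩, one_mul]
      · rw [hh]; dsimp only; rw [ind_of_false fun h => hb h.2, zero_mul]
    · exact (Finset.sum_eq_zero fun b _ => by
        rw [hh]; dsimp only; rw [ind_of_false fun h => ha h.1, zero_mul]).symm
  have h2 : pairDisc p ω X Y - ∑ a ∈ Zᶜ, ∑ b ∈ Zᶜ, h a b =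
      ∑ a ∈ Z, ∑ b, h a b + ∑ a ∈ Zᶜ, ∑ b ∈ Z, h a b := by
    have h3 : pairDisc p ω X Y = ∑ a, ∑ b, h a b := rfl
    rw [h3, ← Finset.sum_add_sum_compl Z]
    have h4 : ∀ a, ∑ b, h a b = ∑ b ∈ Z, h a b + ∑ b ∈ Zᶜ, h a b := fun a =>
      (Finset.sum_add_sum_compl Z _).symm
    rw [Finset.sum_congr rfl fun a (_ : a ∈ Zᶜ) => h4 a, Finset.sum_add_distrib]
    ring
  rw [h1, h2]
  have h5 : ∀ s t : Finset W, |∑ a ∈ s, ∑ b ∈ t, h a b| ≤ s.card * t.card := fun s t => by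
    refine (Finset.abs_sum_le_sum_abs _ _).trans ((Finset.sum_le_sum fun a _ =>
      (Finset.abs_sum_le_sum_abs _ _).trans (Finset.sum_le_sum fun b _ => hle a b)).trans ?_)
    simp
  have h6 : (Zᶜ.card : ℝ) ≤ Fintype.card W := by exact_mod_cast Finset.card_le_univ Zᶜ
  have h7 := h5 Z Finset.univ
  rw [Finset.card_univ] at h7
  calc _ ≤ _ := abs_add_le _ _
    _ ≤ _ := add_le_add h7 (h5 Zᶜ Z)
    _ ≤ _ := by nlinarith [Nat.cast_nonneg (α := ℝ) Z.card]

/-- The discrepancy between common neighbourhoods is small. -/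
lemma pr_abs_pairDisc_ge_le (hp : p ∈ Set.Icc (0 : ℝ) 1) (X Y : Finset W) {x : ℝ} (hx0 : 0 ≤ x)
    (hx : x ≤ 1 / 8) (t : ℝ) :
    pr p (fun ω => t ≤ x * (|pairDisc p ω X Y| - 2 * (X ∪ Y).card * Fintype.card W)) ≤
      2 * Real.exp (-t + Fintype.card W ^ 2 * (2 * x ^ 2 + 64 * x ^ 3)) := by
  set Z := X ∪ Y with hZ
  have h1 : ∀ ω, t ≤ x * (|pairDisc p ω X Y| - 2 * Z.card * Fintype.card W) →
      t ≤ x * |∑ a ∈ Zᶜ.filter (AdjAll ω X), ∑ b ∈ Zᶜ.filter (AdjAll ω Y),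
      (ind (ω s(a, b) = true) - p)| := fun ω h => by
    refine h.trans (mul_le_mul_of_nonneg_left ?_ hx0)
    have h2 := abs_pairDisc_sub_le hp ω X Y Z
    have h3 := abs_sub_abs_le_abs_sub (pairDisc p ω X Y) (∑ a ∈ Zᶜ.filter (AdjAll ω X),
      ∑ b ∈ Zᶜ.filter (AdjAll ω Y), (ind (ω s(a, b) = true) - p))
    linarith
  refine (pr_mono hp h1).trans ?_
  unfold pr
  -- Exposing the pairs that touch X ∪ Y fixes the two common neighbourhoods outside it. The edges
  -- between them are still fresh, so the bound for fixed sets applies conditionally.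
  rw [ex_merge p (touching Z)]
  refine (ex_mono hp (g := fun _ => 2 * Real.exp (-t + Fintype.card W ^ 2 *
    (2 * x ^ 2 + 64 * x ^ 3))) fun ω => ?_).trans (le_of_eq (ex_const p _))
  refine le_trans (le_of_eq ?_) (pr_abs_sum_edges_ge_le hp (Zᶜ.filter (AdjAll ω X))
    (Zᶜ.filter (AdjAll ω Y)) hx0 hx t)
  refine pr_congr fun ω' => ?_
  have h4 : ∀ J ⊆ Z, Zᶜ.filter (AdjAll (merge (touching Z) ω ω') J) = Zᶜ.filter (AdjAll ω J) :=
    fun J hJ => Finset.filter_congr fun v _ => adjAll_merge_of_subset hJ ω ω' v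
  beta_reduce
  rw [h4 X Finset.subset_union_left, h4 Y Finset.subset_union_right]
  have h5 : ∑ a ∈ Zᶜ.filter (AdjAll ω X), ∑ b ∈ Zᶜ.filter (AdjAll ω Y),
      (ind (merge (touching Z) ω ω' s(a, b) = true) - p) =
      ∑ a ∈ Zᶜ.filter (AdjAll ω X), ∑ b ∈ Zᶜ.filter (AdjAll ω Y), (ind (ω' s(a, b) = true) - p) := by
    refine Finset.sum_congr rfl fun a ha => Finset.sum_congr rfl fun b hb => ?_
    rw [merge_of_notMem]
    rintro ⟨u, hu, hue⟩
    rcases Sym2.mem_iff.1 hue with rfl | rfl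
    · exact Finset.mem_compl.1 (Finset.mem_filter.1 ha).1 hu
    · exact Finset.mem_compl.1 (Finset.mem_filter.1 hb).1 hu
  rw [h5]

/-- The number of common neighbours of a set is close to its mean. -/
lemma pr_abs_codeg_sub_ge_le (hp : p ∈ Set.Icc (0 : ℝ) 1) (C : Finset W) {x : ℝ} (hx0 : 0 ≤ x)
    (hx : x ≤ 1 / 8) (t : ℝ) :
    pr p (fun ω => t ≤ x * (|(codeg ω C : ℝ) - Fintype.card W * p ^ C.card| - C.card)) ≤
      2 * Real.exp (-t + Fintype.card W * (2 * x ^ 2 + 64 * x ^ 3)) := by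
  classical
  have hq : p ^ C.card ∈ Set.Icc (0 : ℝ) 1 := ⟨pow_nonneg hp.1 _, pow_le_one₀ hp.1 hp.2⟩
  have h1 : ∀ ω, t ≤ x * (|(codeg ω C : ℝ) - Fintype.card W * p ^ C.card| - C.card) →
      t ≤ x * |∑ v ∈ Cᶜ, 1 * (ind (AdjAll ω C v) - p ^ C.card)| := fun ω h => by
    refine h.trans (mul_le_mul_of_nonneg_left ?_ hx0)
    have h2 : ∑ v ∈ Cᶜ, 1 * (ind (AdjAll ω C v) - p ^ C.card) =
        codeg ω C - Cᶜ.card * p ^ C.card := by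
      simp only [one_mul]
      rw [Finset.sum_sub_distrib, codeg, outDeg, card_filter_eq_sum_ind, Finset.sum_const,
        nsmul_eq_mul]
    have h3 : (Fintype.card W : ℝ) = C.card + Cᶜ.card := by
      exact_mod_cast (Finset.card_add_card_compl C).symm
    rw [h2, h3]
    have h4 : (codeg ω C : ℝ) - (C.card + Cᶜ.card) * p ^ C.card =
      (codeg ω C - Cᶜ.card * p ^ C.card) - C.card * p ^ C.card := by ring
    rw [h4]
    have h5 := abs_sub ((codeg ω C : ℝ) - Cᶜ.card * p ^ C.card) (C.card * p ^ C.card)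
    have h6 : |(C.card : ℝ) * p ^ C.card| ≤ C.card := by
      rw [abs_of_nonneg (mul_nonneg (Nat.cast_nonneg _) hq.1)]
      exact mul_le_of_le_one_right (Nat.cast_nonneg _) hq.2
    linarith
  refine (pr_mono hp h1).trans ?_
  refine (pr_abs_sum_ge_le hp Cᶜ (A := fun v ω => AdjAll ω C v) (Q := fun v => star C v)
    (fun v _ => dependsOn_adjAll C v)
    (fun v hv v' _ hvv => disjoint_star (Finset.mem_compl.1 hv) (Or.inl hvv))
    (fun v _ => pr_adjAll p C v) (c := fun _ => 1) (fun v _ => by norm_num) hx0 hx t).trans ?_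
  gcongr
  exact Finset.card_le_univ _

end Concentration

/-! ### All bounded-size sets behave regularly with high probability. -/

section Regularity

open Topology

/-- The eighth root of `n`. -/
noncomputable def eighthRoot (n : ℕ) : ℝ := (n : ℝ) ^ ((1 : ℝ) / 8)

lemma eighthRoot_pow (n : ℕ) : eighthRoot n ^ 8 = n := by
  rw [eighthRoot, ← Real.rpow_natCast, ← Real.rpow_mul (Nat.cast_nonneg n)]
  norm_num

lemma tendsto_eighthRoot : Tendsto eighthRoot atTop atTop :=
  (tendsto_rpow_atTop (by norm_num)).comp tendsto_natCast_atTop_atTop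

/-- All small sets have about the expected numbers of common neighbours, and of edges between their
common neighbourhoods. -/
def Regular (p : ℝ) (L : ℕ) {n : ℕ} (ω : Sym2 (Fin n) → Bool) : Prop :=
  (∀ X Y : Finset (Fin n), X.card ≤ L → Y.card ≤ L →
    |pairDisc p ω X Y| ≤ eighthRoot n ^ 10 + 4 * L * eighthRoot n ^ 8) ∧
  ∀ C : Finset (Fin n), C.card ≤ L →
    |(codeg ω C : ℝ) - n * p ^ C.card| ≤ eighthRoot n ^ 5 + L

lemma card_filter_card_le (n L : ℕ) (hn : 0 < n) :
    ((Finset.univ : Finset (Finset (Fin n))).filter fun X => X.card ≤ L).card ≤ (L + 1) * n ^ L := by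
  have h : (Finset.univ : Finset (Finset (Fin n))).filter (fun X => X.card ≤ L) ⊆
      (Finset.range (L + 1)).biUnion fun j => Finset.univ.powersetCard j := fun X hX => by
    simp only [Finset.mem_filter, Finset.mem_univ, true_and] at hX
    simp only [Finset.mem_biUnion, Finset.mem_range, Finset.mem_powersetCard, Finset.subset_univ,
      true_and]
    exact ⟨X.card, Nat.lt_succ_of_le hX, rfl⟩
  refine (Finset.card_le_card h).trans (Finset.card_biUnion_le.trans ?_)
  calc _ ≤ ∑ j ∈ Finset.range (L + 1), n ^ L := by
        refine Finset.sum_le_sum fun j hj => ?_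
        rw [Finset.card_powersetCard, Finset.card_univ, Fintype.card_fin]
        exact (Nat.choose_le_pow n j).trans
          (Nat.pow_le_pow_right hn (Nat.lt_succ_iff.1 (Finset.mem_range.1 hj)))
    _ = _ := by simp

/-- A union bound: there are polynomially many sets and pairs of sets in n, and each fails with
probability O(exp(-n^{1/8})). -/
lemma tendsto_pr_not_regular {p : ℝ} (hp : p ∈ Set.Icc (0 : ℝ) 1) (L : ℕ) :
    Tendsto (fun n => pr p fun ω : Sym2 (Fin n) → Bool => ¬ Regular p L ω) atTop (𝓝 0) := by
  classical
  have hlim : Tendsto (fun n : ℕ => 4 * (L + 1) ^ 2 * Real.exp 66 *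
      (eighthRoot n ^ (16 * L) * Real.exp (-eighthRoot n))) atTop (𝓝 0) := by
    have := ((Real.tendsto_pow_mul_exp_neg_atTop_nhds_zero (16 * L)).comp
      tendsto_eighthRoot).const_mul (4 * (L + 1) ^ 2 * Real.exp 66)
    rwa [mul_zero] at this
  refine squeeze_zero' (Eventually.of_forall fun n => pr_nonneg hp _) ?_ hlim
  filter_upwards [tendsto_eighthRoot.eventually_ge_atTop 2] with n hy
  set y := eighthRoot n with hydef
  have hy0 : 0 < y := by linarith
  have hyn : y ^ 8 = n := eighthRoot_pow n
  have hn0 : 0 < n := by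
    have : (0 : ℝ) < n := by rw [← hyn]; positivity
    exact_mod_cast this
  set S := (Finset.univ : Finset (Finset (Fin n))).filter fun X => X.card ≤ L with hS
  have hy4 : (8 : ℝ) ≤ y ^ 4 := by
    calc (8 : ℝ) ≤ 2 ^ 4 := by norm_num
      _ ≤ y ^ 4 := by gcongr
  have hy8 : (8 : ℝ) ≤ y ^ 8 := by
    calc (8 : ℝ) ≤ 2 ^ 8 := by norm_num
      _ ≤ y ^ 8 := by gcongr
  -- With `y` the eighth root of n, the parameter 1/n = y⁻⁸ keeps n²(2x² + 64x³) at most 66, and a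
  -- discrepancy beyond y¹⁰ yields exponent y² ≥ y. For codegrees in `hB`, y⁻⁴ and y⁵ play the same
  -- roles.
  have hA : ∀ X ∈ S, ∀ Y ∈ S, pr p (fun ω : Sym2 (Fin n) → Bool =>
      ¬ |pairDisc p ω X Y| ≤ y ^ 10 + 4 * L * y ^ 8) ≤ 2 * Real.exp (66 - y) := by
    intro X hX Y hY
    have hX := (Finset.mem_filter.1 hX).2
    have hY := (Finset.mem_filter.1 hY).2
    refine le_trans (pr_mono hp fun ω hω => ?_) ((pr_abs_pairDisc_ge_le hp X Y
      (x := (y ^ 8)⁻¹) (by positivity) ?_ (y ^ 2)).trans ?_)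
    · rw [not_le] at hω
      rw [le_inv_mul_iff₀ (by positivity), Fintype.card_fin, ← hyn]
      have h1 : ((X ∪ Y).card : ℝ) ≤ 2 * L := by
        have := Finset.card_union_le X Y
        exact_mod_cast (by omega : (X ∪ Y).card ≤ 2 * L)
      have h2 : 0 < y ^ 8 := by positivity
      nlinarith [mul_le_mul_of_nonneg_right h1 h2.le]
    · rw [inv_le_comm₀ (by positivity) (by norm_num)]; norm_num; exact hy8
    · rw [Fintype.card_fin, ← hyn]
      gcongr
      have h1 : (y ^ 8) ^ 2 * (2 * (y ^ 8)⁻¹ ^ 2 + 64 * (y ^ 8)⁻¹ ^ 3) = 2 + 64 * (y ^ 8)⁻¹ := by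
        field_simp
      have h2 : (y ^ 8)⁻¹ ≤ 1 := inv_le_one_of_one_le₀ (by linarith)
      rw [h1]
      nlinarith
  have hB : ∀ C ∈ S, pr p (fun ω : Sym2 (Fin n) → Bool =>
      ¬ |(codeg ω C : ℝ) - n * p ^ C.card| ≤ y ^ 5 + L) ≤ 2 * Real.exp (66 - y) := by
    intro C hC
    have hC := (Finset.mem_filter.1 hC).2
    refine le_trans (pr_mono hp fun ω hω => ?_) ((pr_abs_codeg_sub_ge_le hp C
      (x := (y ^ 4)⁻¹) (by positivity) ?_ y).trans ?_)
    · rw [not_le] at hω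
      rw [le_inv_mul_iff₀ (by positivity), Fintype.card_fin]
      have h1 : (C.card : ℝ) ≤ L := by exact_mod_cast hC
      calc y ^ 4 * y = y ^ 5 := by ring
        _ ≤ _ := by linarith
    · rw [inv_le_comm₀ (by positivity) (by norm_num)]; norm_num; exact hy4
    · rw [Fintype.card_fin, ← hyn]
      gcongr
      have h1 : y ^ 8 * (2 * (y ^ 4)⁻¹ ^ 2 + 64 * (y ^ 4)⁻¹ ^ 3) = 2 + 64 * (y ^ 4)⁻¹ := by
        field_simp
      have h2 : (y ^ 4)⁻¹ ≤ 1 := inv_le_one_of_one_le₀ (by linarith)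
      rw [h1]
      linarith
  have hSc : (S.card : ℝ) ≤ (L + 1) * y ^ (8 * L) := by
    rw [pow_mul, hyn]
    exact_mod_cast card_filter_card_le n L hn0
  calc pr p (fun ω : Sym2 (Fin n) → Bool => ¬ Regular p L ω)
      ≤ pr p (fun ω : Sym2 (Fin n) → Bool => (∃ z ∈ S ×ˢ S,
          ¬ |pairDisc p ω z.1 z.2| ≤ y ^ 10 + 4 * L * y ^ 8) ∨
          ∃ C ∈ S, ¬ |(codeg ω C : ℝ) - n * p ^ C.card| ≤ y ^ 5 + L) := by
        refine pr_mono hp fun ω hω => ?_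
        rw [Regular, not_and_or] at hω
        rcases hω with hω | hω
        · push Not at hω
          obtain ⟨X, Y, hX, hY, h⟩ := hω
          exact Or.inl ⟨(X, Y), by simp [hS, hX, hY], not_le.2 h⟩
        · push Not at hω
          obtain ⟨C, hC, h⟩ := hω
          exact Or.inr ⟨C, by simp [hS, hC], not_le.2 h⟩
    _ ≤ _ := pr_or_le hp _ _
    _ ≤ ∑ z ∈ S ×ˢ S, 2 * Real.exp (66 - y) + ∑ C ∈ S, 2 * Real.exp (66 - y) := by
        refine add_le_add ((pr_exists_mem_le hp _ _).trans (Finset.sum_le_sum fun z hz => ?_))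
          ((pr_exists_mem_le hp _ _).trans (Finset.sum_le_sum hB))
        exact hA z.1 (Finset.mem_product.1 hz).1 z.2 (Finset.mem_product.1 hz).2
    _ = ((S.card : ℝ) ^ 2 + S.card) * (2 * Real.exp (66 - y)) := by
        rw [Finset.sum_const, Finset.sum_const, Finset.card_product, nsmul_eq_mul, nsmul_eq_mul]
        push_cast; ring
    _ ≤ (2 * ((L + 1) * y ^ (8 * L)) ^ 2) * (2 * Real.exp (66 - y)) := by
        have h1 : (1 : ℝ) ≤ (L + 1) * y ^ (8 * L) := by
          have h2 : (1 : ℝ) ≤ y ^ (8 * L) := one_le_pow₀ (by linarith)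
          have h3 : (0 : ℝ) ≤ L := Nat.cast_nonneg L
          nlinarith
        gcongr
        have h2 : (S.card : ℝ) ^ 2 ≤ ((L + 1) * y ^ (8 * L)) ^ 2 := by gcongr
        nlinarith
    _ = _ := by
        rw [sub_eq_add_neg, Real.exp_add, mul_pow, ← pow_mul]
        ring_nf

end Regularity

/-! ### First-order expansion of products. -/

section Linearization

/-- A first-order expansion of a product. -/
lemma abs_prod_add_sub_le {ι : Type*} [DecidableEq ι] (s : Finset ι) {x e : ι → ℝ} {δ : ℝ}
    (hδ1 : δ ≤ 1) (hx : ∀ v ∈ s, |x v| ≤ 1) (he : ∀ v ∈ s, |e v| ≤ δ) :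
    |∏ v ∈ s, (x v + e v) - ∏ v ∈ s, x v - ∑ v ∈ s, e v * ∏ u ∈ s.erase v, x u| ≤
      4 ^ s.card * δ ^ 2 := by
  induction s using Finset.induction_on with
  | empty => simp; positivity
  | insert a s ha ih =>
    have hδ0 : 0 ≤ δ := (abs_nonneg _).trans (he a (Finset.mem_insert_self _ _))
    have ih := ih (fun v hv => hx v (Finset.mem_insert_of_mem hv))
      fun v hv => he v (Finset.mem_insert_of_mem hv)
    rw [Finset.prod_insert ha, Finset.prod_insert ha, Finset.sum_insert ha,
      Finset.erase_insert ha, Finset.card_insert_of_notMem ha]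
    have h1 : ∑ v ∈ s, e v * ∏ u ∈ (insert a s).erase v, x u =
        x a * ∑ v ∈ s, e v * ∏ u ∈ s.erase v, x u := by
      rw [Finset.mul_sum]
      refine Finset.sum_congr rfl fun v hv => ?_
      have hva : a ≠ v := fun h => ha (h ▸ hv)
      rw [Finset.erase_insert_of_ne hva, Finset.prod_insert
        (fun h => ha (Finset.mem_of_mem_erase h))]
      ring
    rw [h1]
    set P := ∏ v ∈ s, (x v + e v)
    set X := ∏ v ∈ s, x v
    set C := ∑ v ∈ s, e v * ∏ u ∈ s.erase v, x u with hC
    have hCle : |C| ≤ s.card * δ := by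
      refine (Finset.abs_sum_le_sum_abs _ _).trans ?_
      rw [← nsmul_eq_mul, ← Finset.sum_const]
      refine Finset.sum_le_sum fun v hv => ?_
      rw [abs_mul, Finset.abs_prod]
      calc |e v| * ∏ u ∈ s.erase v, |x u| ≤ δ * 1 := by
            refine mul_le_mul (he v (Finset.mem_insert_of_mem hv)) (Finset.prod_le_one
              (fun _ _ => abs_nonneg _) fun u hu => hx u (Finset.mem_insert_of_mem
              (Finset.mem_of_mem_erase hu))) (Finset.prod_nonneg fun _ _ => abs_nonneg _) hδ0
        _ = δ := mul_one δ
    -- The error for `s` recurs with coefficient `x a`, and `e a` multiplies an already small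
    -- increment. The resulting three terms are each at most 4^|s| δ², whence the base 4.
    have h2 : (x a + e a) * P - x a * X - (e a * X + x a * C) =
        x a * (P - X - C) + e a * ((P - X - C) + C) := by ring
    rw [h2]
    have hs : (s.card : ℝ) ≤ 4 ^ s.card := by
      exact_mod_cast (Nat.lt_pow_self (by norm_num : 1 < 4)).le
    have h3 : |x a * (P - X - C)| ≤ 4 ^ s.card * δ ^ 2 := by
      rw [abs_mul]
      exact (mul_le_of_le_one_left (abs_nonneg _) (hx a (Finset.mem_insert_self _ _))).trans ih
    have h4 : |e a * ((P - X - C) + C)| ≤ δ * (4 ^ s.card * δ ^ 2 + s.card * δ) := by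
      rw [abs_mul]
      exact mul_le_mul (he a (Finset.mem_insert_self _ _)) ((abs_add_le _ _).trans
        (add_le_add ih hCle)) (abs_nonneg _) hδ0
    refine (abs_add_le _ _).trans ((add_le_add h3 h4).trans ?_)
    have h5 : (0 : ℝ) < 4 ^ s.card := by positivity
    have h6 : δ * (4 ^ s.card * δ ^ 2) ≤ 4 ^ s.card * δ ^ 2 :=
      mul_le_of_le_one_left (by positivity) hδ1
    have h7 : (s.card : ℝ) * δ ^ 2 ≤ 4 ^ s.card * δ ^ 2 :=
      mul_le_mul_of_nonneg_right hs (sq_nonneg δ)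
    have h8 : (0 : ℝ) ≤ 4 ^ s.card * δ ^ 2 := by positivity
    rw [pow_succ (4 : ℝ)]
    nlinarith

end Linearization

/-! ### Extensions as embeddings modulo rooted automorphisms. -/

section Embeddings

variable {V W : Type*} {H : SimpleGraph V} {R : Finset V} {G : SimpleGraph W} {T : R ↪ W}

/-- The embeddings of the vertices of `H` that extend `T` and send edges to edges, except possibly
the edges between two roots. -/
def IsRootedEmbedding (H : SimpleGraph V) (R : Finset V) (G : SimpleGraph W) (T : R ↪ W)
    (φ : V ↪ W) : Prop :=
  (∀ u : R, φ u = T u) ∧ ∀ x y, H.Adj x y → ¬ (x ∈ R ∧ y ∈ R) → G.Adj (φ x) (φ y)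

/-- The subgraph `K` is the image under `φ` of `H` without the edges between two roots. -/
def IsImage (H : SimpleGraph V) (R : Finset V) (φ : V ↪ W) (K : G.Subgraph) : Prop :=
  K.verts = Set.range φ ∧
    ∀ x y, K.Adj x y ↔ ∃ u v, φ u = x ∧ φ v = y ∧ H.Adj u v ∧ ¬ (u ∈ R ∧ v ∈ R)

lemma IsImage.adj_iff {φ : V ↪ W} {K : G.Subgraph} (h : IsImage H R φ K) (x y : V) :
    K.Adj (φ x) (φ y) ↔ H.Adj x y ∧ ¬ (x ∈ R ∧ y ∈ R) := by
  rw [h.2]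
  constructor
  · rintro ⟨u, v, hu, hv, h⟩
    rwa [φ.injective hu, φ.injective hv] at h
  · exact fun h => ⟨x, y, rfl, rfl, h⟩

lemma IsImage.isRootedEmbedding {φ : V ↪ W} {K : G.Subgraph} (h : IsImage H R φ K)
    (hφ : ∀ u : R, φ u = T u) : IsRootedEmbedding H R G T φ :=
  ⟨hφ, fun x y hxy hR => K.adj_sub ((h.adj_iff x y).2 ⟨hxy, hR⟩)⟩

lemma IsImage.unique {φ : V ↪ W} {K K' : G.Subgraph} (h : IsImage H R φ K)
    (h' : IsImage H R φ K') : K = K' :=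
  SimpleGraph.Subgraph.ext (h.1.trans h'.1.symm)
    (by ext x y; exact (h.2 x y).trans (h'.2 x y).symm)

lemma IsRootedEmbedding.exists_isImage {φ : V ↪ W} (h : IsRootedEmbedding H R G T φ) :
    ∃ K : G.Subgraph, IsImage H R φ K := by
  refine ⟨⟨Set.range φ, fun x y => ∃ u v, φ u = x ∧ φ v = y ∧ H.Adj u v ∧ ¬ (u ∈ R ∧ v ∈ R),
    ?_, ?_, ?_⟩, rfl, fun x y => Iff.rfl⟩
  · rintro _ _ ⟨u, v, rfl, rfl, huv, hR⟩
    exact h.2 u v huv hR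
  · rintro _ _ ⟨u, v, rfl, rfl, huv, hR⟩
    exact ⟨u, rfl⟩
  · constructor
    rintro _ _ ⟨u, v, rfl, rfl, huv, hR⟩
    exact ⟨v, u, rfl, rfl, huv.symm, fun h => hR h.symm⟩

lemma mem_iff_of_fixed {σ : V ≃ V} (hσ : ∀ u ∈ R, σ u = u) (v : V) : σ v ∈ R ↔ v ∈ R := by
  constructor
  · intro h
    rwa [← σ.injective (hσ _ h)]
  · intro h
    rwa [hσ v h]

lemma IsImage.comp {φ : V ↪ W} {K : G.Subgraph} (h : IsImage H R φ K) {σ : H ≃g H}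
    (hσ : ∀ u ∈ R, σ u = u) : IsImage H R (σ.toEquiv.toEmbedding.trans φ) K := by
  have hR := mem_iff_of_fixed (σ := σ.toEquiv) hσ
  refine ⟨?_, fun x y => ?_⟩
  · rw [h.1]
    exact (σ.toEquiv.surjective.range_comp φ).symm
  · rw [h.2]
    constructor
    · rintro ⟨u, v, rfl, rfl, huv, hne⟩
      refine ⟨σ.toEquiv.symm u, σ.toEquiv.symm v, by simp, by simp, ?_, ?_⟩
      · rw [← σ.map_rel_iff]
        change H.Adj (σ.toEquiv (σ.toEquiv.symm u)) (σ.toEquiv (σ.toEquiv.symm v))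
        rwa [Equiv.apply_symm_apply, Equiv.apply_symm_apply]
      · rwa [← hR, ← hR (σ.toEquiv.symm v), Equiv.apply_symm_apply, Equiv.apply_symm_apply]
    · rintro ⟨u, v, rfl, rfl, huv, hne⟩
      refine ⟨σ u, σ v, rfl, rfl, σ.map_rel_iff.2 huv, ?_⟩
      have h1 : (σ u ∈ R ∧ σ v ∈ R) ↔ (u ∈ R ∧ v ∈ R) := and_congr (hR u) (hR v)
      rwa [h1]

/-- Each extension is the image of as many embeddings as there are rooted automorphisms. -/
lemma extCount_mul_numRootedAut (H : SimpleGraph V) (R : Finset V) (G : SimpleGraph W)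
    (T : R ↪ W) : extCount H R G T * numRootedAut H R =
      Nat.card {φ : V ↪ W // IsRootedEmbedding H R G T φ} := by
  have hch : ∀ K : {K : G.Subgraph // IsExtension H R T K}, ∃ φ : V ↪ W, (∀ u : R, φ u = T u) ∧
    IsImage H R φ K.1 := fun K => K.2
  choose Φ hΦT hΦ using hch
  rw [extCount, numRootedAut, ← Nat.card_coe_set_eq, ← Nat.card_prod]
  let F : {K : G.Subgraph // IsExtension H R T K} × {σ : H ≃g H // ∀ u ∈ R, σ u = u} →
      {φ : V ↪ W // IsRootedEmbedding H R G T φ} := fun z =>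
    ⟨z.2.1.toEquiv.toEmbedding.trans (Φ z.1), ((hΦ z.1).comp z.2.2).isRootedEmbedding fun u => by
      have : z.2.1.toEquiv u = u := z.2.2 u u.2
      simp [this, hΦT]⟩
  refine Nat.card_eq_of_bijective F ⟨?_, ?_⟩
  · rintro ⟨K, σ⟩ ⟨K', σ'⟩ hF
    have h1 : σ.1.toEquiv.toEmbedding.trans (Φ K) = σ'.1.toEquiv.toEmbedding.trans (Φ K') :=
      congrArg Subtype.val hF
    have h2 := (hΦ K).comp σ.2
    rw [h1] at h2
    obtain rfl : K = K' := Subtype.ext (h2.unique ((hΦ K').comp σ'.2))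
    congr 1
    refine Subtype.ext (RelIso.ext fun v => (Φ K).injective ?_)
    exact DFunLike.congr_fun h1 v
  · rintro ⟨φ, hφ⟩
    obtain ⟨K, hK⟩ := hφ.exists_isImage
    let K' : {K : G.Subgraph // IsExtension H R T K} := ⟨K, φ, hφ.1, hK⟩
    have hr : ∀ v, ∃ w, Φ K' w = φ v := fun v => by
      have : φ v ∈ Set.range (Φ K') := by
        rw [← (hΦ K').1, hK.1]; exact ⟨v, rfl⟩
      exact this
    have hr' : ∀ w, ∃ v, φ v = Φ K' w := fun w => by
      have : Φ K' w ∈ Set.range φ := by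
        rw [← hK.1, (hΦ K').1]; exact ⟨w, rfl⟩
      exact this
    choose s hs using hr
    choose t ht using hr'
    -- Two embeddings with the same image differ by a permutation of the vertices of `H`, which is
    -- the automorphism sought.
    let σ : V ≃ V := ⟨s, t, fun v => φ.injective (by rw [ht, hs]),
      fun w => (Φ K').injective (by rw [hs, ht])⟩
    have hσ : ∀ u ∈ R, σ u = u := fun u hu => (Φ K').injective (by
      rw [show σ u = s u from rfl, hs, hφ.1 ⟨u, hu⟩, hΦT K' ⟨u, hu⟩])
    have hR := mem_iff_of_fixed hσ
    have hadj : ∀ {x y : V}, H.Adj (σ x) (σ y) ↔ H.Adj x y := by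
      intro x y
      -- The image does not record edges between two roots. They are preserved because `σ` fixes
      -- every root.
      by_cases hxy : x ∈ R ∧ y ∈ R
      · rw [hσ x hxy.1, hσ y hxy.2]
      · have h1 := (hΦ K').adj_iff (σ x) (σ y)
        rw [show Φ K' (σ x) = φ x from hs x, show Φ K' (σ y) = φ y from hs y, hK.adj_iff, hR, hR] at h1
        simpa [hxy] using h1.symm
    refine ⟨(K', ⟨⟨σ, hadj⟩, hσ⟩), Subtype.ext (Function.Embedding.ext fun v => ?_)⟩
    exact hs v

end Embeddings

/-! ### Embeddings versus homomorphisms on the non-roots. -/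

section EmbeddingCount

variable {V W : Type*} [Fintype V] [DecidableEq V] [Fintype W] [DecidableEq W]

/-- The images under `T` of the root neighbours of `v`. -/
noncomputable def rootNbrs (H : SimpleGraph V) (R : Finset V) (T : R ↪ W) (v : {v // v ∉ R}) :
    Finset W := by
  classical exact (Finset.univ.filter fun u : R => H.Adj v u).map T

/-- The edges between non-roots. -/
noncomputable def innerEdges (H : SimpleGraph V) (R : Finset V) : Finset (Sym2 {v // v ∉ R}) := by
  classical exact (H.comap (Subtype.val : {v // v ∉ R} → V)).edgeFinset

omit [Fintype V] [DecidableEq V] [Fintype W] [DecidableEq W] in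
lemma mem_rootNbrs {H : SimpleGraph V} {R : Finset V} {T : R ↪ W} {v : {v // v ∉ R}} {w : W} :
    w ∈ rootNbrs H R T v ↔ ∃ u : R, H.Adj v u ∧ T u = w := by
  simp [rootNbrs]

lemma mk_mem_innerEdges {H : SimpleGraph V} {R : Finset V} {x y : {v // v ∉ R}} :
    s(x, y) ∈ innerEdges H R ↔ H.Adj x y := by
  simp [innerEdges]

omit [Fintype W] [DecidableEq W] in
lemma isRootedEmbedding_iff {H : SimpleGraph V} {R : Finset V} {T : R ↪ W} {ω : Sym2 W → Bool}
    {φ : V ↪ W} (hφ : ∀ u : R, φ u = T u) : IsRootedEmbedding H R (graphOf ω) T φ ↔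
      IsHom ω (rootNbrs H R T) (innerEdges H R) fun v => φ v := by
  constructor
  · intro h
    refine ⟨fun v w hw => ?_, fun e he => ?_⟩
    · obtain ⟨u, huv, rfl⟩ := mem_rootNbrs.1 hw
      have := h.2 u v huv.symm fun h' => v.2 h'.2
      rw [hφ u] at this
      exact (graphOf_adj.1 this).1
    · induction e with | _ x y => ?_
      exact (graphOf_adj.1 (h.2 x y (mk_mem_innerEdges.1 he) fun h' => x.2 h'.1)).1
  · rintro ⟨h1, h2⟩
    refine ⟨hφ, fun x y hxy hR => graphOf_adj.2 ⟨?_, fun h => hxy.ne (φ.injective h)⟩⟩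
    by_cases hx : x ∈ R
    · have hy : y ∉ R := fun hy => hR ⟨hx, hy⟩
      have := h1 ⟨y, hy⟩ (T ⟨x, hx⟩) (mem_rootNbrs.2 ⟨⟨x, hx⟩, hxy.symm, rfl⟩)
      rwa [← hφ ⟨x, hx⟩] at this
    by_cases hy : y ∈ R
    · have := h1 ⟨x, hx⟩ (T ⟨y, hy⟩) (mem_rootNbrs.2 ⟨⟨y, hy⟩, hxy, rfl⟩)
      rw [← hφ ⟨y, hy⟩] at this
      rwa [Sym2.eq_swap]
    · exact h2 s(⟨x, hx⟩, ⟨y, hy⟩) (mk_mem_innerEdges.2 hxy)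

/-- Embeddings that extend `T` correspond to injective maps on the non-roots avoiding the image of
`T`. -/
lemma card_isRootedEmbedding_eq_sum (H : SimpleGraph V) (R : Finset V) (T : R ↪ W)
    (ω : Sym2 W → Bool) :
    (Nat.card {φ : V ↪ W // IsRootedEmbedding H R (graphOf ω) T φ} : ℝ) =
      ∑ ψ : {v // v ∉ R} → W, ind ((Function.Injective ψ ∧ ∀ v, ψ v ∉ Finset.univ.map T) ∧
        IsHom ω (rootNbrs H R T) (innerEdges H R) ψ) := by
  classical
  rw [← card_filter_eq_sum_ind, ← Fintype.card_subtype, ← Nat.card_eq_fintype_card]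
  congr 1
  let F : {φ : V ↪ W // IsRootedEmbedding H R (graphOf ω) T φ} →
      {ψ : {v // v ∉ R} → W // (Function.Injective ψ ∧ ∀ v, ψ v ∉ Finset.univ.map T) ∧
        IsHom ω (rootNbrs H R T) (innerEdges H R) ψ} := fun φ =>
    ⟨fun v => φ.1 v, ⟨fun x y h => Subtype.ext (φ.1.injective h), fun v h => by
      obtain ⟨u, -, hu⟩ := Finset.mem_map.1 h
      rw [← φ.2.1 u] at hu
      exact v.2 (φ.1.injective hu ▸ u.2)⟩, (isRootedEmbedding_iff φ.2.1).1 φ.2⟩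
  refine Nat.card_eq_of_bijective F ⟨?_, ?_⟩
  · intro φ φ' h
    refine Subtype.ext (Function.Embedding.ext fun v => ?_)
    by_cases hv : v ∈ R
    · rw [φ.2.1 ⟨v, hv⟩, φ'.2.1 ⟨v, hv⟩]
    · exact congrFun (congrArg Subtype.val h) ⟨v, hv⟩
  · rintro ⟨ψ, ⟨hinj, havoid⟩, hhom⟩
    let φ₀ : V → W := fun v => if h : v ∈ R then T ⟨v, h⟩ else ψ ⟨v, h⟩
    have hR : ∀ v (h : v ∈ R), φ₀ v = T ⟨v, h⟩ := fun v h => dif_pos h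
    have hN : ∀ v (h : v ∉ R), φ₀ v = ψ ⟨v, h⟩ := fun v h => dif_neg h
    have hT : ∀ v (h : v ∉ R) u (h' : u ∈ R), φ₀ v ≠ φ₀ u := fun v h u h' he => by
      rw [hN v h, hR u h'] at he
      exact havoid ⟨v, h⟩ (he ▸ Finset.mem_map_of_mem T (Finset.mem_univ _))
    have hφ₀ : Function.Injective φ₀ := by
      intro x y hxy
      by_cases hx : x ∈ R <;> by_cases hy : y ∈ R
      · rw [hR x hx, hR y hy] at hxy
        exact congrArg Subtype.val (T.injective hxy)
      · exact absurd hxy.symm (hT y hy x hx)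
      · exact absurd hxy (hT x hx y hy)
      · rw [hN x hx, hN y hy] at hxy
        exact congrArg Subtype.val (hinj hxy)
    have hres : (fun v : {v // v ∉ R} => φ₀ v) = ψ := funext fun v => hN v v.2
    refine ⟨⟨⟨φ₀, hφ₀⟩, (isRootedEmbedding_iff fun u => hR u u.2).2 ?_⟩, Subtype.ext hres⟩
    change IsHom ω _ _ (fun v : {v // v ∉ R} => φ₀ v)
    rwa [hres]

/-- Maps that are not injective or that meet the image of `T` are negligible. -/
lemma abs_card_isRootedEmbedding_sub_le (H : SimpleGraph V) (R : Finset V) (T : R ↪ W)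
    (ω : Sym2 W → Bool) :
    Fintype.card W * |(Nat.card {φ : V ↪ W // IsRootedEmbedding H R (graphOf ω) T φ} : ℝ) -
        homCount ω (rootNbrs H R T) (innerEdges H R)| ≤
      Fintype.card W ^ Fintype.card {v // v ∉ R} * (2 * (Fintype.card V : ℝ) ^ 2) := by
  classical
  set S := Finset.univ.map T with hS
  rw [card_isRootedEmbedding_eq_sum, homCount, ← Finset.sum_sub_distrib]
  -- A map counted only as a homomorphism has two colliding values or a value in the image of the
  -- roots. For each fixed pair or vertex, this loses a factor |W|.
  have h1 : |∑ ψ : {v // v ∉ R} → W, (ind ((Function.Injective ψ ∧ ∀ v, ψ v ∉ S) ∧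
        IsHom ω (rootNbrs H R T) (innerEdges H R) ψ) -
        ind (IsHom ω (rootNbrs H R T) (innerEdges H R) ψ))| ≤
      ∑ z : {v // v ∉ R} × {v // v ∉ R}, |∑ ψ : {v // v ∉ R} → W,
        ind (z.1 ≠ z.2 ∧ ψ z.1 = ψ z.2)| + ∑ v, |∑ ψ : {v // v ∉ R} → W, ind (ψ v ∈ S)| := by
    simp only [abs_of_nonneg (Finset.sum_nonneg fun ψ (_ : ψ ∈ Finset.univ) => ind_nonneg _)]
    rw [Finset.sum_comm, Finset.sum_comm (s := (Finset.univ : Finset {v // v ∉ R})),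
      ← Finset.sum_add_distrib]
    refine (Finset.abs_sum_le_sum_abs _ _).trans (Finset.sum_le_sum fun ψ _ => ?_)
    have h0 : 0 ≤ ∑ z : {v // v ∉ R} × {v // v ∉ R}, ind (z.1 ≠ z.2 ∧ ψ z.1 = ψ z.2) :=
      Finset.sum_nonneg fun _ _ => ind_nonneg _
    have h0' : 0 ≤ ∑ v, ind (ψ v ∈ S) := Finset.sum_nonneg fun _ _ => ind_nonneg _
    by_cases hψ : Function.Injective ψ ∧ ∀ v, ψ v ∉ S
    · rw [ind_and, ind_of_true hψ, one_mul, sub_self, abs_zero]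
      positivity
    · rw [ind_and, ind_of_false hψ, zero_mul, zero_sub, abs_neg, abs_of_nonneg (ind_nonneg _)]
      refine (ind_le_one _).trans ?_
      rw [not_and_or] at hψ
      rcases hψ with hψ | hψ
      · simp only [Function.Injective, not_forall] at hψ
        obtain ⟨x, y, hxy, hne⟩ := hψ
        have := Finset.single_le_sum (f := fun z : {v // v ∉ R} × {v // v ∉ R} =>
          ind (z.1 ≠ z.2 ∧ ψ z.1 = ψ z.2)) (fun _ _ => ind_nonneg _) (Finset.mem_univ (x, y))
        rw [ind_of_true ⟨hne, hxy⟩] at this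
        linarith
      · push Not at hψ
        obtain ⟨v, hv⟩ := hψ
        have := Finset.single_le_sum (f := fun v : {v // v ∉ R} => ind (ψ v ∈ S))
          (fun _ _ => ind_nonneg _) (Finset.mem_univ v)
        rw [ind_of_true hv] at this
        linarith
  have hN : (Fintype.card {v // v ∉ R} : ℝ) ≤ Fintype.card V := by
    exact_mod_cast Fintype.card_subtype_le _
  have hSc : (S.card : ℝ) ≤ Fintype.card V := by
    rw [hS, Finset.card_map, Finset.card_univ, Fintype.card_coe]
    exact_mod_cast Finset.card_le_univ R
  have h2 : ∀ z : {v // v ∉ R} × {v // v ∉ R}, Fintype.card W * |∑ ψ : {v // v ∉ R} → W,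
      ind (z.1 ≠ z.2 ∧ ψ z.1 = ψ z.2)| ≤ Fintype.card W ^ Fintype.card {v // v ∉ R} * 1 := by
    rintro ⟨x, y⟩
    refine abs_sum_le_of_update _ x fun ψ => ?_
    rw [abs_of_nonneg (Finset.sum_nonneg fun _ _ => ind_nonneg _)]
    by_cases hxy : x = y
    · rw [Finset.sum_eq_zero fun a _ => ind_of_false fun h => h.1 hxy]
      exact zero_le_one
    · rw [Finset.sum_eq_single_of_mem (ψ y) (Finset.mem_univ _) fun a _ ha => ind_of_false fun h =>
        ha (by simpa [Ne.symm hxy] using h.2)]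
      exact ind_le_one _
  have h3 : ∀ v : {v // v ∉ R}, Fintype.card W * |∑ ψ : {v // v ∉ R} → W, ind (ψ v ∈ S)| ≤
      Fintype.card W ^ Fintype.card {v // v ∉ R} * S.card := by
    intro v
    refine abs_sum_le_of_update _ v fun ψ => ?_
    rw [abs_of_nonneg (Finset.sum_nonneg fun _ _ => ind_nonneg _)]
    simp only [Function.update_self]
    rw [← card_filter_eq_sum_ind]
    simp
  calc _ ≤ (Fintype.card W : ℝ) * _ := mul_le_mul_of_nonneg_left h1 (Nat.cast_nonneg _)
    _ ≤ ∑ z : {v // v ∉ R} × {v // v ∉ R}, (Fintype.card W : ℝ) ^ Fintype.card {v // v ∉ R} * 1 +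
        ∑ v : {v // v ∉ R}, (Fintype.card W : ℝ) ^ Fintype.card {v // v ∉ R} * S.card := by
        rw [mul_add, Finset.mul_sum, Finset.mul_sum]
        exact add_le_add (Finset.sum_le_sum fun z _ => h2 z) (Finset.sum_le_sum fun v _ => h3 v)
    _ = (Fintype.card W : ℝ) ^ Fintype.card {v // v ∉ R} * ((Fintype.card {v // v ∉ R} : ℝ) ^ 2 +
        Fintype.card {v // v ∉ R} * S.card) := by
        rw [Finset.sum_const, Finset.sum_const, Finset.card_univ, Finset.card_univ,
          Fintype.card_prod, nsmul_eq_mul, nsmul_eq_mul]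
        push_cast; ring
    _ ≤ _ := by
        refine mul_le_mul_of_nonneg_left ?_ (by positivity)
        have h4 : (0 : ℝ) ≤ Fintype.card {v // v ∉ R} := Nat.cast_nonneg _
        have h5 : (0 : ℝ) ≤ S.card := Nat.cast_nonneg _
        nlinarith

end EmbeddingCount

/-! ### Embedding counts as affine functions of codegrees. -/

section ExtensionCount

open Topology

lemma abs_loopDeg_sub_codeg_le {W : Type*} [Fintype W] [DecidableEq W] (ω : Sym2 W → Bool)
    (C : Finset W) : |loopDeg ω C - codeg ω C| ≤ C.card := by
  rw [loopDeg, codeg, outDeg, card_filter_eq_sum_ind, ← Finset.sum_add_sum_compl C,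
    add_sub_cancel_right, abs_of_nonneg (Finset.sum_nonneg fun _ _ => ind_nonneg _)]
  refine (Finset.sum_le_sum fun a _ => ind_le_one _).trans ?_
  simp

variable {V : Type*} [Fintype V] [DecidableEq V]

/-- The root neighbours of a non-root. -/
noncomputable def rootNbrSet (H : SimpleGraph V) (R : Finset V) (v : {v // v ∉ R}) : Finset R := by
  classical exact Finset.univ.filter fun u : R => H.Adj v u

omit [Fintype V] [DecidableEq V] in
lemma mem_rootNbrSet {H : SimpleGraph V} {R : Finset V} {v : {v // v ∉ R}} {u : R} :
    u ∈ rootNbrSet H R v ↔ H.Adj v u := by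
  simp [rootNbrSet]

omit [Fintype V] [DecidableEq V] in
lemma rootNbrs_eq_map {W : Type*} (H : SimpleGraph V) (R : Finset V) (T : R ↪ W)
    (v : {v // v ∉ R}) : rootNbrs H R T v = (rootNbrSet H R v).map T := rfl

lemma card_rootNbrSet_add_le (H : SimpleGraph V) (R : Finset V) (v : {v // v ∉ R}) :
    (rootNbrSet H R v).card + Fintype.card {v // v ∉ R} ≤ Fintype.card V := by
  have h1 : (rootNbrSet H R v).card ≤ R.card := by
    simpa using Finset.card_le_univ (rootNbrSet H R v)
  have h2 : Fintype.card {v // v ∉ R} = Fintype.card V - R.card := by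
    rw [Fintype.card_subtype_compl, Fintype.card_coe]
  have h3 := Finset.card_le_univ R
  omega

lemma prod_erase_pow_card (H : SimpleGraph V) (R : Finset V) (p : ℝ) (v : {v // v ∉ R}) :
    ∏ u ∈ Finset.univ.erase v, p ^ (rootNbrSet H R u).card =
      p ^ ((∑ u, (rootNbrSet H R u).card) - (rootNbrSet H R v).card) := by
  rw [Finset.prod_pow_eq_pow_sum]
  congr 1
  have := Finset.add_sum_erase Finset.univ (fun u => (rootNbrSet H R u).card) (Finset.mem_univ v)
  beta_reduce at this
  omega

/-- In a regular configuration, the extension counts are determined by the numbers of common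
neighbours, up to a small error. -/
lemma abs_card_isRootedEmbedding_div_sub_le {p : ℝ} (hp : p ∈ Set.Icc (0 : ℝ) 1)
    (H : SimpleGraph V) (R : Finset V) :
    ∃ C : ℝ, ∀ᶠ n : ℕ in atTop, ∀ ω : Sym2 (Fin n) → Bool, Regular p (Fintype.card V) ω →
      ∀ T : R ↪ Fin n,
        |(Nat.card {φ : V ↪ Fin n // IsRootedEmbedding H R (graphOf ω) T φ} : ℝ) /
            n ^ Fintype.card {v // v ∉ R} -
          p ^ (innerEdges H R).card * (p ^ (∑ v, (rootNbrSet H R v).card) +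
            ∑ v, p ^ ((∑ v, (rootNbrSet H R v).card) - (rootNbrSet H R v).card) *
              (codeg ω ((rootNbrSet H R v).map T) / n - p ^ (rootNbrSet H R v).card))| ≤
          C / eighthRoot n ^ 6 := by
  set L := Fintype.card V with hL
  set d := Fintype.card {v // v ∉ R} with hd
  set f := (innerEdges H R).card with hf
  set K := ∑ v, (rootNbrSet H R v).card with hK
  -- The three summands bound non-injective maps, the edge discrepancies, and the linearization
  -- together with loops. In normalized counts each is O(n^{-3/4}), below the fluctuation scale (n
  -- log n)^{-1/2}.
  refine ⟨2 * L ^ 2 + f * (1 + 4 * L) + (4 ^ d * (1 + 2 * L) ^ 2 + L ^ 2), ?_⟩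
  filter_upwards [tendsto_eighthRoot.eventually_ge_atTop (1 + 2 * (L : ℝ)),
    tendsto_eighthRoot.eventually_ge_atTop 1] with n hy hy1 ω hω T
  set y := eighthRoot n with hydef
  have hy0 : 0 < y := by linarith
  have hyn : (n : ℝ) = y ^ 8 := (eighthRoot_pow n).symm
  have hn0 : (0 : ℝ) < n := by rw [hyn]; positivity
  have hrd : (0 : ℝ) < (n : ℝ) ^ d := by positivity
  have hdL : (d : ℝ) ≤ L := by exact_mod_cast Fintype.card_subtype_le _
  have hL0 : (0 : ℝ) ≤ L := Nat.cast_nonneg _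
  have hJL : ∀ v, (rootNbrSet H R v).card ≤ L := fun v =>
    (Nat.le_add_right _ _).trans (card_rootNbrSet_add_le H R v)
  set X : ℝ := (Nat.card {φ : V ↪ Fin n // IsRootedEmbedding H R (graphOf ω) T φ} : ℝ) with hX
  set h : ℝ := homCount ω (rootNbrs H R T) (innerEdges H R) with hh
  set D : {v // v ∉ R} → ℝ := fun v => loopDeg ω (rootNbrs H R T v) with hD
  set x : {v // v ∉ R} → ℝ := fun v => p ^ (rootNbrSet H R v).card with hx
  set e : {v // v ∉ R} → ℝ := fun v => D v / n - x v with he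
  have hx0 : ∀ v, 0 ≤ x v := fun v => pow_nonneg hp.1 _
  have hx1 : ∀ v, x v ≤ 1 := fun v => pow_le_one₀ hp.1 hp.2
  -- replacing embeddings by homomorphisms
  have h1 : |X / n ^ d - h / n ^ d| ≤ 2 * L ^ 2 / y ^ 6 := by
    have := abs_card_isRootedEmbedding_sub_le H R T ω
    rw [Fintype.card_fin] at this
    rw [← sub_div, abs_div, abs_of_pos hrd, div_le_div_iff₀ hrd (by positivity)]
    have h2 : |X - h| * y ^ 6 ≤ |X - h| * n := by
      refine mul_le_mul_of_nonneg_left ?_ (abs_nonneg _)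
      rw [hyn]
      exact pow_le_pow_right₀ hy1 (by norm_num)
    linarith
  -- replacing edges by their probabilities
  have h2 : |h / n ^ d - p ^ f * ((∏ v, D v) / n ^ d)| ≤ f * (1 + 4 * L) / y ^ 6 := by
    have h3 := abs_homCount_sub_le hp hω.1 (J := rootNbrs H R T) (F := innerEdges H R)
      (fun v => by rw [rootNbrs_eq_map, Finset.card_map]; exact card_rootNbrSet_add_le H R v)
      (fun e he => by
        induction e with | _ a b => ?_
        have h4 := (mk_mem_innerEdges.1 he).ne
        simpa using fun h5 : a = b => h4 (congrArg Subtype.val h5))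
    rw [Fintype.card_fin] at h3
    have h4 : h / n ^ d - p ^ f * ((∏ v, D v) / n ^ d) = (h - p ^ f * ∏ v, D v) / n ^ d := by ring
    rw [h4, abs_div, abs_of_pos hrd, div_le_div_iff₀ hrd (by positivity)]
    have h5 : y ^ 10 + 4 * L * y ^ 8 ≤ (1 + 4 * L) * y ^ 10 := by
      have : y ^ 8 ≤ y ^ 10 := pow_le_pow_right₀ hy1 (by norm_num)
      nlinarith
    have h6 : (n : ℝ) ^ 2 = y ^ 6 * y ^ 10 := by rw [hyn]; ring
    have h7 : y ^ 10 * (|h - p ^ f * ∏ v, D v| * y ^ 6) ≤ y ^ 10 * (f * (1 + 4 * L) * n ^ d) := by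
      calc _ = (n : ℝ) ^ 2 * |h - p ^ f * ∏ v, D v| := by rw [h6]; ring
        _ ≤ f * (n ^ d * (y ^ 10 + 4 * L * y ^ 8)) := h3
        _ ≤ f * (n ^ d * ((1 + 4 * L) * y ^ 10)) := by gcongr
        _ = _ := by ring
    exact le_of_mul_le_mul_left h7 (by positivity)
  -- linearization
  have hDc : ∀ v, |D v / n - codeg ω ((rootNbrSet H R v).map T) / n| ≤ L / n := fun v => by
    rw [← sub_div, abs_div, abs_of_pos hn0]
    refine div_le_div_of_nonneg_right ?_ hn0.le
    refine (abs_loopDeg_sub_codeg_le ω (rootNbrs H R T v)).trans ?_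
    rw [rootNbrs_eq_map, Finset.card_map]
    exact_mod_cast hJL v
  have hLn : L / (n : ℝ) ≤ L / y ^ 3 := by
    refine div_le_div_of_nonneg_left hL0 (by positivity) ?_
    rw [hyn]
    exact pow_le_pow_right₀ hy1 (by norm_num)
  -- The relative error of a degree is O(n^{-3/8}), so its square in the expansion is O(n^{-3/4}).
  have hed : ∀ v, |e v| ≤ (1 + 2 * L) / y ^ 3 := fun v => by
    have h3 := hω.2 ((rootNbrSet H R v).map T) (by rw [Finset.card_map]; exact hJL v)
    rw [Finset.card_map] at h3
    have h4 : |(codeg ω ((rootNbrSet H R v).map T) : ℝ) / n - x v| ≤ (1 + L) / y ^ 3 := by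
      have h5 : (codeg ω ((rootNbrSet H R v).map T) : ℝ) / n - x v =
          (codeg ω ((rootNbrSet H R v).map T) - n * x v) / n := by field_simp
      rw [h5, abs_div, abs_of_pos hn0, div_le_div_iff₀ hn0 (by positivity)]
      have h6 : y ^ 5 + L ≤ (1 + L) * y ^ 5 := by
        have : 1 ≤ y ^ 5 := one_le_pow₀ hy1
        nlinarith
      calc _ ≤ ((1 + L) * y ^ 5) * y ^ 3 := by
            refine mul_le_mul_of_nonneg_right (h3.trans h6) (by positivity)
        _ = _ := by rw [hyn]; ring
    calc |e v| = |(D v / n - codeg ω ((rootNbrSet H R v).map T) / n) +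
          (codeg ω ((rootNbrSet H R v).map T) / n - x v)| := by rw [he]; ring_nf
      _ ≤ L / y ^ 3 + (1 + L) / y ^ 3 := (abs_add_le _ _).trans (add_le_add ((hDc v).trans hLn) h4)
      _ = _ := by ring
  have hδ1 : (1 + 2 * L) / y ^ 3 ≤ 1 := by
    rw [div_le_one (by positivity)]
    calc 1 + 2 * (L : ℝ) ≤ y := hy
      _ = y ^ 1 := (pow_one y).symm
      _ ≤ y ^ 3 := pow_le_pow_right₀ hy1 (by norm_num)
  have h3 := abs_prod_add_sub_le Finset.univ (x := x) (e := e) hδ1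
    (fun v _ => by rw [abs_of_nonneg (hx0 v)]; exact hx1 v) fun v _ => hed v
  have hprod : ∏ v, (x v + e v) = (∏ v, D v) / n ^ d := by
    simp only [he, add_sub_cancel]
    rw [Finset.prod_div_distrib, Finset.prod_const, Finset.card_univ]
  have hxK : ∏ v, x v = p ^ K := by simp only [hx]; rw [Finset.prod_pow_eq_pow_sum]
  rw [hprod, hxK, Finset.card_univ] at h3
  simp only [hx, prod_erase_pow_card] at h3
  -- replacing degrees by numbers of common neighbours
  have h4 : |∑ v, e v * p ^ (K - (rootNbrSet H R v).card) -
      ∑ v, p ^ (K - (rootNbrSet H R v).card) *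
        (codeg ω ((rootNbrSet H R v).map T) / n - p ^ (rootNbrSet H R v).card)| ≤ L ^ 2 / y ^ 6 := by
    rw [← Finset.sum_sub_distrib]
    refine (Finset.abs_sum_le_sum_abs _ _).trans
      ((Finset.sum_le_sum (g := fun _ => L / (n : ℝ)) fun v _ => ?_).trans ?_)
    · have h5 : e v * p ^ (K - (rootNbrSet H R v).card) - p ^ (K - (rootNbrSet H R v).card) *
          (codeg ω ((rootNbrSet H R v).map T) / n - p ^ (rootNbrSet H R v).card) =
          p ^ (K - (rootNbrSet H R v).card) *
            (D v / n - codeg ω ((rootNbrSet H R v).map T) / n) := by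
        simp only [he, hx]; ring
      rw [h5, abs_mul, abs_of_nonneg (pow_nonneg hp.1 _)]
      exact (mul_le_of_le_one_left (abs_nonneg _) (pow_le_one₀ hp.1 hp.2)).trans (hDc v)
    · rw [Finset.sum_const, Finset.card_univ, nsmul_eq_mul, ← mul_div_assoc]
      refine div_le_div₀ (by positivity) ?_ (by positivity) ?_
      · rw [pow_two]; exact mul_le_mul_of_nonneg_right hdL hL0
      · rw [hyn]; exact pow_le_pow_right₀ hy1 (by norm_num)
  set S₁ := ∑ v, e v * p ^ (K - (rootNbrSet H R v).card) with hS₁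
  set S₂ := ∑ v, p ^ (K - (rootNbrSet H R v).card) *
        (codeg ω ((rootNbrSet H R v).map T) / n - p ^ (rootNbrSet H R v).card) with hS₂
  set P₁ := (∏ v, D v) / (n : ℝ) ^ d with hP₁
  have h5 : |p ^ f * P₁ - p ^ f * (p ^ K + S₂)| ≤
      (4 ^ d * (1 + 2 * L) ^ 2 + L ^ 2) / y ^ 6 := by
    rw [← mul_sub, abs_mul, abs_of_nonneg (pow_nonneg hp.1 _)]
    refine (mul_le_of_le_one_left (abs_nonneg _) (pow_le_one₀ hp.1 hp.2)).trans ?_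
    have h6 : P₁ - (p ^ K + S₂) = (P₁ - p ^ K - S₁) + (S₁ - S₂) := by ring
    rw [h6]
    refine (abs_add_le _ _).trans ((add_le_add h3 h4).trans (le_of_eq ?_))
    rw [div_pow, ← pow_mul]
    ring
  calc |X / n ^ d - p ^ f * (p ^ K + S₂)| = |(X / n ^ d - h / n ^ d) +
        ((h / n ^ d - p ^ f * P₁) + (p ^ f * P₁ - p ^ f * (p ^ K + S₂)))| := by ring_nf
    _ ≤ 2 * L ^ 2 / y ^ 6 + (f * (1 + 4 * L) / y ^ 6 +
        (4 ^ d * (1 + 2 * L) ^ 2 + L ^ 2) / y ^ 6) :=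
        (abs_add_le _ _).trans (add_le_add h1 ((abs_add_le _ _).trans (add_le_add h2 h5)))
    _ = _ := by ring

end ExtensionCount

/-! ### Grouping the non-roots by root class. -/

section Classes

variable {V : Type*} {H : SimpleGraph V} {R : Finset V}

/-- A set of roots, as a subset of the type of roots. -/
noncomputable def rootSubset (R A : Finset V) : Finset R := by
  classical exact Finset.univ.filter fun u : R => (u : V) ∈ A

lemma mem_rootSubset {A : Finset V} {u : R} : u ∈ rootSubset R A ↔ (u : V) ∈ A := by
  simp [rootSubset]

lemma card_rootSubset {A : Finset V} (hA : A ⊆ R) : (rootSubset R A).card = A.card := by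
  classical
  rw [← Finset.card_map (Function.Embedding.subtype _)]
  congr 1
  ext u
  simp only [Finset.mem_map, mem_rootSubset, Function.Embedding.subtype_apply, Subtype.exists,
    exists_and_left, exists_prop]
  constructor
  · rintro ⟨u, hu, -, rfl⟩; exact hu
  · intro hu; exact ⟨u, hu, hA hu, rfl⟩

variable [DecidableEq V] {P : Finpartition R} {ι : Type*}

lemma exists_class_index (A : ι ≃ P.parts) :
    ∃ f : R → ι, ∀ u b, u ∈ rootSubset R (A b) ↔ f u = b := by
  refine ⟨fun u => A.symm ⟨P.part u, P.part_mem.2 u.2⟩, fun u b => ?_⟩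
  rw [mem_rootSubset, Equiv.symm_apply_eq, Subtype.ext_iff]
  exact ⟨fun h => P.part_eq_of_mem (A b).2 h, fun h => by rw [← h]; exact P.mem_part u.2⟩

variable [Fintype V]

/-- Every non-root is free or is a common neighbour of exactly one class. -/
lemma sum_comp_rootNbrSet [Fintype ι] (hsymm : IsSymmetricWith H R P) (A : ι ≃ P.parts)
    (h : Finset R → ℝ) :
    ∑ v, h (rootNbrSet H R v) =
      numFree H R * h ∅ + ∑ b, numCommonNbrs H R (A b) * h (rootSubset R (A b)) := by
  classical
  have hAR : ∀ b, (A b : Finset V) ⊆ R := fun b => P.le (A b).2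
  have hne : ∀ b, (A b : Finset V).Nonempty := fun b => P.nonempty_of_mem_parts (A b).2
  have hempty : ∀ v : {v // v ∉ R}, rootNbrSet H R v = ∅ ↔ ∀ u ∈ R, ¬ H.Adj v u := fun v => by
    rw [Finset.eq_empty_iff_forall_notMem]
    simp only [mem_rootNbrSet, Subtype.forall]
  have hclass : ∀ (v : {v // v ∉ R}) b, rootNbrSet H R v = rootSubset R (A b) ↔
      ∀ u ∈ (A b : Finset V), H.Adj u v := by
    intro v b
    constructor
    · intro he u hu
      have : (⟨u, hAR b hu⟩ : R) ∈ rootNbrSet H R v := by rw [he, mem_rootSubset]; exact hu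
      exact (mem_rootNbrSet.1 this).symm
    -- Adjacency to a single vertex of a class already identifies the class, since the classes are
    -- disjoint and a non-root sees at most one of them.
    · intro hadj
      obtain ⟨u₀, hu₀⟩ := hne b
      rcases hsymm v v.2 with hv | ⟨B, hB, hv⟩
      · exact absurd (hadj u₀ hu₀).symm (hv u₀ (hAR b hu₀))
      · have hu₀B : u₀ ∈ B := (hv u₀ (hAR b hu₀)).1 (hadj u₀ hu₀).symm
        have hBA : B = A b := P.eq_of_mem_parts hB (A b).2 hu₀B hu₀
        ext u
        rw [mem_rootNbrSet, mem_rootSubset, hv u u.2, hBA]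
  have hinj : ∀ b b', rootSubset R (A b) = rootSubset R (A b' : Finset V) → b = b' := by
    intro b b' he
    obtain ⟨u, hu⟩ := hne b
    have h1 : (⟨u, hAR b hu⟩ : R) ∈ rootSubset R (A b' : Finset V) := by
      rw [← he, mem_rootSubset]; exact hu
    exact A.injective (Subtype.ext (P.eq_of_mem_parts (A b).2 (A b').2 hu (mem_rootSubset.1 h1)))
  have hsplit : ∀ v, h (rootNbrSet H R v) = ind (rootNbrSet H R v = ∅) * h ∅ +
      ∑ b, ind (rootNbrSet H R v = rootSubset R (A b)) * h (rootSubset R (A b)) := by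
    intro v
    rcases hsymm v v.2 with hv | ⟨B, hB, hv⟩
    · have he := (hempty v).2 hv
      rw [he, ind_of_true rfl, one_mul, Finset.sum_eq_zero, add_zero]
      intro b _
      rw [ind_of_false, zero_mul]
      intro h'
      obtain ⟨u, hu⟩ := hne b
      have : (⟨u, hAR b hu⟩ : R) ∈ rootSubset R (A b : Finset V) := mem_rootSubset.2 hu
      rw [← h'] at this
      exact Finset.notMem_empty _ this
    · obtain ⟨b, hb⟩ := A.surjective ⟨B, hB⟩
      have hBA : (A b : Finset V) = B := congrArg Subtype.val hb
      have he : rootNbrSet H R v = rootSubset R (A b) :=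
        (hclass v b).2 fun u hu => ((hv u (hAR b hu)).2 (hBA ▸ hu)).symm
      rw [Finset.sum_eq_single b, ind_of_true he, one_mul, ind_of_false, zero_mul, zero_add, he]
      · intro h0
        obtain ⟨u, hu⟩ := hne b
        exact (hempty v).1 h0 u (hAR b hu) ((hv u (hAR b hu)).2 (hBA ▸ hu))
      · intro b' _ hbb
        rw [ind_of_false, zero_mul]
        intro h'
        exact hbb (hinj b' b (h'.symm.trans he))
      · exact fun h' => absurd (Finset.mem_univ b) h'
  have hcount : ∀ (Q : V → Prop), (∑ v : {v // v ∉ R}, ind (Q v)) = ({v | v ∉ R ∧ Q v}.ncard : ℝ) := by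
    intro Q
    rw [← card_filter_eq_sum_ind, ← Finset.card_map (Function.Embedding.subtype _),
      Set.ncard_eq_toFinset_card']
    congr 2
    ext v
    simp
    tauto
  simp only [hsplit]
  rw [Finset.sum_add_distrib, ← Finset.sum_mul, Finset.sum_comm]
  congr 1
  · congr 1
    rw [numFree, ← hcount fun v => ∀ u ∈ R, ¬ H.Adj u v]
    exact Finset.sum_congr rfl fun v _ => ind_congr (by simp only [hempty v, H.adj_comm])
  · refine Finset.sum_congr rfl fun b _ => ?_
    rw [← Finset.sum_mul, numCommonNbrs, ← hcount fun v => ∀ u ∈ (A b : Finset V), H.Adj u v]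
    congr 1
    exact Finset.sum_congr rfl fun v _ => ind_congr (hclass v b)

lemma card_innerEdges (H : SimpleGraph V) (R : Finset V) :
    (innerEdges H R).card = numInnerEdges H R := by
  classical
  have h1 : {e ∈ H.edgeSet | ∀ v ∈ e, v ∉ R} =
      Sym2.map (Subtype.val : {v // v ∉ R} → V) '' (innerEdges H R : Set (Sym2 {v // v ∉ R})) := by
    ext e
    constructor
    · rintro ⟨he, hR⟩
      induction e with | _ x y => ?_
      exact ⟨s(⟨x, hR x (Sym2.mem_mk_left _ _)⟩, ⟨y, hR y (Sym2.mem_mk_right _ _)⟩),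
        mk_mem_innerEdges.2 he, rfl⟩
    · rintro ⟨e, he, rfl⟩
      induction e with | _ x y => ?_
      refine ⟨mk_mem_innerEdges.1 he, fun v hv => ?_⟩
      rcases Sym2.mem_iff.1 hv with rfl | rfl
      · exact x.2
      · exact y.2
  rw [numInnerEdges, h1, Set.ncard_image_of_injective _ (Sym2.map.injective Subtype.val_injective),
    Set.ncard_coe_finset]

omit [DecidableEq V] in
lemma numRootedAut_pos (H : SimpleGraph V) (R : Finset V) : 0 < numRootedAut H R := by
  have : Finite (H ≃g H) := Finite.of_injective (fun σ => (σ : V → V)) DFunLike.coe_injective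
  have : Nonempty {σ : H ≃g H // ∀ u ∈ R, σ u = u} := ⟨⟨RelIso.refl _, fun _ _ => rfl⟩⟩
  exact Nat.card_pos

variable {r : ℕ} {k m : Fin r → ℕ}

/-- In a regular configuration, the extension counts are determined by the numbers of common
neighbours of the images of the classes, up to a small error. -/
lemma abs_extCount_sub_le {p : ℝ} (hp : p ∈ Set.Icc (0 : ℝ) 1) (hR : R.Nonempty)
    (hground : IsFullyGrounded H R) (hsymm : IsSymmetricWith H R P)
    (A : (Σ i : Fin r, Fin (m i)) ≃ P.parts) (hA : ∀ i j, (A ⟨i, j⟩ : Finset V).card = k i)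
    (g : (i : Fin r) → Fin (m i) → ℕ) (hg : ∀ i j, g i j = numCommonNbrs H R (A ⟨i, j⟩)) :
    ∃ C : ℝ, ∀ᶠ n : ℕ in atTop, ∀ ω : Sym2 (Fin n) → Bool, Regular p (Fintype.card V) ω →
      ∀ T : R ↪ Fin n,
        |(extCount H R (graphOf ω) T : ℝ) -
          prefactor (numFree H R) (numInnerEdges H R) (numRootedAut H R) (fun i => ∑ j, g i j) p n *
            (n * p ^ (∑ i, k i * ∑ j, g i j) + ∑ i, ∑ j, g i j *
              p ^ ((∑ i, k i * ∑ j, g i j) - k i) *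
                (codeg ω ((rootSubset R (A ⟨i, j⟩)).map T) - n * p ^ k i))| ≤
          C * (n : ℝ) ^ ((numFree H R + ∑ i, ∑ j, g i j) - 1) * eighthRoot n ^ 2 := by
  obtain ⟨C, hC⟩ := abs_card_isRootedEmbedding_div_sub_le hp H R
  have hAR : ∀ b, (A b : Finset V) ⊆ R := fun b => P.le (A b).2
  have hcard : ∀ i j, (rootSubset R (A ⟨i, j⟩ : Finset V)).card = k i := fun i j => by
    rw [card_rootSubset (hAR _), hA]
  have hsum : ∀ h : Finset R → ℝ, ∑ v, h (rootNbrSet H R v) =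
      numFree H R * h ∅ + ∑ i, ∑ j, g i j * h (rootSubset R (A ⟨i, j⟩)) := fun h => by
    rw [sum_comp_rootNbrSet hsymm A h, Fintype.sum_sigma]
    simp only [hg]
  have hd : Fintype.card {v // v ∉ R} = numFree H R + ∑ i, ∑ j, g i j := by
    have h1 := hsum fun _ => 1
    simp only [Finset.sum_const, Finset.card_univ, nsmul_eq_mul, mul_one] at h1
    exact_mod_cast h1
  have hK : ∑ v, (rootNbrSet H R v).card = ∑ i, k i * ∑ j, g i j := by
    have h1 := hsum fun J => J.card
    simp only [hcard, Finset.card_empty, Nat.cast_zero, mul_zero, zero_add] at h1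
    have h2 : ∑ v, (rootNbrSet H R v).card = ∑ i, ∑ j, g i j * k i := by exact_mod_cast h1
    rw [h2]
    refine Finset.sum_congr rfl fun i _ => ?_
    rw [← Finset.sum_mul, mul_comm]
  -- A root exists and has a non-root neighbour, so there is a non-root. This makes the truncated
  -- exponent d - 1 genuine.
  have hd1 : 0 < numFree H R + ∑ i, ∑ j, g i j := by
    rw [← hd, Fintype.card_pos_iff]
    obtain ⟨u, hu⟩ := hR
    obtain ⟨v, hv, -⟩ := hground u hu
    exact ⟨⟨v, hv⟩⟩
  set s := numFree H R with hs
  set f := numInnerEdges H R with hf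
  set c := numRootedAut H R with hcdef
  set d := s + ∑ i, ∑ j, g i j with hddef
  set K := ∑ i, k i * ∑ j, g i j with hKdef
  have hc : (0 : ℝ) < c := Nat.cast_pos.2 (numRootedAut_pos H R)
  refine ⟨C / c, ?_⟩
  filter_upwards [hC, eventually_gt_atTop 0] with n hn hn0 ω hω T
  have h1 := hn ω hω T
  rw [hd, hK, card_innerEdges, hsum fun J => p ^ (K - J.card) *
    ((codeg ω (J.map T) : ℝ) / n - p ^ J.card), ← extCount_mul_numRootedAut] at h1
  have hn0' : (0 : ℝ) < n := Nat.cast_pos.2 hn0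
  -- Every vertex is a common neighbour of the empty set, so non-roots without root neighbours
  -- contribute no fluctuation.
  have hempty : (codeg ω ((∅ : Finset R).map T) : ℝ) / n - p ^ (∅ : Finset R).card = 0 := by
    have : codeg ω ((∅ : Finset R).map T) = n := by
      rw [codeg, outDeg, Finset.map_empty, Finset.compl_empty, Finset.filter_true_of_mem
        fun v _ u hu => absurd hu (Finset.notMem_empty u), Finset.card_univ, Fintype.card_fin]
    rw [this, Finset.card_empty, pow_zero, div_self hn0'.ne', sub_self]
  rw [hempty, mul_zero, mul_zero, zero_add] at h1
  simp only [hcard] at h1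
  have hy8 : (n : ℝ) = eighthRoot n ^ 8 := (eighthRoot_pow n).symm
  have hy0 : 0 < eighthRoot n := by
    rw [eighthRoot]; positivity
  have hpow : (n : ℝ) ^ d = n ^ (d - 1) * n := by
    rw [← pow_succ, Nat.sub_add_cancel hd1]
  set X : ℝ := (extCount H R (graphOf ω) T : ℝ) with hX
  have hS : ∑ i, ∑ j, (g i j : ℝ) * p ^ (K - k i) *
      (codeg ω ((rootSubset R (A ⟨i, j⟩)).map T) - n * p ^ k i) =
      n * ∑ i, ∑ j, (g i j : ℝ) * (p ^ (K - k i) *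
      (codeg ω ((rootSubset R (A ⟨i, j⟩)).map T) / n - p ^ k i)) := by
    rw [Finset.mul_sum]
    refine Finset.sum_congr rfl fun i _ => ?_
    rw [Finset.mul_sum]
    refine Finset.sum_congr rfl fun j _ => ?_
    field_simp
  rw [hS, prefactor]
  set S := ∑ i, ∑ j, (g i j : ℝ) * (p ^ (K - k i) *
      (codeg ω ((rootSubset R (A ⟨i, j⟩)).map T) / n - p ^ k i))
  have h2 : X - (n : ℝ) ^ (d - 1) * p ^ f / c * (n * p ^ K + n * S) =
      n ^ d / c * (((extCount H R (graphOf ω) T * c : ℕ) : ℝ) / n ^ d - p ^ f * (p ^ K + S)) := by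
    rw [hpow]
    push_cast
    field_simp
    ring
  rw [h2, abs_mul, abs_of_nonneg (by positivity)]
  calc (n : ℝ) ^ d / c * _ ≤ n ^ d / c * (C / eighthRoot n ^ 6) :=
        mul_le_mul_of_nonneg_left h1 (by positivity)
    _ = _ := by
        rw [hpow]
        nth_rewrite 2 [hy8]
        field_simp

end Classes

/-! ### Normalization and the rearrangement bound for the maximum. -/

section Maximum

open Topology

variable {r : ℕ} {m k : Fin r → ℕ}

/-- The linear map giving the limit law. -/
noncomputable def limitMap (p : ℝ) (k : Fin r → ℕ) (g : ∀ i, Fin (m i) → ℕ)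
    (x : ∀ i, Fin (m i) → ℝ) : ℝ :=
  ∑ i, √((1 - p ^ k i) / (k i * p ^ k i)) * ∑ j, (g i j : ℝ) * x i j

lemma continuous_limitMap (p : ℝ) (k : Fin r → ℕ) (g : ∀ i, Fin (m i) → ℕ) :
    Continuous (limitMap p k g) := by
  unfold limitMap; fun_prop

/-- Identifies the contribution of one unit of normalized codegree with b_n times the corresponding
coefficient of the limit, up to the common prefactor. -/
lemma pow_sub_mul_spread {p : ℝ} (hp0 : 0 < p) {k K : ℕ} (hk : k ≤ K) (hk0 : 0 < k) (n : ℕ) :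
    p ^ (K - k) * spread k (p ^ k) n =
      √(n / (2 * Real.log n)) * p ^ K * √((1 - p ^ k) / (k * p ^ k)) := by
  have hq : 0 < p ^ k := pow_pos hp0 k
  have h1 : spread k (p ^ k) n =
      √(n / (2 * Real.log n)) * (p ^ k * √((1 - p ^ k) / (k * p ^ k))) := by
    have h2 : p ^ k * √((1 - p ^ k) / (k * p ^ k)) = √(p ^ k * (1 - p ^ k) / k) := by
      nth_rw 1 [← Real.sqrt_sq hq.le]
      rw [← Real.sqrt_mul (by positivity)]
      congr 1
      field_simp
    have h3 : 0 ≤ (n : ℝ) / (2 * Real.log n) :=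
      div_nonneg (by positivity) (mul_nonneg (by norm_num) (Real.log_natCast_nonneg n))
    rw [h2, ← Real.sqrt_mul h3, spread]
    congr 1
    rw [div_mul_div_comm]
    congr 1
    ring
  have h4 : p ^ K = p ^ (K - k) * p ^ k := by rw [← pow_add, Nat.sub_add_cancel hk]
  rw [h1, h4]
  ring

/-- Each count splits into the deviation of `center` from its mean, whose weighted sum gives the
second term of a_n, and `spread` times its normalized value, which gives b_n times the limit form by
`pow_sub_mul_spread`. -/
lemma prefactor_mul_eq_centering_add {p : ℝ} (hp0 : 0 < p) (hp1 : p < 1) (hk0 : ∀ i, 0 < k i)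
    (s f c : ℕ) (g : ∀ i, Fin (m i) → ℕ) {n : ℕ} (hn : 1 < n)
    (l : (Σ i : Fin r, Fin (m i)) → ℕ) :
    prefactor s f c (fun i => ∑ j, g i j) p n *
      (n * p ^ (∑ i, k i * ∑ j, g i j) + ∑ i, ∑ j, g i j *
        p ^ ((∑ i, k i * ∑ j, g i j) - k i) * (l ⟨i, j⟩ - n * p ^ k i)) =
    centering s f c k (fun i => ∑ j, g i j) p n +
      scaling s f c k (fun i => ∑ j, g i j) p n * limitMap p k g (normalized p k n l) := by
  rw [centering, scaling, mul_assoc (prefactor s f c _ p n), mul_assoc (prefactor s f c _ p n),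
    ← mul_add, add_assoc]
  congr 2
  rw [limitMap, Finset.mul_sum, Finset.mul_sum, ← Finset.sum_add_distrib]
  refine Finset.sum_congr rfl fun i _ => ?_
  set K := ∑ i, k i * ∑ j, g i j with hK
  -- If no weight belongs to this size, `k i` may exceed `K` and the subtraction in the exponent
  -- truncates, but then all the terms vanish.
  by_cases hg : ∑ j, g i j = 0
  · have : ∀ j, g i j = 0 := fun j => (Finset.sum_eq_zero_iff.1 hg) j (Finset.mem_univ _)
    simp [this]
  have hkK : k i ≤ K := by
    refine le_trans ?_ (Finset.single_le_sum (f := fun i => k i * ∑ j, g i j)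
      (fun _ _ => Nat.zero_le _) (Finset.mem_univ i))
    exact Nat.le_mul_of_pos_right _ (Nat.pos_of_ne_zero hg)
  have hq0 : 0 < p ^ k i := pow_pos hp0 _
  have hq1 : p ^ k i < 1 := pow_lt_one₀ hp0.le hp1 (hk0 i).ne'
  have hw : 0 < spread (k i) (p ^ k i) n := by
    have h1 := Real.log_pos (x := n) (by exact_mod_cast hn)
    have h2 : 0 < n := by omega
    have h3 : 0 < 1 - p ^ k i := by linarith
    have h4 := hk0 i
    exact Real.sqrt_pos.2 (by positivity)
  have hl : ∀ j, (l ⟨i, j⟩ : ℝ) - n * p ^ k i = (center (k i) (p ^ k i) n - n * p ^ k i) +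
      spread (k i) (p ^ k i) n * normalized p k n l i j := fun j => by
    rw [normalized, mul_div_cancel₀ _ hw.ne']; ring
  simp only [hl, mul_add, Finset.sum_add_distrib]
  congr 1
  · rw [← Finset.sum_mul, ← Finset.sum_mul, center]
    push_cast
    ring
  · rw [← mul_assoc, ← pow_sub_mul_spread hp0 hkK (hk0 i), Finset.mul_sum]
    exact Finset.sum_congr rfl fun j _ => by ring

variable [∀ i, NeZero (m i)] {α : Type*} [Fintype α] [DecidableEq α]
  {A : (Σ i : Fin r, Fin (m i)) → Finset α}

omit [∀ i, NeZero (m i)] in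
lemma Separated.antitone {c : ℕ} {l : (Σ i : Fin r, Fin (m i)) → ℕ} (hl : Separated c l)
    (i : Fin r) : Antitone fun j => l ⟨i, j⟩ := fun j j' hj => by
  rcases hj.eq_or_lt with rfl | hj
  · exact le_rfl
  · have := hl i j j' hj; dsimp only; omega

omit [DecidableEq α] in
/-- The weighted numbers of common neighbours are largest at the top sets in decreasing order. -/
lemma TopSets.sum_mul_codeg_le {W : Type*} [Fintype W] [DecidableEq W] {T : α ↪ W}
    {l : (Σ i : Fin r, Fin (m i)) → ℕ} {ω : Sym2 W → Bool} (h : TopSets k A T l ω)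
    (hl : Separated (Fintype.card α) l) (hAk : ∀ i j, (A ⟨i, j⟩).card = k i)
    (hAi : Function.Injective A) (T' : α ↪ W) (i : Fin r) {g : Fin (m i) → ℕ} (hg : Antitone g) :
    ∑ j, g j * codeg ω ((A ⟨i, j⟩).map T') ≤ ∑ j, g j * (l ⟨i, j⟩ + Fintype.card α) := by
  classical
  have hinj : ∀ (S : α ↪ W) (j j' : Fin (m i)),
      (A ⟨i, j⟩).map S = (A ⟨i, j'⟩).map S → j = j' := fun S j j' hj =>
    eq_of_heq (Sigma.mk.inj (hAi (Finset.map_injective S hj))).2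
  -- The classes that `T'` sends to some top set of the same size. On them the assignment is
  -- injective, and it is extended to a permutation of all indices.
  set s : Set (Fin (m i)) := {j | ∃ j', (A ⟨i, j⟩).map T' = (A ⟨i, j'⟩).map T} with hs
  set σ₀ : Fin (m i) → Fin (m i) := fun j =>
    if hj : ∃ j', (A ⟨i, j⟩).map T' = (A ⟨i, j'⟩).map T then hj.choose else j with hσ₀
  have hσ : ∀ j ∈ s, (A ⟨i, j⟩).map T' = (A ⟨i, σ₀ j⟩).map T := fun j hj => by
    have hj' : ∃ j', (A ⟨i, j⟩).map T' = (A ⟨i, j'⟩).map T := hj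
    simp only [hσ₀, dif_pos hj']
    exact hj'.choose_spec
  obtain ⟨e, he⟩ := Set.MapsTo.exists_equiv_extend_of_card_eq (t := Finset.univ) (s := s) (f := σ₀)
    (by simp) (fun _ _ => by simp) (fun j hj j' hj' hjj => by
      refine hinj T' j j' ?_
      rw [hσ j hj, hσ j' hj', hjj])
  set σ : Equiv.Perm (Fin (m i)) := e.trans (Equiv.subtypeUnivEquiv fun _ => Finset.mem_univ _)
    with hσe
  have hle : ∀ j, codeg ω ((A ⟨i, j⟩).map T') ≤ l ⟨i, σ j⟩ + Fintype.card α := fun j => by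
    by_cases hj : j ∈ s
    · have : σ j = σ₀ j := he j hj
      rw [this, hσ j hj]
      exact h.codeg_le _
    -- A class sent elsewhere has codegree below the last top value, hence below whichever one the
    -- extension assigns to it.
    · have h1 := h.2 i ((A ⟨i, j⟩).map T') (by rw [Finset.card_map, hAk])
        fun j' hj' => hj ⟨j', hj'⟩
      have h2 := hl.last_le i (σ j)
      dsimp only at h1
      omega
  -- Weights and top values are both decreasing in the index, so the identity is the best pairing.
  have hmono : Monovary g fun j => l ⟨i, j⟩ + Fintype.card α :=
    hg.monovary ((hl.antitone i).add_const _)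
  calc _ ≤ ∑ j, g j * (l ⟨i, σ j⟩ + Fintype.card α) :=
        Finset.sum_le_sum fun j _ => Nat.mul_le_mul_left _ (hle j)
    _ ≤ _ := hmono.sum_mul_comp_perm_le_sum_mul

/-- After division by the prefactor, the counting error is of order n^{1/4}, while b_n is of order
√(n / log n). -/
lemma tendsto_eighthRoot_sq_div :
    Tendsto (fun n : ℕ => eighthRoot n ^ 2 / √(n / (2 * Real.log n))) atTop (𝓝 0) := by
  have h1 := (((tendsto_log_pow_div 2).sqrt).const_mul 2).sqrt
  rw [Real.sqrt_zero, mul_zero, Real.sqrt_zero] at h1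
  refine h1.congr' ?_
  filter_upwards [eventually_gt_atTop 1, tendsto_eighthRoot.eventually_gt_atTop 0] with n hn hy
  have hlog := Real.log_pos (x := n) (by exact_mod_cast hn)
  have hn0 : (n : ℝ) = (eighthRoot n ^ 4) ^ 2 := by rw [← pow_mul, eighthRoot_pow]
  have h2 : √(Real.log n ^ 2 / n) = Real.log n / eighthRoot n ^ 4 := by
    rw [Real.sqrt_div (by positivity), Real.sqrt_sq hlog.le]
    congr 1
    nth_rw 1 [hn0]
    exact Real.sqrt_sq (by positivity)
  have h3 : eighthRoot n ^ 2 = √(eighthRoot n ^ 4) := by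
    rw [show eighthRoot n ^ 4 = (eighthRoot n ^ 2) ^ 2 by ring, Real.sqrt_sq (by positivity)]
  rw [h2, h3, ← Real.sqrt_div (by positivity)]
  congr 1
  have hn1 : (n : ℝ) = eighthRoot n ^ 8 := (eighthRoot_pow n).symm
  set y := eighthRoot n
  set L := Real.log n
  rw [hn1]
  field_simp

lemma tendsto_one_div_sqrt :
    Tendsto (fun n : ℕ => 1 / √((n : ℝ) / (2 * Real.log n))) atTop (𝓝 0) := by
  refine squeeze_zero' (Eventually.of_forall fun n => by positivity) ?_ tendsto_eighthRoot_sq_div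
  filter_upwards [tendsto_eighthRoot.eventually_ge_atTop 1] with n hn
  gcongr
  exact one_le_pow₀ hn

end Maximum

/-! ### The maximal extension count in terms of the top codegrees. -/

section Limit

open Topology

variable {V : Type*} [Fintype V] [DecidableEq V] {H : SimpleGraph V} {R : Finset V}
  {P : Finpartition R} {r : ℕ} {k m : Fin r → ℕ} [∀ i, NeZero (m i)]

omit [Fintype V] in
lemma class_card_pos (A : (Σ i : Fin r, Fin (m i)) ≃ P.parts)
    (hA : ∀ i j, (A ⟨i, j⟩ : Finset V).card = k i) (i : Fin r) : 0 < k i := by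
  rw [← hA i (lastIdx (m i))]
  exact Finset.card_pos.2 (P.nonempty_of_mem_parts (A _).2)

omit [Fintype V] [∀ i, NeZero (m i)] in
lemma rootSubset_class_injective (A : (Σ i : Fin r, Fin (m i)) ≃ P.parts) :
    Function.Injective fun b => rootSubset R (A b) := fun b b' h => by
  have h : rootSubset R (A b) = rootSubset R (A b') := h
  refine A.injective (Subtype.ext (Finset.ext fun u => ?_))
  have hR : ∀ b, (A b : Finset V) ⊆ R := fun b => P.le (A b).2
  exact ⟨fun hu => (mem_rootSubset (u := ⟨u, hR _ hu⟩)).1 (h ▸ mem_rootSubset.2 hu),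
    fun hu => (mem_rootSubset (u := ⟨u, hR _ hu⟩)).1 (h ▸ mem_rootSubset.2 hu)⟩

/-- In a regular configuration, the maximal extension count is determined by the largest numbers of
common neighbours. -/
lemma abs_maxExtCount_sub_le {p : ℝ} (hp0 : 0 < p) (hp1 : p < 1) (hR : R.Nonempty)
    (hground : IsFullyGrounded H R) (hsymm : IsSymmetricWith H R P)
    (A : (Σ i : Fin r, Fin (m i)) ≃ P.parts) (hA : ∀ i j, (A ⟨i, j⟩ : Finset V).card = k i)
    (g : (i : Fin r) → Fin (m i) → ℕ) (hg : ∀ i j, g i j = numCommonNbrs H R (A ⟨i, j⟩))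
    (hg_anti : ∀ i, Antitone (g i)) :
    ∃ δ : ℕ → ℝ, Tendsto δ atTop (𝓝 0) ∧ ∀ᶠ n : ℕ in atTop, ∀ ω : Sym2 (Fin n) → Bool,
      Regular p (Fintype.card V) ω → ∀ (T : R ↪ Fin n) (l : (Σ i : Fin r, Fin (m i)) → ℕ),
      Separated (Fintype.card R) l → TopSets k (fun b => rootSubset R (A b)) T l ω →
        |((maxExtCount H R (graphOf ω) : ℝ) -
            centering (numFree H R) (numInnerEdges H R) (numRootedAut H R) k
              (fun i => ∑ j, g i j) p n) /
            scaling (numFree H R) (numInnerEdges H R) (numRootedAut H R) k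
              (fun i => ∑ j, g i j) p n - limitMap p k g (normalized p k n l)| ≤ δ n := by
  obtain ⟨C, hC⟩ := abs_extCount_sub_le ⟨hp0.le, hp1.le⟩ hR hground hsymm A hA g hg
  set s := numFree H R
  set f := numInnerEdges H R
  set c := numRootedAut H R
  set G : Fin r → ℕ := fun i => ∑ j, g i j with hG
  set K : ℕ := ∑ i, k i * ∑ j, g i j with hK
  have hc : (0 : ℝ) < c := Nat.cast_pos.2 (numRootedAut_pos H R)
  set D : ℝ := ∑ i, ∑ j, g i j * p ^ (K - k i) * Fintype.card R with hD
  have hD0 : 0 ≤ D := Finset.sum_nonneg fun i _ => Finset.sum_nonneg fun j _ => by positivity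
  have hcard : ∀ i j, (rootSubset R (A ⟨i, j⟩ : Finset V)).card = k i := fun i j => by
    rw [card_rootSubset (P.le (A _).2), hA]
  refine ⟨fun n => C * c / p ^ (f + K) * (eighthRoot n ^ 2 / √(n / (2 * Real.log n))) +
    D / p ^ K * (1 / √(n / (2 * Real.log n))), ?_, ?_⟩
  · simpa using (tendsto_eighthRoot_sq_div.const_mul (C * c / p ^ (f + K))).add
      (tendsto_one_div_sqrt.const_mul (D / p ^ K))
  filter_upwards [hC, eventually_gt_atTop 1] with n hn hn1 ω hω T l hl hT
  have hlog := Real.log_pos (x := n) (by exact_mod_cast hn1)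
  have hn0 : (0 : ℝ) < n := by positivity
  have hpre : 0 < prefactor s f c G p n := by unfold prefactor; positivity
  have hs : 0 < √((n : ℝ) / (2 * Real.log n)) := Real.sqrt_pos.2 (by positivity)
  have hb : 0 < scaling s f c k G p n := by unfold scaling; positivity
  set E : ℝ := C * (n : ℝ) ^ ((s + ∑ i, ∑ j, g i j) - 1) * eighthRoot n ^ 2 with hE
  set main : ((Σ i : Fin r, Fin (m i)) → ℝ) → ℝ := fun l => prefactor s f c G p n *
    (n * p ^ K + ∑ i, ∑ j, g i j * p ^ (K - k i) * (l ⟨i, j⟩ - n * p ^ k i)) with hmain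
  have hmain_l : main (fun b => l b) = centering s f c k G p n +
      scaling s f c k G p n * limitMap p k g (normalized p k n l) :=
    prefactor_mul_eq_centering_add hp0 hp1 (class_card_pos A hA) s f c g hn1 l
  have hX : ∀ T' : R ↪ Fin n, |(extCount H R (graphOf ω) T' : ℝ) -
      main (fun b => codeg ω ((rootSubset R (A b)).map T'))| ≤ E := hn ω hω
  -- The tuple `T` itself nearly attains the maximum, since its codegrees dominate `l` and the
  -- coefficients are nonnegative.
  have hlow : main (fun b => l b) ≤ main (fun b => codeg ω ((rootSubset R (A b)).map T)) := by
    simp only [hmain]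
    gcongr with i _ j _
    exact hT.le_codeg ⟨i, j⟩
  -- No other tuple does better by more than the bounded discrepancy between outer and full
  -- codegrees. The order of the `g i j` enters here.
  have hup : ∀ T' : R ↪ Fin n, main (fun b => codeg ω ((rootSubset R (A b)).map T')) ≤
      main (fun b => l b) + prefactor s f c G p n * D := fun T' => by
    simp only [hmain]
    rw [← mul_add, add_assoc]
    refine mul_le_mul_of_nonneg_left (add_le_add le_rfl ?_) hpre.le
    rw [hD, ← Finset.sum_add_distrib]
    refine Finset.sum_le_sum fun i _ => ?_
    have h1 : ((∑ j, g i j * codeg ω ((rootSubset R (A ⟨i, j⟩)).map T') : ℕ) : ℝ) ≤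
        (∑ j, g i j * (l ⟨i, j⟩ + Fintype.card R) : ℕ) := Nat.cast_le.2
      (hT.sum_mul_codeg_le hl hcard (rootSubset_class_injective A) T' i (hg_anti i))
    push_cast at h1
    have h2 := mul_le_mul_of_nonneg_left h1 (pow_pos hp0 (K - k i)).le
    rw [Finset.mul_sum, Finset.mul_sum] at h2
    rw [← Finset.sum_add_distrib]
    have h3 := sub_le_sub_right h2 (∑ j, g i j * p ^ (K - k i) * (n * p ^ k i))
    rw [← Finset.sum_sub_distrib, ← Finset.sum_sub_distrib] at h3
    calc _ = _ := Finset.sum_congr rfl fun j _ => by ring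
      _ ≤ _ := h3
      _ = _ := Finset.sum_congr rfl fun j _ => by ring
  have habs : |(maxExtCount H R (graphOf ω) : ℝ) - main (fun b => l b)| ≤
      E + prefactor s f c G p n * D := by
    have hPD : 0 ≤ prefactor s f c G p n * D := by positivity
    rw [abs_le]
    constructor
    · have h1 : (extCount H R (graphOf ω) T : ℝ) ≤ maxExtCount H R (graphOf ω) := Nat.cast_le.2
        (Finset.le_sup (f := fun T : R ↪ Fin n => extCount H R (graphOf ω) T) (Finset.mem_univ T))
      have := (abs_le.1 (hX T)).1
      linarith
    · obtain ⟨T', -, hT'⟩ := Finset.exists_mem_eq_sup Finset.univ ⟨T, Finset.mem_univ _⟩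
        fun T : R ↪ Fin n => extCount H R (graphOf ω) T
      have h1 : (maxExtCount H R (graphOf ω) : ℝ) = extCount H R (graphOf ω) T' := by
        rw [maxExtCount, hT']
      have := (abs_le.1 (hX T')).2
      have := hup T'
      linarith
  have hscale : (maxExtCount H R (graphOf ω) - centering s f c k G p n) / scaling s f c k G p n -
      limitMap p k g (normalized p k n l) =
      (maxExtCount H R (graphOf ω) - main (fun b => l b)) / scaling s f c k G p n := by
    rw [hmain_l]; field_simp; ring
  rw [hscale, abs_div, abs_of_pos hb, div_le_iff₀ hb]
  refine habs.trans (le_of_eq ?_)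
  rw [hE, scaling, prefactor]
  change _ = _ * ((n : ℝ) ^ ((s + ∑ i, ∑ j, g i j) - 1) * p ^ f / c *
    √((n : ℝ) / (2 * Real.log n)) * p ^ K)
  simp only [hG, pow_add]
  field_simp

/-- The lower bound for the probability that the normalized maximum lies in an open set. -/
lemma le_liminf_maxExtCount {p : unitInterval} (hp0 : 0 < p) (hp1 : p < 1) (hR : R.Nonempty)
    (hground : IsFullyGrounded H R) (hsymm : IsSymmetricWith H R P) (hk : StrictMono k)
    (A : (Σ i : Fin r, Fin (m i)) ≃ P.parts) (hA : ∀ i j, (A ⟨i, j⟩ : Finset V).card = k i)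
    (g : (i : Fin r) → Fin (m i) → ℕ) (hg : ∀ i j, g i j = numCommonNbrs H R (A ⟨i, j⟩))
    (hg_anti : ∀ i, Antitone (g i)) {U : Set ℝ} (hU : IsOpen U) :
    Measure.pi (fun i => orderedGumbel (m i)) (limitMap p k g ⁻¹' U) ≤
      liminf (fun n => SimpleGraph.binomialRandom (Fin n) p {G |
        ((maxExtCount H R G : ℝ) - centering (numFree H R) (numInnerEdges H R) (numRootedAut H R) k
              (fun i => ∑ j, g i j) p n) /
            scaling (numFree H R) (numInnerEdges H R) (numRootedAut H R) k
              (fun i => ∑ j, g i j) p n ∈ U}) atTop := by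
  have hp0' : (0 : ℝ) < p := hp0
  have hp1' : (p : ℝ) < 1 := hp1
  have hpI : (p : ℝ) ∈ Set.Icc (0 : ℝ) 1 := p.2
  obtain ⟨δ, hδ, hn⟩ := abs_maxExtCount_sub_le hp0' hp1' hR hground hsymm A hA g hg hg_anti
  obtain ⟨φ, hφ⟩ := exists_class_index A
  have hcard : ∀ i j, (rootSubset R (A ⟨i, j⟩ : Finset V)).card = k i := fun i j => by
    rw [card_rootSubset (P.le (A _).2), hA]
  have hcont := continuous_limitMap (p : ℝ) k g
  have h1 := le_liminf_topSets hp0' hp1' hk.injective (class_card_pos A hA) hcard hφ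
    (hU.preimage hcont).measurableSet
    -- Points whose image keeps distance `δ n` from the complement of `U`, so that the error in the
    -- maximum cannot leave `U`. Any sequence converging to a point of the open preimage eventually
    -- satisfies this.
    (fun n => {y | Metric.closedBall (limitMap (p : ℝ) k g y) (δ n) ⊆ U}) fun x hx y hy => by
      obtain ⟨ε, hε, hεU⟩ := Metric.isOpen_iff.1 hU _ hx
      have h2 := Metric.tendsto_nhds.1 ((hcont.tendsto x).comp hy) (ε / 2) (half_pos hε)
      filter_upwards [h2, hδ.eventually_lt_const (half_pos hε)] with n h3 h4 z hz
      refine hεU ?_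
      have h5 := dist_triangle z (limitMap (p : ℝ) k g (y n)) (limitMap (p : ℝ) k g x)
      have h6 := Metric.mem_closedBall.1 hz
      rw [Metric.mem_ball]
      simp only [Function.comp_apply] at h3
      linarith
  have h2 : ∀ n (S : Set (SimpleGraph (Fin n))), SimpleGraph.binomialRandom (Fin n) p S =
      ENNReal.ofReal (pr (p : ℝ) fun ω => graphOf ω ∈ S) := fun n S => by
    rw [pr_graphOf_mem, ofReal_measureReal]
  simp only [h2]
  refine le_liminf_ofReal_of_le_add (tendsto_pr_not_regular hpI (Fintype.card V)) ?_ h1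
  filter_upwards [hn] with n hn
  refine (pr_mono hpI fun ω hω => ?_).trans (pr_or_le hpI _ _)
  by_cases hreg : Regular (p : ℝ) (Fintype.card V) ω
  · obtain ⟨T, l, hl, hy, hT⟩ := hω
    refine Or.inl (hy ?_)
    rw [Metric.mem_closedBall, Real.dist_eq]
    exact hn ω hreg T l hl hT
  · exact Or.inr hreg

end Limit

end RootedGraph

/-! ### Convergence in distribution. -/

theorem mainTheorem1 {V : Type*} [Fintype V] [DecidableEq V]
    (H : SimpleGraph V) (R : Finset V) (hR : R.Nonempty)
    (hground : RootedGraph.IsFullyGrounded H R)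
    -- the root classes
    (P : Finpartition R) (hsymm : RootedGraph.IsSymmetricWith H R P)
    -- their enumeration: `A ⟨i, j⟩` is the `j`-th of the `m i` classes of size `k i`
    (r : ℕ) (k m : Fin r → ℕ) [∀ i, NeZero (m i)] (hk : StrictMono k)
    (A : (Σ i : Fin r, Fin (m i)) ≃ P.parts)
    (hA : ∀ i j, (A ⟨i, j⟩ : Finset V).card = k i)
    (g : (i : Fin r) → Fin (m i) → ℕ)
    (hg : ∀ i j, g i j = RootedGraph.numCommonNbrs H R (A ⟨i, j⟩))
    (hg_anti : ∀ i, Antitone (g i))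
    (p : unitInterval) (hp0 : 0 < p) (hp1 : p < 1)
    (a b : ℕ → ℝ)
    (ha : a = RootedGraph.centering (RootedGraph.numFree H R) (RootedGraph.numInnerEdges H R)
      (RootedGraph.numRootedAut H R) k (fun i => ∑ j, g i j) p)
    (hb : b = RootedGraph.scaling (RootedGraph.numFree H R) (RootedGraph.numInnerEdges H R)
      (RootedGraph.numRootedAut H R) k (fun i => ∑ j, g i j) p) :
    (∀ i, IsProbabilityMeasure (RootedGraph.orderedGumbel (m i))) ∧
    ∀ {Ω : Type*} [MeasurableSpace Ω] (μ : Measure Ω) [IsProbabilityMeasure μ]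
      (η : (i : Fin r) → Ω → Fin (m i) → ℝ),
      (∀ i, HasLaw (η i) (RootedGraph.orderedGumbel (m i)) μ) → iIndepFun η μ →
      TendstoInDistribution
        (fun (n : ℕ) (G : SimpleGraph (Fin n)) =>
          ((RootedGraph.maxExtCount H R G : ℝ) - a n) / b n)
        atTop
        (fun ω => ∑ i, √((1 - (p : ℝ) ^ k i) / (k i * (p : ℝ) ^ k i)) *
          ∑ j, (g i j : ℝ) * η i ω j)
        (fun n => SimpleGraph.binomialRandom (Fin n) p) μ := by
  subst ha hb
  refine ⟨fun i => inferInstance, fun {Ω} _ μ _ η hη hindep => ?_⟩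
  -- Independence makes the joint law the product of the ordered Gumbel measures, the measure in the
  -- liminf bounds.
  have hlaw := hindep.hasLaw_pi hη
  have hcont := RootedGraph.continuous_limitMap (p : ℝ) k g
  have hZ : AEMeasurable (fun ω => RootedGraph.limitMap (p : ℝ) k g fun i => η i ω) μ :=
    hcont.measurable.comp_aemeasurable hlaw.aemeasurable
  have hmeas : ∀ n (f : SimpleGraph (Fin n) → ℝ), Measurable f := fun n f S _ =>
    RootedGraph.measurableSet_simpleGraph _
  refine ⟨fun n => (hmeas n _).aemeasurable, hZ, ?_⟩
  -- The portmanteau criterion: for probability measures, liminf bounds on open sets imply weak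
  -- convergence, so no matching upper bound is required.
  refine tendsto_of_forall_isOpen_le_liminf_nat' fun U hU => ?_
  simp only [ProbabilityMeasure.coe_mk]
  have h1 : μ.map (fun ω => RootedGraph.limitMap (p : ℝ) k g fun i => η i ω) U =
      Measure.pi (fun i => RootedGraph.orderedGumbel (m i))
        (RootedGraph.limitMap (p : ℝ) k g ⁻¹' U) := by
    rw [← hlaw.map_eq, Measure.map_apply_of_aemeasurable hZ hU.measurableSet,
      Measure.map_apply_of_aemeasurable hlaw.aemeasurable (hU.preimage hcont).measurableSet]
    rfl
  refine (le_of_eq h1).trans ((RootedGraph.le_liminf_maxExtCount hp0 hp1 hR hground hsymm hk A hA g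
    hg hg_anti hU).trans (le_of_eq ?_))
  congr 1
  funext n
  rw [Measure.map_apply (hmeas n _) hU.measurableSet]
  rfl
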